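/- Conventions. All manifolds are smooth, Hausdorff, second countable and connected, and have dimension $d+1$. A timelike curve is a piecewise smooth curve whose (one-sided) tangent vectors are all timelike, the left- and right-sided tangent vectors at each break point lying in the same component of the timelike cone. A Cauchy hypersurface of a Lorentzian manifold is a subset met exactly once by every inextendible timelike curve, and the manifold is globally hyperbolic if it possesses one. For a subset $S$ of a time-oriented Lorentzian manifold $M$, $I^+(S,M)$ is the set of end points of future directed timelike curves in $M$ starting in $S$. A $C^0$-extension of a smooth Lorentzian manifold $(M,g)$ consists of a Lorentzian manifold $(\tilde M,\tilde g)$ of the same dimension with $\tilde g$ continuous, together with a smooth isometric embedding $\iota:M\hookrightarrow\tilde M$ whose image is a proper subset of $\tilde M$. If $(M,g)$ is time-oriented, the future boundary $\partial^+\iota(M)$ is the set of all $p\in\partial\iota(M)$ for which there is a timelike curve $\tilde\gamma:[-1,0]\to\tilde M$ with $\tilde\gamma([-1,0))\subseteq\iota(M)$, $\tilde\gamma(0)=p$, and $\iota^{-1}\circ\tilde\gamma|_{[-1,0)}$ future directed in $M$. Proposition 2.2. Let $(M,g)$ be a time-oriented, globally hyperbolic, smooth Lorentzian manifold of dimension $d+1$,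 let $\iota:M\hookrightarrow\tilde M$ be a $C^0$-extension of $(M,g)$, and let $p\in\partial^+\iota(M)$. For every $\delta>0$ there exist $\varepsilon_0,\varepsilon_1>0$ and a smooth chart $\tilde\varphi:\tilde U\to(-\varepsilon_0,\varepsilon_0)\times(-\varepsilon_1,\varepsilon_1)^d$ of $\tilde M$, onto the box, with the following properties: (i) $p\in\tilde U$ and $\tilde\varphi(p)=(0,\dots,0)$; (ii) $|\tilde g_{\mu\nu}-m_{\mu\nu}|<\delta$ on the box for all $\mu,\nu$, where $\tilde g_{\mu\nu}$ are the components of $\tilde g$ in the chart and $m_{\mu\nu}=\mathrm{diag}(-1,1,\dots,1)$; (iii) there is a Lipschitz continuous function $f:(-\varepsilon_1,\varepsilon_1)^d\to(-\varepsilon_0,\varepsilon_0)$ such that $$\{(x_0,\underline x)\in(-\varepsilon_0,\varepsilon_0)\times(-\varepsilon_1,\varepsilon_1)^d : x_0<f(\underline x)\}\subseteq\tilde\varphi\big(\iota(M)\cap\tilde U\big),$$ $$\{(x_0,\underline x)\in(-\varepsilon_0,\varepsilon_0)\times(-\varepsilon_1,\varepsilon_1)^d : x_0=f(\underline x)\}\subseteq\tilde\varphi\big(\partial^+\iota(M)\cap\tilde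 U\big),$$ and the graph of $f$ is achronal in the box, i.e. no $\tilde g$-timelike curve within $\tilde U$ joins two points of $\tilde\varphi^{-1}(\mathrm{graph} f)$. Moreover, given any Cauchy hypersurface $\Sigma$ of $M$, the chart and $f$ can be chosen such that in addition $$\{(x_0,\underline x)\in(-\varepsilon_0,\varepsilon_0)\times(-\varepsilon_1,\varepsilon_1)^d : x_0<f(\underline x)\}\subseteq\tilde\varphi\big(\iota(I^+(\Sigma,M))\cap\tilde U\big).$$ -/

import Mathlib

open Set Filter Topology
open scoped Manifold ContDiff

noncomputable section

namespace C0Ext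

/-- The model space `ℝ^{d+1}` with coordinates `(x 0, x 1, …, x d)`. -/
abbrev Model (d : ℕ) : Type := EuclideanSpace ℝ (Fin (d + 1))

/-- The Minkowski components `m_{μν} = diag(-1, 1, …, 1)`. -/
def minkowski (d : ℕ) (μ ν : Fin (d + 1)) : ℝ :=
  if μ = ν then (if μ = 0 then -1 else 1) else 0

/-- A `C^n` Lorentzian metric of signature `(-, +, …, +)` on a `(d+1)`-dimensional manifold. -/
structure LorentzianMetric (d : ℕ) (n : WithTop ℕ∞) (M : Type*) [TopologicalSpace M]
    [ChartedSpace (Model d) M] [IsManifold (𝓡 (d + 1)) ∞ M] where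
  /-- the bilinear form on each tangent space -/
  val : ∀ x : M, TangentSpace (𝓡 (d + 1)) x →L[ℝ] TangentSpace (𝓡 (d + 1)) x →L[ℝ] ℝ
  symm : ∀ (x : M) (v w : TangentSpace (𝓡 (d + 1)) x), val x v w = val x w v
  /-- every tangent space has a basis that is orthonormal in the Lorentzian sense -/
  signature : ∀ x : M, ∃ b : Module.Basis (Fin (d + 1)) ℝ (TangentSpace (𝓡 (d + 1)) x),
    ∀ μ ν, val x (b μ) (b ν) = minkowski d μ ν
  contMDiff : ContMDiff (𝓡 (d + 1)) ((𝓡 (d + 1)).prod 𝓘(ℝ, Model d →L[ℝ] Model d →L[ℝ] ℝ)) n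
    (fun x ↦ Bundle.TotalSpace.mk' (Model d →L[ℝ] Model d →L[ℝ] ℝ) x (val x))

section Curves

variable {d : ℕ} {M : Type*} [TopologicalSpace M] [ChartedSpace (Model d) M]

/-- The right-sided tangent vector of `γ` at `t`. -/
def rightTangent (γ : ℝ → M) (t : ℝ) : TangentSpace (𝓡 (d + 1)) (γ t) :=
  mfderivWithin 𝓘(ℝ, ℝ) (𝓡 (d + 1)) γ (Ici t) t (1 : ℝ)

/-- The left-sided tangent vector of `γ` at `t`. -/
def leftTangent (γ : ℝ → M) (t : ℝ) : TangentSpace (𝓡 (d + 1)) (γ t) :=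
  mfderivWithin 𝓘(ℝ, ℝ) (𝓡 (d + 1)) γ (Iic t) t (1 : ℝ)

/-- `γ` is piecewise smooth on the interval `J`: around each parameter of `J` it is smooth, up to
and including that parameter, on either side. By compactness, this says that every compact
subinterval of `J` splits into finitely many closed intervals on each of which `γ` is smooth. -/
def PiecewiseSmoothOn (d : ℕ) {M : Type*} [TopologicalSpace M] [ChartedSpace (Model d) M]
    (γ : ℝ → M) (J : Set ℝ) : Prop :=
  ∀ t ∈ J, ∃ ε > 0, ContMDiffOn 𝓘(ℝ, ℝ) (𝓡 (d + 1)) ∞ γ (J ∩ Icc t (t + ε)) ∧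
    ContMDiffOn 𝓘(ℝ, ℝ) (𝓡 (d + 1)) ∞ γ (J ∩ Icc (t - ε) t)

variable [IsManifold (𝓡 (d + 1)) ∞ M] {n : WithTop ℕ∞}

/-- `γ`, restricted to the nondegenerate interval `J`, is a timelike curve: it is piecewise smooth,
its one-sided tangent vectors are timelike, and at each interior parameter the left- and right-sided
tangent vectors lie in the same component of the cone of timelike vectors (for timelike
`v`, `w` this means `g(v, w) < 0`). The values of `γ` outside `J` play no role. -/
structure IsTimelikeOn (g : LorentzianMetric d n M) (γ : ℝ → M) (J : Set ℝ) : Prop where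
  ordConnected : J.OrdConnected
  nontrivial : J.Nontrivial
  piecewiseSmooth : PiecewiseSmoothOn d γ J
  right_timelike : ∀ t ∈ J, (J ∩ Ioi t).Nonempty →
    g.val (γ t) (rightTangent γ t) (rightTangent γ t) < 0
  left_timelike : ∀ t ∈ J, (J ∩ Iio t).Nonempty →
    g.val (γ t) (leftTangent γ t) (leftTangent γ t) < 0
  same_cone : ∀ t ∈ J, (J ∩ Iio t).Nonempty → (J ∩ Ioi t).Nonempty →
    g.val (γ t) (leftTangent γ t) (rightTangent γ t) < 0

/-- A timelike curve on the interval `J` is inextendible if it has neither a future nor a past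
end point in `M`: `γ t` converges in `M` neither as `t` increases through `J` (to `sup J`) nor as
`t` decreases through `J` (to `inf J`). -/
def IsInextendibleOn (γ : ℝ → M) (J : Set ℝ) : Prop :=
  (¬ ∃ q, Tendsto (fun t : J ↦ γ t) atTop (𝓝 q)) ∧
    ¬ ∃ q, Tendsto (fun t : J ↦ γ t) atBot (𝓝 q)

/-- A Cauchy hypersurface: a set met exactly once by every inextendible timelike curve. -/
def IsCauchyHypersurface (g : LorentzianMetric d n M) (S : Set M) : Prop :=
  ∀ (γ : ℝ → M) (J : Set ℝ), IsTimelikeOn g γ J → IsInextendibleOn γ J →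
    ∃! t, t ∈ J ∧ γ t ∈ S

/-- Global hyperbolicity: existence of a Cauchy hypersurface. -/
def IsGloballyHyperbolic (g : LorentzianMetric d n M) : Prop :=
  ∃ S : Set M, IsCauchyHypersurface g S

/-- `A` is achronal in `U`: no timelike curve within `U` runs from a point of `A` to a point
of `A`. -/
def IsAchronalIn (g : LorentzianMetric d n M) (U A : Set M) : Prop :=
  ∀ γ : ℝ → M, IsTimelikeOn g γ (Icc 0 1) → (∀ t ∈ Icc (0 : ℝ) 1, γ t ∈ U) →
    γ 0 ∈ A → γ 1 ∉ A

/-- A time orientation, given by a continuous timelike vector field (declared to be future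
directed). -/
structure TimeOrientation (g : LorentzianMetric d n M) where
  field : ∀ x : M, TangentSpace (𝓡 (d + 1)) x
  continuous : Continuous (fun x ↦ (⟨x, field x⟩ : TangentBundle (𝓡 (d + 1)) M))
  timelike : ∀ x, g.val x (field x) (field x) < 0

/-- A timelike curve on `J` whose tangent vectors are future directed, i.e. lie in the same
component of the timelike cone as the time-orienting vector field. -/
structure IsFutureDirectedOn {g : LorentzianMetric d n M} (T : TimeOrientation g)
    (γ : ℝ → M) (J : Set ℝ) : Prop where
  isTimelikeOn : IsTimelikeOn g γ J
  right_future : ∀ t ∈ J, (J ∩ Ioi t).Nonempty →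
    g.val (γ t) (T.field (γ t)) (rightTangent γ t) < 0
  left_future : ∀ t ∈ J, (J ∩ Iio t).Nonempty →
    g.val (γ t) (T.field (γ t)) (leftTangent γ t) < 0

/-- The timelike (chronological) future `I⁺(S, M)` of a set. -/
def chronologicalFuture {g : LorentzianMetric d n M} (T : TimeOrientation g) (S : Set M) : Set M :=
  {q | ∃ γ : ℝ → M, IsFutureDirectedOn T γ (Icc 0 1) ∧ γ 0 ∈ S ∧ γ 1 = q}

end Curves

section Extensions

variable {d : ℕ} {M : Type*} [TopologicalSpace M] [ChartedSpace (Model d) M]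
  [IsManifold (𝓡 (d + 1)) ∞ M]
  {N : Type*} [TopologicalSpace N] [ChartedSpace (Model d) N] [IsManifold (𝓡 (d + 1)) ∞ N]

/-- `ι : M → N` is a `C⁰`-extension of the smooth Lorentzian manifold `(M, g)`: `(N, g')` is a
Lorentzian manifold of the same dimension with continuous metric, and `ι` is an isometric (smooth)
embedding onto a proper subset of `N`. -/
structure IsC0Extension (g : LorentzianMetric d ∞ M) (g' : LorentzianMetric d 0 N)
    (ι : M → N) : Prop where
  isSmoothEmbedding : Manifold.IsSmoothEmbedding (𝓡 (d + 1)) (𝓡 (d + 1)) ∞ ι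
  isometric : ∀ (x : M) (v w : TangentSpace (𝓡 (d + 1)) x),
    g'.val (ι x) (mfderiv (𝓡 (d + 1)) (𝓡 (d + 1)) ι x v)
      (mfderiv (𝓡 (d + 1)) (𝓡 (d + 1)) ι x w) = g.val x v w
  proper : range ι ≠ univ

/-- The future boundary `∂⁺ι(M)`: the points `p ∈ ∂ι(M)` for which there is a timelike curve
`γ' : [-1, 0] → N` ending at `p` which on `[-1, 0)` is the image under `ι` of a future directed
timelike curve `γ` of `M`. -/
def futureBoundary {g : LorentzianMetric d ∞ M} (T : TimeOrientation g)
    (g' : LorentzianMetric d 0 N) (ι : M → N) : Set N :=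
  {p | p ∈ frontier (range ι) ∧ ∃ γ' : ℝ → N, IsTimelikeOn g' γ' (Icc (-1) 0) ∧ γ' 0 = p ∧
    ∃ γ : ℝ → M, (∀ t ∈ Ico (-1 : ℝ) 0, ι (γ t) = γ' t) ∧ IsFutureDirectedOn T γ (Ico (-1) 0)}

/-- The component `g'_{μν}` of the metric with respect to the coordinates `φ`, at the point with
coordinates `x`. -/
def metricComponent (g' : LorentzianMetric d 0 N) (φ : OpenPartialHomeomorph N (Model d))
    (x : Model d) (μ ν : Fin (d + 1)) : ℝ :=
  letI : ChartedSpace (Model d) (Model d) := chartedSpaceSelf (Model d)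
  g'.val (φ.symm x)
    (mfderiv (𝓡 (d + 1)) (𝓡 (d + 1)) φ.symm x (EuclideanSpace.single μ (1 : ℝ) : Model d))
    (mfderiv (𝓡 (d + 1)) (𝓡 (d + 1)) φ.symm x (EuclideanSpace.single ν (1 : ℝ) : Model d))

/-- The spatial part `(x 1, …, x d)` of `x = (x 0, x 1, …, x d)`. -/
def spatial (x : Model d) : EuclideanSpace ℝ (Fin d) := WithLp.toLp 2 fun i ↦ x i.succ

/-- The cube `(-ε, ε)^d`. -/
def cube (d : ℕ) (ε : ℝ) : Set (EuclideanSpace ℝ (Fin d)) := {y | ∀ i, y i ∈ Ioo (-ε) ε}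

/-- The box `(-ε₀, ε₀) × (-ε₁, ε₁)^d` in `ℝ^{d+1}`. -/
def box (d : ℕ) (ε₀ ε₁ : ℝ) : Set (Model d) := {x | x 0 ∈ Ioo (-ε₀) ε₀ ∧ spatial x ∈ cube d ε₁}

/-- The part of the box strictly below the graph of `f`. -/
def belowGraph (ε₀ ε₁ : ℝ) (f : EuclideanSpace ℝ (Fin d) → ℝ) : Set (Model d) :=
  {x | x ∈ box d ε₀ ε₁ ∧ x 0 < f (spatial x)}

/-- The graph of `f` in the box. -/
def graphIn (ε₀ ε₁ : ℝ) (f : EuclideanSpace ℝ (Fin d) → ℝ) : Set (Model d) :=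
  {x | x ∈ box d ε₀ ε₁ ∧ x 0 = f (spatial x)}

/-- The smooth chart `φ : U → (-ε₀, ε₀) × (-ε₁, ε₁)^d` of `N` and the function
`f : (-ε₁, ε₁)^d → (-ε₀, ε₀)` (only its values on the cube matter) describe the future boundary
near `p`, with metric components that are `δ`-close to Minkowski. -/
structure IsBoundaryChart {g : LorentzianMetric d ∞ M} (T : TimeOrientation g)
    (g' : LorentzianMetric d 0 N) (ι : M → N) (p : N) (δ ε₀ ε₁ : ℝ)
    (φ : OpenPartialHomeomorph N (Model d)) (f : EuclideanSpace ℝ (Fin d) → ℝ) : Prop where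
  pos₀ : 0 < ε₀
  pos₁ : 0 < ε₁
  smooth : φ ∈ IsManifold.maximalAtlas (𝓡 (d + 1)) ∞ N
  target_eq : φ.target = box d ε₀ ε₁
  mem_source : p ∈ φ.source
  map_center : φ p = 0
  close : ∀ x ∈ box d ε₀ ε₁, ∀ μ ν, |metricComponent g' φ x μ ν - minkowski d μ ν| < δ
  mapsTo : ∀ y ∈ cube d ε₁, f y ∈ Ioo (-ε₀) ε₀
  lipschitz : ∃ K, LipschitzOnWith K f (cube d ε₁)
  below_subset : belowGraph ε₀ ε₁ f ⊆ φ '' (range ι ∩ φ.source)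
  graph_subset : graphIn ε₀ ε₁ f ⊆ φ '' (futureBoundary T g' ι ∩ φ.source)
  achronal : IsAchronalIn g' φ.source (φ.symm '' graphIn ε₀ ε₁ f)

end Extensions

end C0Ext

end

/-!
The argument is local near `p`, and it uses neither a solution theory for geodesics nor any
regularity of `g'` beyond continuity.

*Adapted chart.* A future boundary point `p` is the end point of a timelike curve `c` whose earlier
points lie in `ι(M)`. Lorentz orthonormal coordinates at `p` whose time axis is tangent to `c` can
be tilted slightly, so that the time axis becomes the secant from `c t` to `p` for a `t` close
to `0`. The box of half height equal to the distance of `c t` from `p` on this axis then has `c t`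
as the centre of its bottom. By continuity of `g'`, the metric is close to the Minkowski metric on
the box, and all directions in a fixed cone around `∂₀` are timelike. The curve in `M` has no
end point in `M`, so it enters the timelike future of the Cauchy hypersurface `Σ`, and for late `t`
the point `c t` has a neighbourhood in `ι(I⁺(Σ, M))`. For a sufficiently narrow box this
neighbourhood contains the part of the box near its bottom (`exists_adaptedBox`, with the
properties collected in `AdaptedBox`).

*The graph.* Let `G` be the set of points of the box for which the whole vertical segment down to
the bottom of the box lies in `ι(M)` (`subgraph`). It is open, and going up from the bottom shows
that it lies in `ι(I⁺(Σ, M))`. The key fact is `mem_subgraph_of_coneCurveOn`: a past directed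
timelike curve in the box that starts in `G` stays in `G`. Otherwise it would leave `G` at a point
that is not in `ι(M)`, as `G` is relatively closed in `ι(M)` (`mem_subgraph_of_mem_closure`). Up to
this point it would be a past inextendible timelike curve of `M`; such a curve meets the timelike
past of `Σ`, although its points in `G` lie in `ι(I⁺(Σ, M))`, which contradicts the achronality
of `Σ`. As the admissible directions contain a cone around `∂₀`, the
set `G` is the region below the graph of a Lipschitz function (`exitHeight`), and the same
fact, together with the openness of `G` and of the chronological relation, shows that no timelike
curve joins two points of the graph. The graph lies below the top of the box since `p ∉ ι(M)` is in
the past of all points near the top. A vertical segment ending on the graph shows that the points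
of the graph belong to the future boundary.

Timelike curves that are inextendible in one direction only can be compared with `Σ` because they
extend to inextendible ones (`exists_coneCurveOn_Ici_not_tendsto`).

A single notion of curve, `ConeCurveOn 𝒞`, covers timelike curves with either time orientation, in
`M` and in `N`: its one-sided tangent vectors lie in the subset `𝒞` of the tangent bundle.
-/

noncomputable section

namespace C0Ext

/-! ### Curves with tangent vectors in a given set -/

section ConeCurves

variable {d : ℕ} {M : Type*} [TopologicalSpace M] [ChartedSpace (Model d) M]
  {N : Type*} [TopologicalSpace N] [ChartedSpace (Model d) N]

/-- On the side `K` of the parameter `t` (in practice `Ici t` or `Iic t`), the curve `γ` is smooth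
near `t` and its one-sided tangent vector lies in the set `𝒞` of tangent vectors. -/
structure SideIn (𝒞 : Set (TangentBundle (𝓡 (d + 1)) M)) (γ : ℝ → M) (K : Set ℝ) (t : ℝ) :
    Prop where
  smooth : ∃ s ∈ 𝓝 t, ContMDiffOn 𝓘(ℝ, ℝ) (𝓡 (d + 1)) ∞ γ (K ∩ s)
  mem : tangentMapWithin 𝓘(ℝ, ℝ) (𝓡 (d + 1)) γ K ⟨t, (1 : ℝ)⟩ ∈ 𝒞

/-- `γ` is piecewise smooth on `J` with all one-sided tangent vectors in `𝒞`. At an end point of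
`J` only the side that points into `J` matters. -/
structure ConeCurveOn (𝒞 : Set (TangentBundle (𝓡 (d + 1)) M)) (γ : ℝ → M) (J : Set ℝ) : Prop where
  right : ∀ t ∈ J, (J ∩ Ioi t).Nonempty → SideIn 𝒞 γ (Ici t) t
  left : ∀ t ∈ J, (J ∩ Iio t).Nonempty → SideIn 𝒞 γ (Iic t) t

variable {𝒞 𝒟 : Set (TangentBundle (𝓡 (d + 1)) M)} {γ γ' : ℝ → M} {K J : Set ℝ} {t : ℝ}

theorem SideIn.mono (h : SideIn 𝒞 γ K t) (hsub : 𝒞 ⊆ 𝒟) : SideIn 𝒟 γ K t :=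
  ⟨h.smooth, hsub h.mem⟩

theorem ConeCurveOn.mono (h : ConeCurveOn 𝒞 γ J) (hsub : 𝒞 ⊆ 𝒟) : ConeCurveOn 𝒟 γ J :=
  ⟨fun t ht h' ↦ (h.right t ht h').mono hsub, fun t ht h' ↦ (h.left t ht h').mono hsub⟩

theorem ConeCurveOn.mono_set {J' : Set ℝ} (h : ConeCurveOn 𝒞 γ J) (hsub : J' ⊆ J) :
    ConeCurveOn 𝒞 γ J' :=
  ⟨fun t ht h' ↦ h.right t (hsub ht) (h'.mono (inter_subset_inter_left _ hsub)),
    fun t ht h' ↦ h.left t (hsub ht) (h'.mono (inter_subset_inter_left _ hsub))⟩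

theorem tangentMapWithin_congr_nhds (hK : t ∈ K) (h : γ =ᶠ[𝓝[K] t] γ') :
    tangentMapWithin 𝓘(ℝ, ℝ) (𝓡 (d + 1)) γ K ⟨t, (1 : ℝ)⟩ =
      tangentMapWithin 𝓘(ℝ, ℝ) (𝓡 (d + 1)) γ' K ⟨t, (1 : ℝ)⟩ := by
  have h0 : γ t = γ' t := h.self_of_nhdsWithin hK
  have h1 : mfderivWithin 𝓘(ℝ, ℝ) (𝓡 (d + 1)) γ K t =
    mfderivWithin 𝓘(ℝ, ℝ) (𝓡 (d + 1)) γ' K t := h.mfderivWithin_eq h0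
  simp only [tangentMapWithin]
  congr 1
  exact DFunLike.congr_fun h1 (1 : ℝ)

theorem SideIn.congr (hK : t ∈ K) (h : SideIn 𝒞 γ K t) (he : γ =ᶠ[𝓝[K] t] γ') :
    SideIn 𝒞 γ' K t := by
  refine ⟨?_, ?_⟩
  · obtain ⟨s, hs, hsm⟩ := h.smooth
    obtain ⟨u, hu, hu'⟩ := mem_nhdsWithin_iff_exists_mem_nhds_inter.1 he
    refine ⟨s ∩ u, inter_mem hs hu, (hsm.mono (by grind)).congr ?_⟩
    intro x hx
    exact (hu' ⟨hx.2.2, hx.1⟩ : γ x = γ' x).symm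
  · rw [← tangentMapWithin_congr_nhds hK he]
    exact h.mem

theorem SideIn.contMDiffWithinAt (hK : t ∈ K) (h : SideIn 𝒞 γ K t) :
    ContMDiffWithinAt 𝓘(ℝ, ℝ) (𝓡 (d + 1)) ∞ γ K t := by
  obtain ⟨s, hs, hsm⟩ := h.smooth
  exact (contMDiffWithinAt_inter hs).1 (hsm t ⟨hK, mem_of_mem_nhds hs⟩)

theorem SideIn.continuousWithinAt (hK : t ∈ K) (h : SideIn 𝒞 γ K t) :
    ContinuousWithinAt γ K t :=
  (h.contMDiffWithinAt hK).continuousWithinAt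

/-- Pushing forward along a map that is smooth near the curve. -/
theorem SideIn.comp {𝒟 : Set (TangentBundle (𝓡 (d + 1)) N)} {F : M → N} {U : Set M} (hU : IsOpen U)
    (hF : ContMDiffOn (𝓡 (d + 1)) (𝓡 (d + 1)) ∞ F U) (hK : t ∈ K)
    (hKu : UniqueDiffWithinAt ℝ K t) (hγ : γ t ∈ U)
    (h : SideIn (tangentMap (𝓡 (d + 1)) (𝓡 (d + 1)) F ⁻¹' 𝒟) γ K t) :
    SideIn 𝒟 (F ∘ γ) K t := by
  refine ⟨?_, ?_⟩
  · obtain ⟨s, hs, hsm⟩ := h.smooth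
    obtain ⟨u, hu, hu'⟩ := mem_nhdsWithin_iff_exists_mem_nhds_inter.1
      ((h.continuousWithinAt hK).preimage_mem_nhdsWithin (hU.mem_nhds hγ))
    refine ⟨s ∩ u, inter_mem hs hu, hF.comp (hsm.mono (by grind)) ?_⟩
    intro x hx
    exact hu' ⟨hx.2.2, hx.1⟩
  · have h1 := mfderiv_comp_mfderivWithin (I := 𝓘(ℝ, ℝ)) (I' := 𝓡 (d + 1)) (I'' := 𝓡 (d + 1))
      (f := γ) t (s := K) (g := F)
      ((hF.contMDiffAt (hU.mem_nhds hγ)).mdifferentiableAt (by simp))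
      ((h.contMDiffWithinAt hK).mdifferentiableWithinAt (by simp)) hKu.uniqueMDiffWithinAt
    have h2 := h.mem
    have h3 : tangentMapWithin 𝓘(ℝ, ℝ) (𝓡 (d + 1)) (F ∘ γ) K ⟨t, (1 : ℝ)⟩ =
      tangentMap (𝓡 (d + 1)) (𝓡 (d + 1)) F
        (tangentMapWithin 𝓘(ℝ, ℝ) (𝓡 (d + 1)) γ K ⟨t, (1 : ℝ)⟩) := by
      simp only [tangentMapWithin, tangentMap, Function.comp]
      congr 1
      exact DFunLike.congr_fun h1 (1 : ℝ)
    rw [h3]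
    exact h2

/-- Affine reparametrization of one side of a curve; `a < 0` exchanges left and right. -/
theorem SideIn.comp_affine {a b : ℝ} (hK : a * t + b ∈ K)
    (hKu : UniqueDiffWithinAt ℝ ((fun s ↦ a * s + b) ⁻¹' K) t)
    (h : SideIn {X | (⟨X.1, a • X.2⟩ : TangentBundle (𝓡 (d + 1)) M) ∈ 𝒞} γ K (a * t + b)) :
    SideIn 𝒞 (fun s ↦ γ (a * s + b)) ((fun s ↦ a * s + b) ⁻¹' K) t := by
  have haff : ContDiff ℝ ∞ (fun s : ℝ ↦ a * s + b) := by fun_prop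
  refine ⟨?_, ?_⟩
  · obtain ⟨s, hs, hsm⟩ := h.smooth
    refine ⟨(fun s ↦ a * s + b) ⁻¹' s, haff.continuous.continuousAt.preimage_mem_nhds hs, ?_⟩
    exact hsm.comp haff.contMDiff.contMDiffOn (fun x hx ↦ hx)
  · have hd : HasDerivAt (fun s : ℝ ↦ a * s + b) a t := by
      simpa using ((hasDerivAt_id t).const_mul a).add_const b
    have h1 := mfderivWithin_comp (I := 𝓘(ℝ, ℝ)) (I' := 𝓘(ℝ, ℝ)) (I'' := 𝓡 (d + 1))
      (f := fun s ↦ a * s + b) t (s := (fun s ↦ a * s + b) ⁻¹' K) (g := γ) (u := K)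
      ((h.contMDiffWithinAt hK).mdifferentiableWithinAt (by simp))
      (haff.contMDiff.contMDiffAt.mdifferentiableAt (by simp)).mdifferentiableWithinAt
      subset_rfl hKu.uniqueMDiffWithinAt
    have h2 : mfderivWithin 𝓘(ℝ, ℝ) 𝓘(ℝ, ℝ) (fun s ↦ a * s + b) ((fun s ↦ a * s + b) ⁻¹' K) t
        (1 : ℝ) = a • (1 : ℝ) := by
      rw [mfderivWithin_eq_fderivWithin]
      rw [hd.hasFDerivAt.hasFDerivWithinAt.fderivWithin hKu]
      change (1 : ℝ) • a = a • (1 : ℝ)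
      simp
    have h3 : mfderivWithin 𝓘(ℝ, ℝ) (𝓡 (d + 1)) (fun s ↦ γ (a * s + b))
        ((fun s ↦ a * s + b) ⁻¹' K) t (1 : ℝ) =
          a • mfderivWithin 𝓘(ℝ, ℝ) (𝓡 (d + 1)) γ K (a * t + b) (1 : ℝ) := by
      refine (DFunLike.congr_fun h1 (1 : ℝ)).trans ?_
      refine (congrArg (mfderivWithin 𝓘(ℝ, ℝ) (𝓡 (d + 1)) γ K (a * t + b)) h2).trans ?_
      exact map_smul (mfderivWithin 𝓘(ℝ, ℝ) (𝓡 (d + 1)) γ K (a * t + b)) a (1 : ℝ)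
    have h4 := h.mem
    simp only [tangentMapWithin, mem_ofPred_eq] at h4 ⊢
    rw [h3]
    exact h4

end ConeCurves

/-! ### Operations on curves -/

section ConeCurves

variable {d : ℕ} {M : Type*} [TopologicalSpace M] [ChartedSpace (Model d) M]
  {𝒞 : Set (TangentBundle (𝓡 (d + 1)) M)} {γ γ₁ γ₂ : ℝ → M} {K J : Set ℝ} {t : ℝ}

theorem ConeCurveOn.continuousOn (h : ConeCurveOn 𝒞 γ J) : ContinuousOn γ J := by
  intro t ht
  have hr : ContinuousWithinAt γ (J ∩ Ici t) t := by
    by_cases hne : (J ∩ Ioi t).Nonempty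
    · exact ((h.right t ht hne).continuousWithinAt self_mem_Ici).mono inter_subset_right
    · refine continuousWithinAt_singleton.mono (fun x hx ↦ ?_)
      by_contra hxt
      exact hne ⟨x, hx.1, lt_of_le_of_ne hx.2 (Ne.symm hxt)⟩
  have hl : ContinuousWithinAt γ (J ∩ Iic t) t := by
    by_cases hne : (J ∩ Iio t).Nonempty
    · exact ((h.left t ht hne).continuousWithinAt self_mem_Iic).mono inter_subset_right
    · refine continuousWithinAt_singleton.mono (fun x hx ↦ ?_)
      by_contra hxt
      exact hne ⟨x, hx.1, lt_of_le_of_ne hx.2 hxt⟩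
  refine (hl.union hr).mono (fun x hx ↦ ?_)
  rcases le_total x t with h' | h'
  · exact Or.inl ⟨hx, h'⟩
  · exact Or.inr ⟨hx, h'⟩

theorem ConeCurveOn.congr (h : ConeCurveOn 𝒞 γ₁ J) (hJ : J.OrdConnected) (he : EqOn γ₁ γ₂ J) :
    ConeCurveOn 𝒞 γ₂ J := by
  refine ⟨fun t ht hne ↦ (h.right t ht hne).congr self_mem_Ici ?_,
    fun t ht hne ↦ (h.left t ht hne).congr self_mem_Iic ?_⟩
  · obtain ⟨u, hu, htu⟩ := hne
    filter_upwards [Icc_mem_nhdsGE htu] with x hx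
    exact he (hJ.out ht hu hx)
  · obtain ⟨u, hu, htu⟩ := hne
    filter_upwards [Icc_mem_nhdsLE htu] with x hx
    exact he (hJ.out hu ht hx)

/-- Concatenation of two curves at the parameter `m`. -/
theorem ConeCurveOn.glue {m : ℝ} (hm : m ∈ J)
    (h₁ : ConeCurveOn 𝒞 γ₁ (J ∩ Iic m)) (h₂ : ConeCurveOn 𝒞 γ₂ (J ∩ Ici m)) (he : γ₁ m = γ₂ m) :
    ConeCurveOn 𝒞 (fun s ↦ if s ≤ m then γ₁ s else γ₂ s) J := by
  constructor
  · rintro t ht ⟨u, hu, htu⟩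
    rcases lt_or_ge t m with htm | htm
    · refine (h₁.right t ⟨ht, htm.le⟩ ⟨m, ⟨hm, self_mem_Iic⟩, htm⟩).congr self_mem_Ici ?_
      filter_upwards [mem_nhdsWithin_of_mem_nhds (Iic_mem_nhds htm)] with x hx
      simp [show x ≤ m from hx]
    · refine (h₂.right t ⟨ht, htm⟩ ⟨u, ⟨hu, htm.trans htu.le⟩, htu⟩).congr self_mem_Ici ?_
      filter_upwards [self_mem_nhdsWithin] with x hx
      split_ifs with h
      · obtain rfl : x = m := le_antisymm h (htm.trans hx)
        exact he.symm
      · rfl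
  · rintro t ht ⟨u, hu, htu⟩
    rcases le_or_gt t m with htm | htm
    · refine (h₁.left t ⟨ht, htm⟩ ⟨u, ⟨hu, htu.le.trans htm⟩, htu⟩).congr self_mem_Iic ?_
      filter_upwards [self_mem_nhdsWithin] with x hx
      simp [show x ≤ m from le_trans hx htm]
    · refine (h₂.left t ⟨ht, htm.le⟩ ⟨m, ⟨hm, self_mem_Ici⟩, htm⟩).congr self_mem_Iic ?_
      filter_upwards [mem_nhdsWithin_of_mem_nhds (Ioi_mem_nhds htm)] with x hx
      simp [show ¬ x ≤ m from not_le.2 hx]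

theorem ConeCurveOn.comp_affine {a b : ℝ} (ha : a ≠ 0)
    (h : ConeCurveOn {X | (⟨X.1, a • X.2⟩ : TangentBundle (𝓡 (d + 1)) M) ∈ 𝒞} γ J) :
    ConeCurveOn 𝒞 (fun s ↦ γ (a * s + b)) ((fun s ↦ a * s + b) ⁻¹' J) := by
  rcases lt_or_gt_of_ne ha with ha' | ha'
  · have hI : ∀ t, (fun s ↦ a * s + b) ⁻¹' (Iic (a * t + b)) = Ici t := fun t ↦ by
      ext x; simp [mul_le_mul_left_of_neg ha']
    have hI' : ∀ t, (fun s ↦ a * s + b) ⁻¹' (Ici (a * t + b)) = Iic t := fun t ↦ by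
      ext x; simp [mul_le_mul_left_of_neg ha']
    constructor
    · rintro t ht ⟨u, hu, htu⟩
      rw [← hI]
      refine (h.left _ ht ⟨_, hu, ?_⟩).comp_affine self_mem_Iic ?_
      · have := mul_lt_mul_of_neg_left (mem_Ioi.1 htu) ha'
        simp only [mem_Iio]; linarith
      · rw [hI]; exact uniqueDiffWithinAt_Ici t
    · rintro t ht ⟨u, hu, htu⟩
      rw [← hI']
      refine (h.right _ ht ⟨_, hu, ?_⟩).comp_affine self_mem_Ici ?_
      · have := mul_lt_mul_of_neg_left (mem_Iio.1 htu) ha'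
        simp only [mem_Ioi]; linarith
      · rw [hI']; exact uniqueDiffWithinAt_Iic t
  · have hI : ∀ t, (fun s ↦ a * s + b) ⁻¹' (Ici (a * t + b)) = Ici t := fun t ↦ by
      ext x; simp [mul_le_mul_iff_right₀ ha']
    have hI' : ∀ t, (fun s ↦ a * s + b) ⁻¹' (Iic (a * t + b)) = Iic t := fun t ↦ by
      ext x; simp [mul_le_mul_iff_right₀ ha']
    constructor
    · rintro t ht ⟨u, hu, htu⟩
      rw [← hI]
      refine (h.right _ ht ⟨_, hu, ?_⟩).comp_affine self_mem_Ici ?_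
      · have := mul_lt_mul_of_pos_left (mem_Ioi.1 htu) ha'
        simp only [mem_Ioi]; linarith
      · rw [hI]; exact uniqueDiffWithinAt_Ici t
    · rintro t ht ⟨u, hu, htu⟩
      rw [← hI']
      refine (h.left _ ht ⟨_, hu, ?_⟩).comp_affine self_mem_Iic ?_
      · have := mul_lt_mul_of_pos_left (mem_Iio.1 htu) ha'
        simp only [mem_Iio]; linarith
      · rw [hI']; exact uniqueDiffWithinAt_Iic t

theorem ConeCurveOn.shift (h : ConeCurveOn 𝒞 γ J) (b : ℝ) :
    ConeCurveOn 𝒞 (fun s ↦ γ (s + b)) ((fun s ↦ s + b) ⁻¹' J) := by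
  have h1 := ConeCurveOn.comp_affine (𝒞 := 𝒞) (a := 1) (b := b) one_ne_zero
    (h.mono (fun X hX ↦ by simpa using hX))
  simpa using h1

/-- The set of the negatives of the vectors in `𝒞`. -/
def oppositeCone (𝒞 : Set (TangentBundle (𝓡 (d + 1)) M)) : Set (TangentBundle (𝓡 (d + 1)) M) :=
  {X | (⟨X.1, (-1 : ℝ) • X.2⟩ : TangentBundle (𝓡 (d + 1)) M) ∈ 𝒞}

theorem oppositeCone_oppositeCone : oppositeCone (oppositeCone 𝒞) = 𝒞 := by
  ext X
  simp [oppositeCone]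

theorem ConeCurveOn.reverse (h : ConeCurveOn 𝒞 γ J) :
    ConeCurveOn (oppositeCone 𝒞) (fun s ↦ γ (-s)) (Neg.neg ⁻¹' J) := by
  have h1 := ConeCurveOn.comp_affine (𝒞 := oppositeCone 𝒞) (a := -1) (b := 0) (γ := γ) (J := J)
    (by norm_num) (h.mono (fun X hX ↦ by simpa [oppositeCone] using hX))
  simpa using h1

/-- At parameters close to `t`, on the side where the curve is controlled, it is smooth with
tangent vector in the open set `𝒞`. -/
theorem SideIn.eventually_right [IsManifold (𝓡 (d + 1)) ∞ M] (h𝒞 : IsOpen 𝒞)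
    (h : SideIn 𝒞 γ (Ici t) t) :
    ∀ᶠ s in 𝓝[>] t, SideIn 𝒞 γ (Ici s) s ∧ SideIn 𝒞 γ (Iic s) s := by
  have : IsManifold (𝓡 (d + 1)) 1 M := .of_le (n := ∞) (by simp)
  obtain ⟨s, hs, hsm⟩ := h.smooth
  obtain ⟨ε, hε, hsub⟩ := Metric.nhds_basis_closedBall.mem_iff.1 hs
  rw [Real.closedBall_eq_Icc] at hsub
  have hsm' : ContMDiffOn 𝓘(ℝ, ℝ) (𝓡 (d + 1)) ∞ γ (Icc t (t + ε)) :=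
    hsm.mono fun x hx ↦ ⟨hx.1, hsub ⟨by linarith [hx.1], hx.2⟩⟩
  have hlt : t < t + ε := by linarith
  have hc := hsm'.continuousOn_tangentMapWithin (by simp)
    (uniqueDiffOn_Icc hlt).uniqueMDiffOn
  have hl : Continuous (fun s : ℝ ↦ (⟨s, (1 : ℝ)⟩ : TangentBundle 𝓘(ℝ, ℝ) ℝ)) := by
    exact (tangentBundleModelSpaceHomeomorph 𝓘(ℝ, ℝ)).symm.continuous.comp
      (continuous_id.prodMk continuous_const)
  have hc' : ContinuousOn (fun s : ℝ ↦ tangentMapWithin 𝓘(ℝ, ℝ) (𝓡 (d + 1)) γ (Icc t (t + ε))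
      ⟨s, (1 : ℝ)⟩) (Icc t (t + ε)) :=
    hc.comp hl.continuousOn (fun x hx ↦ hx)
  have ht : tangentMapWithin 𝓘(ℝ, ℝ) (𝓡 (d + 1)) γ (Icc t (t + ε)) ⟨t, (1 : ℝ)⟩ ∈ 𝒞 := by
    have : mfderivWithin 𝓘(ℝ, ℝ) (𝓡 (d + 1)) γ (Icc t (t + ε)) t =
        mfderivWithin 𝓘(ℝ, ℝ) (𝓡 (d + 1)) γ (Ici t) t := by
      rw [← Ici_inter_Iic]
      exact mfderivWithin_inter (Iic_mem_nhds hlt)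
    have h2 := h.mem
    simp only [tangentMapWithin] at h2 ⊢
    rw [this]; exact h2
  have hev : ∀ᶠ s in 𝓝[Icc t (t + ε)] t, tangentMapWithin 𝓘(ℝ, ℝ) (𝓡 (d + 1)) γ
      (Icc t (t + ε)) ⟨s, (1 : ℝ)⟩ ∈ 𝒞 :=
    (hc' t (left_mem_Icc.2 hlt.le)).preimage_mem_nhdsWithin (h𝒞.mem_nhds ht)
  have hle : 𝓝[>] t ≤ 𝓝[Icc t (t + ε)] t := by
    rw [← nhdsWithin_Ioo_eq_nhdsGT hlt]
    exact nhdsWithin_mono _ Ioo_subset_Icc_self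
  filter_upwards [hle hev, Ioo_mem_nhdsGT hlt] with s hs1 hs2
  have hnhds : Icc t (t + ε) ∈ 𝓝 s := Icc_mem_nhds hs2.1 hs2.2
  have hd : MDifferentiableAt 𝓘(ℝ, ℝ) (𝓡 (d + 1)) γ s :=
    ((hsm' s (Ioo_subset_Icc_self hs2)).contMDiffAt hnhds).mdifferentiableAt (by simp)
  have key : ∀ K : Set ℝ, UniqueDiffWithinAt ℝ K s → SideIn 𝒞 γ K s := by
    intro K hK
    refine ⟨⟨_, hnhds, hsm'.mono inter_subset_right⟩, ?_⟩
    have e1 : mfderivWithin 𝓘(ℝ, ℝ) (𝓡 (d + 1)) γ (Icc t (t + ε)) s =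
      mfderivWithin 𝓘(ℝ, ℝ) (𝓡 (d + 1)) γ K s := by
      rw [mfderivWithin_of_mem_nhds hnhds, mfderivWithin_eq_mfderiv hK.uniqueMDiffWithinAt hd]
    simp only [tangentMapWithin] at hs1 ⊢
    rw [← e1]; exact hs1
  exact ⟨key _ (uniqueDiffWithinAt_Ici s), key _ (uniqueDiffWithinAt_Iic s)⟩

end ConeCurves

/-! ### Curves in charts -/

section Charts

variable {d : ℕ} {M : Type*} [TopologicalSpace M] [ChartedSpace (Model d) M]
  [IsManifold (𝓡 (d + 1)) ∞ M]
  {𝒞 : Set (TangentBundle (𝓡 (d + 1)) M)} {γ γ₁ γ₂ : ℝ → M} {K J : Set ℝ} {t : ℝ}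
  {φ : OpenPartialHomeomorph M (Model d)}

/-- The tangent vector of `M` with coordinates `w`, at the point with coordinates `z`, in the
chart `φ`. -/
def chartVec (φ : OpenPartialHomeomorph M (Model d)) (z w : Model d) :
    TangentBundle (𝓡 (d + 1)) M :=
  tangentMap (𝓡 (d + 1)) (𝓡 (d + 1)) φ.symm ⟨z, w⟩

theorem continuousOn_chartVec (hφ : φ ∈ IsManifold.maximalAtlas (𝓡 (d + 1)) ∞ M) :
    ContinuousOn (fun p : Model d × Model d ↦ chartVec φ p.1 p.2) (φ.target ×ˢ univ) := by
  have : IsManifold (𝓡 (d + 1)) 1 M := .of_le (n := ∞) (by simp)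
  have h1 := (contMDiffOn_symm_of_mem_maximalAtlas hφ).continuousOn_tangentMapWithin (by simp)
    φ.open_target.uniqueMDiffOn
  have h2 : Continuous (fun p : Model d × Model d ↦ (⟨p.1, p.2⟩ : TangentBundle (𝓡 (d + 1))
      (Model d))) :=
    (tangentBundleModelSpaceHomeomorph (𝓡 (d + 1))).symm.continuous
  refine (h1.comp h2.continuousOn (fun p hp ↦ hp.1)).congr (fun p hp ↦ ?_)
  simp only [Function.comp, chartVec]
  rw [tangentMapWithin_eq_tangentMap (φ.open_target.uniqueMDiffOn _ hp.1)]
  exact (contMDiffAt_symm_of_mem_maximalAtlas hφ hp.1).mdifferentiableAt (by simp)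

/-- The coordinate description in the chart `φ` of a set of tangent vectors. -/
def coneIn (𝒞 : Set (TangentBundle (𝓡 (d + 1)) M)) (φ : OpenPartialHomeomorph M (Model d)) :
    Set (Model d × Model d) :=
  {p | p.1 ∈ φ.target ∧ chartVec φ p.1 p.2 ∈ 𝒞}

theorem isOpen_coneIn (hφ : φ ∈ IsManifold.maximalAtlas (𝓡 (d + 1)) ∞ M) (h𝒞 : IsOpen 𝒞) :
    IsOpen (coneIn 𝒞 φ) := by
  have := (continuousOn_chartVec hφ).isOpen_inter_preimage (φ.open_target.prod isOpen_univ) h𝒞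
  convert this using 1
  ext p
  simp [coneIn]

theorem chartVec_tangentMap (hφ : φ ∈ IsManifold.maximalAtlas (𝓡 (d + 1)) ∞ M)
    {X : TangentBundle (𝓡 (d + 1)) M} (hX : X.1 ∈ φ.source) :
    chartVec φ (φ X.1) (mfderiv (𝓡 (d + 1)) (𝓡 (d + 1)) φ X.1 X.2) = X := by
  have : IsManifold (𝓡 (d + 1)) 1 M := .of_le (n := ∞) (by simp)
  have h1 : MDifferentiableAt (𝓡 (d + 1)) (𝓡 (d + 1)) φ X.1 :=
    (contMDiffAt_of_mem_maximalAtlas hφ hX).mdifferentiableAt (by simp)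
  have h2 : MDifferentiableAt (𝓡 (d + 1)) (𝓡 (d + 1)) φ.symm (φ X.1) :=
    (contMDiffAt_symm_of_mem_maximalAtlas hφ (φ.map_source hX)).mdifferentiableAt (by simp)
  have h3 := tangentMap_comp_at X h2 h1
  have h4 : tangentMap (𝓡 (d + 1)) (𝓡 (d + 1)) (φ.symm ∘ φ) X = X := by
    have he : (φ.symm ∘ φ) =ᶠ[𝓝 X.1] id := φ.eventually_left_inverse hX
    have h5 := he.mfderiv_eq (I := 𝓡 (d + 1)) (I' := 𝓡 (d + 1))
    simp only [tangentMap]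
    rw [h5, mfderiv_id]
    ext
    · exact he.self_of_nhds
    · rfl
  rw [h4] at h3
  exact h3.symm

theorem SideIn.hasDerivWithinAt (hφ : φ ∈ IsManifold.maximalAtlas (𝓡 (d + 1)) ∞ M) (hK : t ∈ K)
    (hs : γ t ∈ φ.source) (h : SideIn 𝒞 γ K t) :
    ∃ w : Model d, HasDerivWithinAt (φ ∘ γ) w K t ∧ (φ (γ t), w) ∈ coneIn 𝒞 φ ∧
      chartVec φ (φ (γ t)) w = tangentMapWithin 𝓘(ℝ, ℝ) (𝓡 (d + 1)) γ K ⟨t, (1 : ℝ)⟩ := by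
  have hγ := (h.contMDiffWithinAt hK).mdifferentiableWithinAt (by simp)
  have h1 : MDifferentiableAt (𝓡 (d + 1)) (𝓡 (d + 1)) φ (γ t) :=
    (contMDiffAt_of_mem_maximalAtlas hφ hs).mdifferentiableAt (by simp)
  have hcv := chartVec_tangentMap hφ
    (X := tangentMapWithin 𝓘(ℝ, ℝ) (𝓡 (d + 1)) γ K ⟨t, (1 : ℝ)⟩) hs
  have hmem := h.mem
  rw [← hcv] at hmem
  refine ⟨_, ?_, ⟨φ.map_source hs, hmem⟩, hcv⟩
  have h2 := h1.hasMFDerivAt.comp_hasMFDerivWithinAt t hγ.hasMFDerivWithinAt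
  let L : ℝ →L[ℝ] Model d := (mfderiv (𝓡 (d + 1)) (𝓡 (d + 1)) φ (γ t)).comp
    (mfderivWithin 𝓘(ℝ, ℝ) (𝓡 (d + 1)) γ K t)
  have h3 : HasFDerivWithinAt (φ ∘ γ) L K t := hasMFDerivWithinAt_iff_hasFDerivWithinAt.1 h2
  exact h3.hasDerivWithinAt

omit [IsManifold (𝓡 (d + 1)) ∞ M] in
/-- Straight coordinate lines with direction in the cone. -/
theorem sideIn_line (hφ : φ ∈ IsManifold.maximalAtlas (𝓡 (d + 1)) ∞ M) (hK : t ∈ K)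
    (hKu : UniqueDiffWithinAt ℝ K t) {z w : Model d} (h : (z + t • w, w) ∈ coneIn 𝒞 φ) :
    SideIn 𝒞 (fun s ↦ φ.symm (z + s • w)) K t := by
  have hc : ContDiff ℝ ∞ (fun s : ℝ ↦ z + s • w) := by fun_prop
  have hd : HasDerivAt (fun s : ℝ ↦ z + s • w) w t := by
    simpa using ((hasDerivAt_id t).smul_const w).const_add z
  refine SideIn.comp (M := Model d) (F := φ.symm) (γ := fun s ↦ z + s • w) φ.open_target
    (contMDiffOn_symm_of_mem_maximalAtlas hφ) hK hKu h.1
    ⟨⟨univ, univ_mem, hc.contMDiff.contMDiffOn⟩, ?_⟩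
  have h1 : mfderivWithin 𝓘(ℝ, ℝ) (𝓡 (d + 1)) (fun s : ℝ ↦ z + s • w) K t (1 : ℝ) = w := by
    rw [mfderivWithin_eq_fderivWithin, hd.hasFDerivAt.hasFDerivWithinAt.fderivWithin hKu]
    change (1 : ℝ) • w = w
    simp
  simp only [tangentMapWithin, mem_preimage]
  rw [h1]
  exact h.2

omit [IsManifold (𝓡 (d + 1)) ∞ M] in
theorem coneCurveOn_line (hφ : φ ∈ IsManifold.maximalAtlas (𝓡 (d + 1)) ∞ M)
    {z w : Model d} (h : ∀ t ∈ J, (z + t • w, w) ∈ coneIn 𝒞 φ) :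
    ConeCurveOn 𝒞 (fun s ↦ φ.symm (z + s • w)) J :=
  ⟨fun t ht _ ↦ sideIn_line hφ self_mem_Ici (uniqueDiffWithinAt_Ici t) (h t ht),
    fun t ht _ ↦ sideIn_line hφ self_mem_Iic (uniqueDiffWithinAt_Iic t) (h t ht)⟩

/-- The end point of a curve with tangent vectors in an open cone can be moved: close to the
end point, replace the curve by a straight coordinate line. -/
theorem ConeCurveOn.eventually_exists_end (h𝒞 : IsOpen 𝒞) {a b : ℝ} (hab : a < b)
    (h : ConeCurveOn 𝒞 γ (Icc a b)) :
    ∀ᶠ y in 𝓝 (γ b), ∃ γ' : ℝ → M, ConeCurveOn 𝒞 γ' (Icc a b) ∧ γ' a = γ a ∧ γ' b = y := by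
  set φ := chartAt (Model d) (γ b) with hφdef
  have hφ : φ ∈ IsManifold.maximalAtlas (𝓡 (d + 1)) ∞ M :=
    IsManifold.chart_mem_maximalAtlas (γ b)
  have hs : γ b ∈ φ.source := mem_chart_source _ _
  have hL : SideIn 𝒞 γ (Iic b) b := h.left b (right_mem_Icc.2 hab.le) ⟨a, ⟨le_rfl, hab.le⟩, hab⟩
  obtain ⟨w, hw, hwc, -⟩ := hL.hasDerivWithinAt hφ self_mem_Iic hs
  obtain ⟨ρ, hρ, hball⟩ := Metric.isOpen_iff.1 (isOpen_coneIn hφ h𝒞) _ hwc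
  -- a parameter `m < b` from which the chord to the end point is admissible
  have hslope := (hasDerivWithinAt_iff_tendsto_slope' (by simp)).1
    (hw.mono Iio_subset_Iic_self)
  have e1 : ∀ᶠ m in 𝓝[<] b, slope (φ ∘ γ) b m ∈ Metric.ball w ρ := hslope (Metric.ball_mem_nhds _ hρ)
  have hcont : ContinuousWithinAt (φ ∘ γ) (Iio b) b :=
    hw.continuousWithinAt.mono Iio_subset_Iic_self
  have e2 : ∀ᶠ m in 𝓝[<] b, φ (γ m) ∈ Metric.ball (φ (γ b)) ρ :=
    hcont (Metric.ball_mem_nhds _ hρ)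
  have e3 : ∀ᶠ m in 𝓝[<] b, γ m ∈ φ.source :=
    ((hL.continuousWithinAt self_mem_Iic).mono Iio_subset_Iic_self)
      (φ.open_source.mem_nhds hs)
  have e4 : ∀ᶠ m in 𝓝[<] b, m ∈ Ioo a b := Ioo_mem_nhdsLT hab
  obtain ⟨m, hm1, hm2, hm3, hm4⟩ := (e1.and (e2.and (e3.and e4))).exists
  have hmb : 0 < b - m := sub_pos.2 hm4.2
  have hcφ : ContinuousAt φ (γ b) := φ.continuousAt hs
  have hdir : ContinuousAt (fun y ↦ (b - m)⁻¹ • (φ y - φ (γ m))) (γ b) := by fun_prop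
  have hdir0 : (b - m)⁻¹ • (φ (γ b) - φ (γ m)) ∈ Metric.ball w ρ := by
    rw [slope_comm] at hm1
    simpa [slope, vsub_eq_sub] using hm1
  filter_upwards [hdir.preimage_mem_nhds (Metric.isOpen_ball.mem_nhds hdir0),
    hcφ.preimage_mem_nhds (Metric.ball_mem_nhds _ hρ), φ.open_source.mem_nhds hs]
    with y hy1 hy2 hy3
  set u : Model d := (b - m)⁻¹ • (φ y - φ (γ m)) with hu
  have hline : ∀ t ∈ Icc m b, (φ (γ m) - m • u + t • u, u) ∈ coneIn 𝒞 φ := by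
    intro t ht
    apply hball
    rw [← ball_prod_same]
    refine ⟨?_, hy1⟩
    have hmem := (convex_ball (φ (γ b)) ρ).add_smul_sub_mem hm2 hy2
      (t := (t - m) / (b - m)) ⟨div_nonneg (by linarith [ht.1]) hmb.le,
        (div_le_one hmb).2 (by linarith [ht.2])⟩
    convert hmem using 1
    rw [hu]
    simp only [smul_smul, sub_eq_add_neg, add_assoc]
    congr 1
    rw [← sub_eq_add_neg, ← neg_smul, ← add_smul]
    congr 1
    ring
  refine ⟨_, ConeCurveOn.glue (γ₁ := γ) (γ₂ := fun t ↦ φ.symm (φ (γ m) - m • u + t • u)) (m := m)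
    ⟨hm4.1.le, hm4.2.le⟩ (h.mono_set inter_subset_left) ?_ ?_, ?_, ?_⟩
  · exact coneCurveOn_line hφ (fun t ht ↦ hline t ⟨ht.2, ht.1.2⟩)
  · simp [φ.left_inv hm3]
  · simp [hm4.1.le]
  · simp only [not_le.2 hm4.2, if_false]
    have : φ (γ m) - m • u + b • u = φ y := by
      rw [sub_add, ← sub_smul, hu, smul_smul]
      have : (m - b) * (b - m)⁻¹ = -1 := by field_simp; ring
      rw [this]; simp
    rw [this, φ.left_inv hy3]

end Charts

section Reach

variable {d : ℕ} {M : Type*} [TopologicalSpace M] [ChartedSpace (Model d) M]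
  {𝒞 : Set (TangentBundle (𝓡 (d + 1)) M)} {x y z : M}

/-- `y` is the end point of a curve from `x` with tangent vectors in `𝒞`. -/
def Reach (𝒞 : Set (TangentBundle (𝓡 (d + 1)) M)) (x y : M) : Prop :=
  ∃ (γ : ℝ → M) (a b : ℝ), a < b ∧ ConeCurveOn 𝒞 γ (Icc a b) ∧ γ a = x ∧ γ b = y

theorem ConeCurveOn.reach {γ : ℝ → M} {J : Set ℝ} (h : ConeCurveOn 𝒞 γ J) (hJ : J.OrdConnected)
    {a b : ℝ} (ha : a ∈ J) (hb : b ∈ J) (hab : a < b) : Reach 𝒞 (γ a) (γ b) :=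
  ⟨γ, a, b, hab, h.mono_set (hJ.out ha hb), rfl, rfl⟩

theorem Reach.exists_from (h : Reach 𝒞 x y) (a : ℝ) :
    ∃ (γ : ℝ → M) (b : ℝ), a < b ∧ ConeCurveOn 𝒞 γ (Icc a b) ∧ γ a = x ∧ γ b = y := by
  obtain ⟨γ, a', b', hab, hγ, h1, h2⟩ := h
  refine ⟨fun s ↦ γ (s + (a' - a)), b' - (a' - a), by linarith, ?_, by simp [h1], by simp [h2]⟩
  convert hγ.shift (a' - a) using 1
  ext s; simp

theorem Reach.trans (h₁ : Reach 𝒞 x y) (h₂ : Reach 𝒞 y z) : Reach 𝒞 x z := by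
  obtain ⟨γ₁, a, b, hab, hγ₁, rfl, rfl⟩ := h₁
  obtain ⟨γ₂, c, hbc, hγ₂, h3, rfl⟩ := h₂.exists_from b
  refine ⟨_, a, c, hab.trans hbc, ConeCurveOn.glue (m := b) ⟨hab.le, hbc.le⟩
    (hγ₁.mono_set ?_) (hγ₂.mono_set ?_) h3.symm, by simp [hab.le], by simp [hbc]⟩
  · exact fun s hs ↦ ⟨hs.1.1, hs.2⟩
  · exact fun s hs ↦ ⟨hs.2, hs.1.2⟩

theorem Reach.reverse (h : Reach 𝒞 x y) : Reach (oppositeCone 𝒞) y x := by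
  obtain ⟨γ, a, b, hab, hγ, rfl, rfl⟩ := h
  refine ⟨fun s ↦ γ (-s), -b, -a, by linarith, ?_, by simp, by simp⟩
  convert hγ.reverse using 1
  ext s; simp [and_comm]

theorem isOpen_oppositeCone [IsManifold (𝓡 (d + 1)) ∞ M] (h𝒞 : IsOpen 𝒞) :
    IsOpen (oppositeCone 𝒞) := by
  have : IsManifold (𝓡 (d + 1)) 1 M := .of_le (n := ∞) (by simp)
  refine h𝒞.preimage ?_
  rw [continuous_iff_continuousAt]
  intro X
  rw [FiberBundle.continuousAt_totalSpace]
  refine ⟨(FiberBundle.continuous_proj _ _).continuousAt, ?_⟩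
  set e := trivializationAt (Model d) (TangentSpace (𝓡 (d + 1)) (M := M)) X.1 with he
  have h0 : ContinuousAt (fun Y : TangentBundle (𝓡 (d + 1)) M ↦ (e Y).2) X :=
    ((FiberBundle.continuousAt_totalSpace (Model d) (fun Y : TangentBundle (𝓡 (d + 1)) M ↦ Y)).1
      continuousAt_id).2
  have h1 := h0.const_smul (-1 : ℝ)
  refine h1.congr ?_
  have h2 : ∀ᶠ Y : TangentBundle (𝓡 (d + 1)) M in 𝓝 X, Y.1 ∈ e.baseSet :=
    (FiberBundle.continuous_proj _ _).continuousAt (e.open_baseSet.mem_nhds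
      (FiberBundle.mem_baseSet_trivializationAt' X.1))
  filter_upwards [h2] with Y hY
  exact (((e.linear ℝ hY).map_smul (-1 : ℝ) Y.2)).symm

theorem Reach.eventually_right [IsManifold (𝓡 (d + 1)) ∞ M] (h𝒞 : IsOpen 𝒞) (h : Reach 𝒞 x y) :
    ∀ᶠ y' in 𝓝 y, Reach 𝒞 x y' := by
  obtain ⟨γ, a, b, hab, hγ, rfl, rfl⟩ := h
  filter_upwards [hγ.eventually_exists_end h𝒞 hab] with y' ⟨γ', h1, h2, h3⟩
  exact ⟨γ', a, b, hab, h1, h2, h3⟩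

theorem Reach.eventually_left [IsManifold (𝓡 (d + 1)) ∞ M] (h𝒞 : IsOpen 𝒞) (h : Reach 𝒞 x y) :
    ∀ᶠ x' in 𝓝 x, Reach 𝒞 x' y := by
  filter_upwards [h.reverse.eventually_right (isOpen_oppositeCone h𝒞)] with x' hx'
  have := hx'.reverse
  rwa [oppositeCone_oppositeCone] at this

end Reach

/-! ### Inextendible curves -/

section Rays

variable {d : ℕ} {M : Type*} [TopologicalSpace M] [ChartedSpace (Model d) M]
  {𝒞 : Set (TangentBundle (𝓡 (d + 1)) M)} {x y : M}

/-- The set `𝒞` of tangent vectors is stable under multiplication by positive numbers. -/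
def IsConic (𝒞 : Set (TangentBundle (𝓡 (d + 1)) M)) : Prop :=
  ∀ X ∈ 𝒞, ∀ a : ℝ, 0 < a → (⟨X.1, a • X.2⟩ : TangentBundle (𝓡 (d + 1)) M) ∈ 𝒞

theorem IsConic.oppositeCone (h : IsConic 𝒞) : IsConic (oppositeCone 𝒞) := by
  intro X hX a ha
  have := h _ hX a ha
  simp only [C0Ext.oppositeCone, mem_ofPred_eq] at this ⊢
  rwa [smul_comm] at this

/-- Curves in a conic set can be parametrized by any given interval. -/
theorem Reach.exists_on (hc : IsConic 𝒞) (h : Reach 𝒞 x y) {a b : ℝ} (hab : a < b) :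
    ∃ γ : ℝ → M, ConeCurveOn 𝒞 γ (Icc a b) ∧ γ a = x ∧ γ b = y := by
  obtain ⟨γ, a', b', hab', hγ, rfl, rfl⟩ := h
  set r := (b' - a') / (b - a) with hr
  have hba : b - a ≠ 0 := (sub_pos.2 hab).ne'
  have hr0 : 0 < r := div_pos (sub_pos.2 hab') (sub_pos.2 hab)
  have hrb : r * (b - a) = b' - a' := by rw [hr]; field_simp
  have h1 := (hγ.mono (fun X hX ↦ hc X hX r hr0)).comp_affine (𝒞 := 𝒞) (b := a' - r * a) hr0.ne'
  refine ⟨_, h1.mono_set ?_, ?_, ?_⟩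
  · intro s hs
    have e1 := mul_le_mul_of_nonneg_left hs.1 hr0.le
    have e2 := mul_le_mul_of_nonneg_left hs.2 hr0.le
    constructor
    · linarith
    · linarith [mul_sub r b a]
  · congr 1; ring
  · congr 1; linarith [mul_sub r b a]

/-- A sequence of curves, each starting at the end point of the previous one, runs together
to a single curve on `[0, ∞)`. -/
theorem exists_coneCurveOn_Ici (hc : IsConic 𝒞) {u : ℕ → M} (h : ∀ n, Reach 𝒞 (u n) (u (n + 1))) :
    ∃ γ : ℝ → M, ConeCurveOn 𝒞 γ (Ici 0) ∧ ∀ n : ℕ, γ n = u n := by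
  have h1 : ∀ n : ℕ, ∃ γ : ℝ → M, ConeCurveOn 𝒞 γ (Icc n (n + 1 : ℝ)) ∧ γ n = u n ∧
      γ (n + 1) = u (n + 1) := fun n ↦ (h n).exists_on hc (by simp)
  choose Γ hΓ hΓ0 hΓ1 using h1
  refine ⟨fun t ↦ Γ ⌊t⌋₊ t, ⟨fun t ht _ ↦ ?_, ?_⟩, fun n ↦ by simp [hΓ0]⟩
  · have ht' : (0 : ℝ) ≤ t := ht
    have e1 : (⌊t⌋₊ : ℝ) ≤ t := Nat.floor_le ht'
    have e2 : t < ⌊t⌋₊ + 1 := Nat.lt_floor_add_one t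
    refine ((hΓ ⌊t⌋₊).right t ⟨e1, e2.le⟩ ⟨_, ⟨e1.trans e2.le, le_rfl⟩, e2⟩).congr self_mem_Ici ?_
    filter_upwards [Ico_mem_nhdsGE e2] with s hs
    have : ⌊s⌋₊ = ⌊t⌋₊ := (Nat.floor_eq_iff (ht'.trans hs.1)).2 ⟨e1.trans hs.1, hs.2⟩
    rw [this]
  · rintro t ht ⟨v, hv, hvt⟩
    have ht' : (0 : ℝ) < t := lt_of_le_of_lt hv hvt
    obtain ⟨k, hk⟩ : ∃ k : ℕ, ⌈t⌉₊ = k + 1 := Nat.exists_eq_succ_of_ne_zero (Nat.ceil_pos.2 ht').ne'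
    have e1 : (k : ℝ) < t := Nat.lt_ceil.1 (by omega)
    have e2 : t ≤ k + 1 := by
      have := Nat.le_ceil t
      rw [hk] at this
      exact_mod_cast this
    refine ((hΓ k).left t ⟨e1.le, e2⟩ ⟨_, ⟨le_rfl, e1.le.trans e2⟩, e1⟩).congr self_mem_Iic ?_
    filter_upwards [Ioc_mem_nhdsLE e1] with s hs
    rcases (hs.2.trans e2).lt_or_eq with hlt | rfl
    · have : ⌊s⌋₊ = k := (Nat.floor_eq_iff (by linarith [hs.1, Nat.cast_nonneg (α := ℝ) k])).2
        ⟨hs.1.le, hlt⟩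
      rw [this]
    · have : ⌊(k + 1 : ℝ)⌋₊ = k + 1 := by exact_mod_cast Nat.floor_natCast (R := ℝ) (k + 1)
      rw [this, hΓ1]
      have h0 := hΓ0 (k + 1)
      push_cast at h0
      exact h0.symm

variable [IsManifold (𝓡 (d + 1)) ∞ M]

theorem exists_reach_ne (h𝒞 : IsOpen 𝒞) {v : TangentSpace (𝓡 (d + 1)) x} (hv : v ≠ 0)
    (hvc : (⟨x, v⟩ : TangentBundle (𝓡 (d + 1)) M) ∈ 𝒞) : ∃ y ≠ x, Reach 𝒞 x y := by
  set φ := chartAt (Model d) x with hφdef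
  have hφ : φ ∈ IsManifold.maximalAtlas (𝓡 (d + 1)) ∞ M := IsManifold.chart_mem_maximalAtlas x
  have hx : x ∈ φ.source := mem_chart_source _ _
  have hX := chartVec_tangentMap hφ (X := ⟨x, v⟩) hx
  set w : Model d := mfderiv (𝓡 (d + 1)) (𝓡 (d + 1)) φ x v with hw
  have hX' : chartVec φ (φ x) w = ⟨x, v⟩ := hX
  have hw0 : w ≠ 0 := by
    intro h0
    rw [h0] at hX'
    have h1 : (chartVec φ (φ x) 0).2 = 0 :=
      map_zero (mfderiv (𝓡 (d + 1)) (𝓡 (d + 1)) φ.symm (φ x))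
    rw [hX'] at h1
    exact hv h1
  have hmem : (φ x, w) ∈ coneIn 𝒞 φ := ⟨φ.map_source hx, by rw [hX']; exact hvc⟩
  have hcont : Continuous (fun t : ℝ ↦ (φ x + t • w, w)) := by fun_prop
  have hev : ∀ᶠ t : ℝ in 𝓝 0, (φ x + t • w, w) ∈ coneIn 𝒞 φ :=
    hcont.continuousAt.preimage_mem_nhds ((isOpen_coneIn hφ h𝒞).mem_nhds (by simpa using hmem))
  obtain ⟨ε, hε, hsub⟩ := Metric.nhds_basis_closedBall.mem_iff.1 hev
  rw [Real.closedBall_eq_Icc] at hsub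
  have hline : ∀ t ∈ Icc (0 : ℝ) ε, (φ x + t • w, w) ∈ coneIn 𝒞 φ :=
    fun t ht ↦ hsub ⟨by linarith [ht.1], by linarith [ht.2]⟩
  refine ⟨φ.symm (φ x + ε • w), ?_, _, 0, ε, hε, coneCurveOn_line hφ hline, ?_, rfl⟩
  · intro h
    have h2 : φ (φ.symm (φ x + ε • w)) = φ x := by rw [h]
    rw [φ.right_inv (hline ε ⟨hε.le, le_rfl⟩).1] at h2
    simp [hε.ne', hw0] at h2
  · simp [φ.left_inv hx]

/-- Every point is the starting point of a curve in the cone without end point: at each step,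
go at least half as far as possible. If the resulting sequence of points converged to `q`, the
steps would tend to `0`; but a fixed point `y ≠ q` that can be reached from `q` can also be
reached from all points close to `q`. -/
theorem exists_coneCurveOn_Ici_not_tendsto [T2Space M] [SecondCountableTopology M]
    (h𝒞 : IsOpen 𝒞) (hc : IsConic 𝒞)
    (hne : ∀ x : M, ∃ v : TangentSpace (𝓡 (d + 1)) x, v ≠ 0 ∧
      (⟨x, v⟩ : TangentBundle (𝓡 (d + 1)) M) ∈ 𝒞) (x : M) :
    ∃ γ : ℝ → M, ConeCurveOn 𝒞 γ (Ici 0) ∧ γ 0 = x ∧ ¬ ∃ q, Tendsto γ atTop (𝓝 q) := by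
  have : LocallyCompactSpace M := Manifold.locallyCompact_of_finiteDimensional (𝓡 (d + 1))
  let _ := TopologicalSpace.metrizableSpaceMetric M
  have hne' : ∀ x : M, ∃ y ≠ x, Reach 𝒞 x y := fun x ↦ by
    obtain ⟨v, hv, hvc⟩ := hne x
    exact exists_reach_ne h𝒞 hv hvc
  have step : ∀ x : M, ∃ y, Reach 𝒞 x y ∧ ∀ z, Reach 𝒞 x z →
      min 1 (dist x z) ≤ 2 * min 1 (dist x y) := by
    intro x
    obtain ⟨y₀, hy₀, hr₀⟩ := hne' x
    set S : Set ℝ := (fun z ↦ min 1 (dist x z)) '' {z | Reach 𝒞 x z} with hS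
    have hbdd : BddAbove S := ⟨1, by rintro _ ⟨z, -, rfl⟩; exact min_le_left _ _⟩
    have hpos : 0 < sSup S := lt_of_lt_of_le (lt_min one_pos (dist_pos.2 hy₀.symm))
      (le_csSup hbdd ⟨y₀, hr₀, rfl⟩)
    obtain ⟨_, ⟨y, hy, rfl⟩, hlt⟩ := exists_lt_of_lt_csSup (s := S) ⟨_, y₀, hr₀, rfl⟩ (half_lt_self hpos)
    refine ⟨y, hy, fun z hz ↦ ?_⟩
    have := le_csSup hbdd ⟨z, hz, rfl⟩
    simp only at this hlt
    linarith
  choose next hnext hmax using step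
  obtain ⟨γ, hγ, hγu⟩ := exists_coneCurveOn_Ici hc (u := fun n ↦ next^[n] x) (fun n ↦ by
    rw [Function.iterate_succ_apply']; exact hnext _)
  refine ⟨γ, hγ, by simpa using hγu 0, ?_⟩
  rintro ⟨q, hq⟩
  have hu : Tendsto (fun n ↦ next^[n] x) atTop (𝓝 q) := by
    refine (hq.comp tendsto_natCast_atTop_atTop).congr (fun n ↦ ?_)
    exact hγu n
  obtain ⟨y, hyq, hqy⟩ := hne' q
  have h1 : ∀ᶠ n in atTop, Reach 𝒞 (next^[n] x) y := hu (hqy.eventually_left h𝒞)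
  have h2 : ∀ᶠ n in atTop, min 1 (dist (next^[n] x) y) ≤
      2 * min 1 (dist (next^[n] x) (next^[n + 1] x)) := by
    filter_upwards [h1] with n hn
    rw [Function.iterate_succ_apply']
    exact hmax _ _ hn
  have h3 : Tendsto (fun n ↦ min 1 (dist (next^[n] x) y)) atTop (𝓝 (min 1 (dist q y))) :=
    tendsto_const_nhds.min (hu.dist tendsto_const_nhds)
  have h4 : Tendsto (fun n ↦ 2 * min 1 (dist (next^[n] x) (next^[n + 1] x))) atTop
      (𝓝 (2 * min 1 (dist q q))) :=
    (tendsto_const_nhds.min (hu.dist ((tendsto_add_atTop_iff_nat 1).2 hu))).const_mul 2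
  have h5 := le_of_tendsto_of_tendsto h3 h4 h2
  have h6 : 0 < min 1 (dist q y) := lt_min one_pos (dist_pos.2 hyq.symm)
  simp at h5
  rcases h5 with h5 | h5
  · linarith
  · exact hyq h5.symm

end Rays

/-! ### Linear algebra of the timelike cone -/

section LorentzAlgebra

variable {d : ℕ} {n : WithTop ℕ∞} {M : Type*} [TopologicalSpace M] [ChartedSpace (Model d) M]
  [IsManifold (𝓡 (d + 1)) ∞ M] (g : LorentzianMetric d n M) {x : M}

theorem sum_minkowski (v w : Fin (d + 1) → ℝ) :
    ∑ μ, ∑ ν, v μ * (w ν * minkowski d μ ν) = -(v 0 * w 0) + ∑ i : Fin d, v i.succ * w i.succ := by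
  have h : ∀ μ, ∑ ν, v μ * (w ν * minkowski d μ ν) = v μ * w μ * (if μ = 0 then -1 else 1) := by
    intro μ
    rw [Finset.sum_eq_single μ]
    · simp [minkowski]
    · intro ν _ hν
      simp [minkowski, hν.symm]
    · simp
  simp only [h]
  rw [Fin.sum_univ_succ]
  simp [Fin.succ_ne_zero]

/-- With respect to a Lorentz orthonormal basis, timelike vectors have a nonzero time component,
and the product of two of them is negative iff their time components have the same sign; this is
the Cauchy-Schwarz inequality for the spatial components. -/
theorem LorentzianMetric.exists_timeComponent (x : M) :
    ∃ τ : TangentSpace (𝓡 (d + 1)) x → ℝ, ∀ v w, g.val x v v < 0 → g.val x w w < 0 →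
      g.val x v w * (τ v * τ w) < 0 := by
  obtain ⟨b, hb⟩ := g.signature x
  have hexp : ∀ v w, g.val x v w = -(b.repr v 0 * b.repr w 0) +
      ∑ i : Fin d, b.repr v i.succ * b.repr w i.succ := by
    intro v w
    rw [← sum_minkowski]
    conv_lhs => rw [← b.sum_repr v, ← b.sum_repr w]
    simp only [map_sum, map_smul, sum_apply, smul_apply,
      hb, smul_eq_mul, Finset.mul_sum]
    rw [Finset.sum_comm]
    refine Finset.sum_congr rfl fun μ _ ↦ Finset.sum_congr rfl fun ν _ ↦ ?_
    ring
  refine ⟨fun v ↦ b.repr v 0, fun v w hv hw ↦ ?_⟩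
  simp only [hexp] at hv hw ⊢
  have hcs := Finset.sum_mul_sq_le_sq_mul_sq Finset.univ (fun i : Fin d ↦ b.repr v i.succ)
    (fun i : Fin d ↦ b.repr w i.succ)
  set s := ∑ i : Fin d, b.repr v i.succ * b.repr w i.succ
  set a := b.repr v 0
  set c := b.repr w 0
  have e1 : ∑ i : Fin d, b.repr v i.succ * b.repr v i.succ = ∑ i : Fin d, b.repr v i.succ ^ 2 := by
    simp only [sq]
  have e2 : ∑ i : Fin d, b.repr w i.succ * b.repr w i.succ = ∑ i : Fin d, b.repr w i.succ ^ 2 := by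
    simp only [sq]
  rw [e1] at hv
  rw [e2] at hw
  set A := ∑ i : Fin d, b.repr v i.succ ^ 2
  set C := ∑ i : Fin d, b.repr w i.succ ^ 2
  have hA : 0 ≤ A := Finset.sum_nonneg fun i _ ↦ sq_nonneg _
  have hC : 0 ≤ C := Finset.sum_nonneg fun i _ ↦ sq_nonneg _
  have h1 : s ^ 2 < (a * c) ^ 2 := by
    have : A * C < (a * a) * (c * c) := by
      apply mul_lt_mul'' <;> linarith
    calc s ^ 2 ≤ A * C := hcs
      _ < _ := this
      _ = _ := by ring
  have h2 : |s| < |a * c| := sq_lt_sq.1 h1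
  have h3 : s * (a * c) < (a * c) * (a * c) := by
    calc s * (a * c) ≤ |s| * |a * c| := by rw [← abs_mul]; exact le_abs_self _
      _ < |a * c| * |a * c| := mul_lt_mul_of_pos_right h2 ((abs_nonneg _).trans_lt h2)
      _ = _ := abs_mul_abs_self _
  linarith

variable {u v w : TangentSpace (𝓡 (d + 1)) x}

theorem LorentzianMetric.neg_of_neg_of_neg (hu : g.val x u u < 0) (hv : g.val x v v < 0)
    (hw : g.val x w w < 0) (huv : g.val x u v < 0) (huw : g.val x u w < 0) : g.val x v w < 0 := by
  obtain ⟨τ, hτ⟩ := g.exists_timeComponent x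
  have h1 := pos_of_mul_neg_right (hτ u v hu hv) huv.le
  have h2 := pos_of_mul_neg_right (hτ u w hu hw) huw.le
  have h3 : 0 < τ v * τ w := by
    have h4 : 0 < (τ u * τ u) * (τ v * τ w) := by nlinarith [mul_pos h1 h2]
    exact pos_of_mul_pos_right h4 (mul_self_nonneg _)
  exact neg_of_mul_neg_left (hτ v w hv hw) h3.le

theorem LorentzianMetric.ne_zero_of_timelike (hu : g.val x u u < 0) (hv : g.val x v v < 0) :
    g.val x u v ≠ 0 := by
  obtain ⟨τ, hτ⟩ := g.exists_timeComponent x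
  intro h
  simpa [h] using hτ u v hu hv

end LorentzAlgebra

section FutureCone

variable {d : ℕ} {n : WithTop ℕ∞} {M : Type*} [TopologicalSpace M] [ChartedSpace (Model d) M]
  [IsManifold (𝓡 (d + 1)) ∞ M] (g : LorentzianMetric d n M)

theorem LorentzianMetric.continuousOn_val {X : Type*} [TopologicalSpace X] {s : Set X} {b : X → M}
    {v w : ∀ y, TangentSpace (𝓡 (d + 1)) (b y)}
    (hv : ContinuousOn (fun y ↦ (⟨b y, v y⟩ : TangentBundle (𝓡 (d + 1)) M)) s)
    (hw : ContinuousOn (fun y ↦ (⟨b y, w y⟩ : TangentBundle (𝓡 (d + 1)) M)) s) :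
    ContinuousOn (fun y ↦ g.val (b y) (v y) (w y)) s := by
  have hb : ContinuousOn b s := (FiberBundle.continuous_proj (Model d) _).comp_continuousOn hv
  have hψ := g.contMDiff.continuous.comp_continuousOn hb
  have h := ContinuousOn.clm_bundle_apply₂ (F₁ := Model d) (F₂ := Model d) (F₃ := ℝ)
    (E₃ := Bundle.Trivial M ℝ) hψ hv hw
  intro y hy
  have := h y hy
  simp only [FiberBundle.continuousWithinAt_totalSpace] at this
  exact this.2

/-- The timelike tangent vectors, over the points of `U`, in the same component of the cone as the
timelike field `F`. -/
def futureCone (F : ∀ x : M, TangentSpace (𝓡 (d + 1)) x) (U : Set M) :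
    Set (TangentBundle (𝓡 (d + 1)) M) :=
  {X | X.1 ∈ U ∧ g.val X.1 X.2 X.2 < 0 ∧ g.val X.1 (F X.1) X.2 < 0}

variable {g} {F : ∀ x : M, TangentSpace (𝓡 (d + 1)) x} {U : Set M}

theorem isOpen_futureCone (hU : IsOpen U)
    (hF : ContinuousOn (fun x ↦ (⟨x, F x⟩ : TangentBundle (𝓡 (d + 1)) M)) U) :
    IsOpen (futureCone g F U) := by
  have hp : Continuous (fun X : TangentBundle (𝓡 (d + 1)) M ↦ X.1) :=
    FiberBundle.continuous_proj (Model d) _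
  have hV : IsOpen ((fun X : TangentBundle (𝓡 (d + 1)) M ↦ X.1) ⁻¹' U) := hU.preimage hp
  have hid : ContinuousOn (fun X : TangentBundle (𝓡 (d + 1)) M ↦
      (⟨X.1, X.2⟩ : TangentBundle (𝓡 (d + 1)) M)) ((fun X ↦ X.1) ⁻¹' U) := continuousOn_id
  have h1 := g.continuousOn_val hid hid
  have h2 := g.continuousOn_val (hF.comp hp.continuousOn (fun X hX ↦ hX)) hid
  have h3 := (h1.prodMk h2).isOpen_inter_preimage hV
    ((isOpen_Iio (a := (0 : ℝ))).prod (isOpen_Iio (a := (0 : ℝ))))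
  convert h3 using 1
  ext X
  simp [futureCone]

theorem isConic_futureCone : IsConic (futureCone g F U) := by
  rintro X ⟨h1, h2, h3⟩ a ha
  refine ⟨h1, ?_, ?_⟩
  · simp only [map_smul, smul_apply, smul_eq_mul]
    exact mul_neg_of_pos_of_neg ha (mul_neg_of_pos_of_neg ha h2)
  · simp only [map_smul, smul_eq_mul]
    exact mul_neg_of_pos_of_neg ha h3

end FutureCone

/-! ### Timelike curves -/

section Timelike

variable {d : ℕ} {n : WithTop ℕ∞} {M : Type*} [TopologicalSpace M] [ChartedSpace (Model d) M]
  {𝒞 : Set (TangentBundle (𝓡 (d + 1)) M)} {γ : ℝ → M} {J : Set ℝ} {t : ℝ}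

theorem SideIn.reverse_right (h : SideIn 𝒞 γ (Iic t) t) :
    SideIn (oppositeCone 𝒞) (fun s ↦ γ (-s)) (Ici (-t)) (-t) := by
  have e : (fun s : ℝ ↦ (-1 : ℝ) * s + 0) ⁻¹' (Iic t) = Ici (-t) := by
    ext x; simp
  have h1 := SideIn.comp_affine (𝒞 := oppositeCone 𝒞) (a := -1) (b := 0) (t := -t) (K := Iic t)
    (γ := γ) (by simp) (by rw [e]; exact uniqueDiffWithinAt_Ici _)
    (by simpa using h.mono (fun X hX ↦ by simpa [oppositeCone] using hX))
  rw [e] at h1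
  simpa using h1

theorem SideIn.reverse_left (h : SideIn 𝒞 γ (Ici t) t) :
    SideIn (oppositeCone 𝒞) (fun s ↦ γ (-s)) (Iic (-t)) (-t) := by
  have e : (fun s : ℝ ↦ (-1 : ℝ) * s + 0) ⁻¹' (Ici t) = Iic (-t) := by
    ext x; simp
  have h1 := SideIn.comp_affine (𝒞 := oppositeCone 𝒞) (a := -1) (b := 0) (t := -t) (K := Ici t)
    (γ := γ) (by simp) (by rw [e]; exact uniqueDiffWithinAt_Iic _)
    (by simpa using h.mono (fun X hX ↦ by simpa [oppositeCone] using hX))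
  rw [e] at h1
  simpa using h1

variable [IsManifold (𝓡 (d + 1)) ∞ M]

theorem SideIn.eventually_left (h𝒞 : IsOpen 𝒞) (h : SideIn 𝒞 γ (Iic t) t) :
    ∀ᶠ s in 𝓝[<] t, SideIn 𝒞 γ (Ici s) s ∧ SideIn 𝒞 γ (Iic s) s := by
  have h1 := h.reverse_right.eventually_right (isOpen_oppositeCone h𝒞)
  have h2 : Tendsto (fun s : ℝ ↦ -s) (𝓝[<] t) (𝓝[>] (-t)) :=
    tendsto_neg_nhdsLT
  filter_upwards [h2.eventually h1] with s ⟨hs1, hs2⟩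
  have e1 := hs1.reverse_left
  have e2 := hs2.reverse_right
  rw [oppositeCone_oppositeCone] at e1 e2
  simp only [neg_neg] at e1 e2
  exact ⟨e2, e1⟩

variable {g : LorentzianMetric d n M} {F : ∀ x : M, TangentSpace (𝓡 (d + 1)) x} {U : Set M}

omit [IsManifold (𝓡 (d + 1)) ∞ M] in
theorem PiecewiseSmoothOn.right (h : PiecewiseSmoothOn d γ J) (hJ : J.OrdConnected) (ht : t ∈ J)
    (hne : (J ∩ Ioi t).Nonempty) :
    ∃ s ∈ 𝓝 t, ContMDiffOn 𝓘(ℝ, ℝ) (𝓡 (d + 1)) ∞ γ (Ici t ∩ s) := by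
  obtain ⟨ε, hε, h1, -⟩ := h t ht
  obtain ⟨u, hu, htu⟩ := hne
  refine ⟨Iic (min u (t + ε)), Iic_mem_nhds (lt_min htu (by linarith)), h1.mono ?_⟩
  rintro x ⟨hx1, hx2⟩
  have := le_min_iff.1 (mem_Iic.1 hx2)
  exact ⟨hJ.out ht hu ⟨hx1, this.1⟩, hx1, this.2⟩

omit [IsManifold (𝓡 (d + 1)) ∞ M] in
theorem PiecewiseSmoothOn.left (h : PiecewiseSmoothOn d γ J) (hJ : J.OrdConnected) (ht : t ∈ J)
    (hne : (J ∩ Iio t).Nonempty) :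
    ∃ s ∈ 𝓝 t, ContMDiffOn 𝓘(ℝ, ℝ) (𝓡 (d + 1)) ∞ γ (Iic t ∩ s) := by
  obtain ⟨ε, hε, -, h1⟩ := h t ht
  obtain ⟨u, hu, htu⟩ := hne
  refine ⟨Ici (max u (t - ε)), Ici_mem_nhds (max_lt htu (by linarith)), h1.mono ?_⟩
  rintro x ⟨hx1, hx2⟩
  have := max_le_iff.1 (mem_Ici.1 hx2)
  exact ⟨hJ.out hu ht ⟨this.1, hx1⟩, this.2, hx1⟩

omit [IsManifold (𝓡 (d + 1)) ∞ M] in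
theorem contMDiffOn_of_subset_singleton {s : Set ℝ} (h : s ⊆ {t}) :
    ContMDiffOn 𝓘(ℝ, ℝ) (𝓡 (d + 1)) ∞ γ s := by
  intro x hx
  have hx' : x = t := h hx
  subst hx'
  refine ContMDiffWithinAt.mono ?_ h
  rw [contMDiffWithinAt_iff]
  refine ⟨continuousWithinAt_singleton, contDiffWithinAt_singleton.mono ?_⟩
  intro y hy
  exact (show y = x from hy.1)

omit [IsManifold (𝓡 (d + 1)) ∞ M] in
theorem ConeCurveOn.piecewiseSmoothOn (h : ConeCurveOn 𝒞 γ J) : PiecewiseSmoothOn d γ J := by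
  intro t ht
  have hr : ∃ ε > 0, ContMDiffOn 𝓘(ℝ, ℝ) (𝓡 (d + 1)) ∞ γ (J ∩ Icc t (t + ε)) := by
    by_cases hne : (J ∩ Ioi t).Nonempty
    · obtain ⟨s, hs, hsm⟩ := (h.right t ht hne).smooth
      obtain ⟨ε, hε, hsub⟩ := Metric.nhds_basis_closedBall.mem_iff.1 hs
      rw [Real.closedBall_eq_Icc] at hsub
      exact ⟨ε, hε, hsm.mono fun x hx ↦ ⟨hx.2.1, hsub ⟨by linarith [hx.2.1], hx.2.2⟩⟩⟩
    · refine ⟨1, one_pos, contMDiffOn_of_subset_singleton (t := t) fun x hx ↦ ?_⟩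
      by_contra hxt
      exact hne ⟨x, hx.1, lt_of_le_of_ne hx.2.1 (Ne.symm hxt)⟩
  have hl : ∃ ε > 0, ContMDiffOn 𝓘(ℝ, ℝ) (𝓡 (d + 1)) ∞ γ (J ∩ Icc (t - ε) t) := by
    by_cases hne : (J ∩ Iio t).Nonempty
    · obtain ⟨s, hs, hsm⟩ := (h.left t ht hne).smooth
      obtain ⟨ε, hε, hsub⟩ := Metric.nhds_basis_closedBall.mem_iff.1 hs
      rw [Real.closedBall_eq_Icc] at hsub
      exact ⟨ε, hε, hsm.mono fun x hx ↦ ⟨hx.2.2, hsub ⟨hx.2.1, by linarith [hx.2.2]⟩⟩⟩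
    · refine ⟨1, one_pos, contMDiffOn_of_subset_singleton (t := t) fun x hx ↦ ?_⟩
      by_contra hxt
      exact hne ⟨x, hx.1, lt_of_le_of_ne hx.2.2 hxt⟩
  obtain ⟨ε₁, h1, hr⟩ := hr
  obtain ⟨ε₂, h2, hl⟩ := hl
  refine ⟨min ε₁ ε₂, lt_min h1 h2, hr.mono ?_, hl.mono ?_⟩
  · exact inter_subset_inter_right _ (Icc_subset_Icc_right (by simp))
  · exact inter_subset_inter_right _ (Icc_subset_Icc_left (by linarith [min_le_right ε₁ ε₂]))

theorem ConeCurveOn.isTimelikeOn (h : ConeCurveOn (futureCone g F U) γ J) (hJ : J.OrdConnected)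
    (hJ' : J.Nontrivial) (hF : ∀ x ∈ U, g.val x (F x) (F x) < 0) : IsTimelikeOn g γ J where
  ordConnected := hJ
  nontrivial := hJ'
  piecewiseSmooth := h.piecewiseSmoothOn
  right_timelike t ht hne := (h.right t ht hne).mem.2.1
  left_timelike t ht hne := (h.left t ht hne).mem.2.1
  same_cone t ht hne hne' := by
    obtain ⟨h1, h2, h3⟩ := (h.right t ht hne').mem
    obtain ⟨-, h5, h6⟩ := (h.left t ht hne).mem
    exact g.neg_of_neg_of_neg (hF _ h1) h5 h2 h6 h3

theorem isFutureDirectedOn_iff {T : TimeOrientation g} :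
    IsFutureDirectedOn T γ J ↔
      J.OrdConnected ∧ J.Nontrivial ∧ ConeCurveOn (futureCone g T.field univ) γ J := by
  constructor
  · intro h
    have hT := h.isTimelikeOn
    exact ⟨hT.ordConnected, hT.nontrivial,
      fun t ht hne ↦ ⟨hT.piecewiseSmooth.right hT.ordConnected ht hne, mem_univ _,
        hT.right_timelike t ht hne, h.right_future t ht hne⟩,
      fun t ht hne ↦ ⟨hT.piecewiseSmooth.left hT.ordConnected ht hne, mem_univ _,
        hT.left_timelike t ht hne, h.left_future t ht hne⟩⟩
  · rintro ⟨h1, h2, h3⟩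
    exact ⟨h3.isTimelikeOn h1 h2 (fun x _ ↦ T.timelike x),
      fun t ht hne ↦ (h3.right t ht hne).mem.2.2, fun t ht hne ↦ (h3.left t ht hne).mem.2.2⟩

/-- A timelike curve in a time-oriented region is either future directed or past directed: the
orientation of its tangent vectors is locally constant. -/
theorem IsTimelikeOn.coneCurveOn_or (h : IsTimelikeOn g γ J) (hU : IsOpen U)
    (hF : ContinuousOn (fun x ↦ (⟨x, F x⟩ : TangentBundle (𝓡 (d + 1)) M)) U)
    (hFt : ∀ x ∈ U, g.val x (F x) (F x) < 0) (hγ : ∀ t ∈ J, γ t ∈ U) :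
    ConeCurveOn (futureCone g F U) γ J ∨ ConeCurveOn (oppositeCone (futureCone g F U)) γ J := by
  classical
  have hopen := isOpen_futureCone (g := g) hU hF
  -- the curve has sides in the cone `𝒞` at `t`
  let P : Set (TangentBundle (𝓡 (d + 1)) M) → ℝ → Prop := fun 𝒞 t ↦
    ((J ∩ Ioi t).Nonempty → SideIn 𝒞 γ (Ici t) t) ∧ ((J ∩ Iio t).Nonempty → SideIn 𝒞 γ (Iic t) t)
  have hP : ∀ 𝒞, (∀ t ∈ J, P 𝒞 t) → ConeCurveOn 𝒞 γ J := fun 𝒞 h ↦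
    ⟨fun t ht ↦ (h t ht).1, fun t ht ↦ (h t ht).2⟩
  have hopp : ∀ t ∈ J, ∀ v : TangentSpace (𝓡 (d + 1)) (γ t), g.val (γ t) v v < 0 →
      0 < g.val (γ t) (F (γ t)) v →
        (⟨γ t, v⟩ : TangentBundle (𝓡 (d + 1)) M) ∈ oppositeCone (futureCone g F U) :=
    fun t ht v hv hpos ↦ ⟨hγ t ht, by simpa using hv, by simpa using hpos⟩
  have hsign : ∀ t ∈ J, ∀ v : TangentSpace (𝓡 (d + 1)) (γ t), g.val (γ t) v v < 0 →
      ((⟨γ t, v⟩ : TangentBundle (𝓡 (d + 1)) M) ∈ futureCone g F U ∨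
        (⟨γ t, v⟩ : TangentBundle (𝓡 (d + 1)) M) ∈ oppositeCone (futureCone g F U)) := by
    intro t ht v hv
    rcases lt_or_gt_of_ne (g.ne_zero_of_timelike (hFt _ (hγ t ht)) hv) with h1 | h1
    · exact Or.inl ⟨hγ t ht, hv, h1⟩
    · exact Or.inr (hopp t ht v hv h1)
  have hcases : ∀ t ∈ J, P (futureCone g F U) t ∨ P (oppositeCone (futureCone g F U)) t := by
    intro t ht
    by_cases hr : (J ∩ Ioi t).Nonempty
    · have hsr := h.piecewiseSmooth.right h.ordConnected ht hr
      by_cases hl : (J ∩ Iio t).Nonempty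
      · have hsl := h.piecewiseSmooth.left h.ordConnected ht hl
        have hlr := h.same_cone t ht hl hr
        have ht1 := h.right_timelike t ht hr
        have ht2 := h.left_timelike t ht hl
        rcases hsign t ht _ ht1 with h1 | h1
        · refine Or.inl ⟨fun _ ↦ ⟨hsr, h1⟩, fun _ ↦ ⟨hsl, hγ t ht, ht2, ?_⟩⟩
          rw [g.symm] at hlr
          have := h1.2.2
          rw [g.symm] at this ⊢
          rw [g.symm]
          exact g.neg_of_neg_of_neg ht1 (hFt _ (hγ t ht)) ht2 this hlr
        · refine Or.inr ⟨fun _ ↦ ⟨hsr, h1⟩, fun _ ↦ ⟨hsl, hopp t ht (leftTangent γ t) ht2 ?_⟩⟩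
          rw [g.symm] at hlr
          have h3 := h1.2.2
          have h4 := hFt _ (hγ t ht)
          have := g.neg_of_neg_of_neg (u := rightTangent γ t) (v := (-1 : ℝ) • F (γ t))
            (w := leftTangent γ t) ht1 (by simpa using h4) ht2
            (by rw [g.symm]; simpa using h3) hlr
          simpa using this
      · rcases hsign t ht _ (h.right_timelike t ht hr) with h1 | h1
        · exact Or.inl ⟨fun _ ↦ ⟨hsr, h1⟩, fun h ↦ absurd h hl⟩
        · exact Or.inr ⟨fun _ ↦ ⟨hsr, h1⟩, fun h ↦ absurd h hl⟩
    · by_cases hl : (J ∩ Iio t).Nonempty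
      · have hsl := h.piecewiseSmooth.left h.ordConnected ht hl
        rcases hsign t ht _ (h.left_timelike t ht hl) with h1 | h1
        · exact Or.inl ⟨fun h ↦ absurd h hr, fun _ ↦ ⟨hsl, h1⟩⟩
        · exact Or.inr ⟨fun h ↦ absurd h hr, fun _ ↦ ⟨hsl, h1⟩⟩
      · exact Or.inl ⟨fun h ↦ absurd h hr, fun h ↦ absurd h hl⟩
  have hloc : ∀ 𝒞, IsOpen 𝒞 → ∀ t ∈ J, P 𝒞 t → ∀ᶠ s in 𝓝[J] t, P 𝒞 s := by
    intro 𝒞 h𝒞 t ht hPt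
    have h1 : ∀ᶠ s in 𝓝[>] t, s ∈ J → P 𝒞 s := by
      by_cases hr : (J ∩ Ioi t).Nonempty
      · filter_upwards [(hPt.1 hr).eventually_right h𝒞] with s hs _
        exact ⟨fun _ ↦ hs.1, fun _ ↦ hs.2⟩
      · filter_upwards [self_mem_nhdsWithin] with s hs hsJ
        exact absurd ⟨s, hsJ, hs⟩ hr
    have h2 : ∀ᶠ s in 𝓝[<] t, s ∈ J → P 𝒞 s := by
      by_cases hr : (J ∩ Iio t).Nonempty
      · filter_upwards [(hPt.2 hr).eventually_left h𝒞] with s hs _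
        exact ⟨fun _ ↦ hs.1, fun _ ↦ hs.2⟩
      · filter_upwards [self_mem_nhdsWithin] with s hs hsJ
        exact absurd ⟨s, hsJ, hs⟩ hr
    have h3 : ∀ᶠ s in 𝓝[≠] t, s ∈ J → P 𝒞 s := by
      rw [← nhdsLT_sup_nhdsGT]
      exact eventually_sup.2 ⟨h2, h1⟩
    rw [eventually_nhdsWithin_iff] at h3 ⊢
    filter_upwards [h3] with s hs hsJ
    by_cases hst : s = t
    · rwa [hst]
    · exact hs hst hsJ
  have hdisj : ∀ t ∈ J, P (futureCone g F U) t → P (oppositeCone (futureCone g F U)) t → False := by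
    intro t ht h1 h2
    have key : ∀ X, X ∈ futureCone g F U → X ∈ oppositeCone (futureCone g F U) → False := by
      intro X hX hX'
      have e1 := hX.2.2
      have e2 := hX'.2.2
      simp at e2
      linarith
    obtain ⟨u, hu, hut⟩ := h.nontrivial.exists_ne t
    rcases lt_or_gt_of_ne hut with hlt | hlt
    · exact key _ (h1.2 ⟨u, hu, hlt⟩).mem (h2.2 ⟨u, hu, hlt⟩).mem
    · exact key _ (h1.1 ⟨u, hu, hlt⟩).mem (h2.1 ⟨u, hu, hlt⟩).mem
  have hconst : ContinuousOn (fun t ↦ decide (P (futureCone g F U) t)) J := by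
    intro t ht
    refine continuousWithinAt_const.congr_of_eventuallyEq
      (f := fun _ ↦ decide (P (futureCone g F U) t)) ?_ rfl
    rcases hcases t ht with h1 | h1
    · filter_upwards [hloc _ hopen t ht h1] with s hs
      simp [hs, h1]
    · filter_upwards [hloc _ (isOpen_oppositeCone hopen) t ht h1, self_mem_nhdsWithin] with s hs hsJ
      have e1 : ¬ P (futureCone g F U) t := fun h ↦ hdisj t ht h h1
      have e2 : ¬ P (futureCone g F U) s := fun h ↦ hdisj s hsJ h hs
      simp [e1, e2]
  have hpre : IsPreconnected J := h.ordConnected.isPreconnected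
  by_cases hex : ∃ t₀ ∈ J, P (futureCone g F U) t₀
  · obtain ⟨t₀, ht₀, hPt₀⟩ := hex
    refine Or.inl (hP _ fun t ht ↦ ?_)
    have := hpre.constant hconst ht ht₀
    simpa [hPt₀] using this
  · push Not at hex
    exact Or.inr (hP _ fun t ht ↦ (hcases t ht).resolve_left (hex t ht))

end Timelike

/-! ### Chronological future and Cauchy hypersurfaces -/

section Causality

variable {d : ℕ} {n : WithTop ℕ∞} {M : Type*} [TopologicalSpace M] [ChartedSpace (Model d) M]
  [IsManifold (𝓡 (d + 1)) ∞ M] {g : LorentzianMetric d n M} (T : TimeOrientation g)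
  {γ : ℝ → M} {J : Set ℝ} {a b : ℝ} {x y : M} {S : Set M}

/-- The future directed timelike tangent vectors. -/
def TimeOrientation.cone : Set (TangentBundle (𝓡 (d + 1)) M) := futureCone g T.field univ

theorem TimeOrientation.isOpen_cone : IsOpen T.cone :=
  isOpen_futureCone isOpen_univ T.continuous.continuousOn

theorem TimeOrientation.isConic_cone : IsConic T.cone := isConic_futureCone

theorem TimeOrientation.field_ne_zero (x : M) : T.field x ≠ 0 := by
  intro h
  simpa [h] using T.timelike x

theorem mem_chronologicalFuture_iff :
    y ∈ chronologicalFuture T S ↔ ∃ x ∈ S, Reach T.cone x y := by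
  constructor
  · rintro ⟨γ, hγ, h0, h1⟩
    exact ⟨γ 0, h0, γ, 0, 1, one_pos, (isFutureDirectedOn_iff.1 hγ).2.2, rfl, h1⟩
  · rintro ⟨x, hx, h⟩
    obtain ⟨γ, hγ, h0, h1⟩ := h.exists_on T.isConic_cone (zero_lt_one (α := ℝ))
    exact ⟨γ, isFutureDirectedOn_iff.2 ⟨ordConnected_Icc,
      ⟨0, by simp, 1, by simp, by simp⟩, hγ⟩, h0 ▸ hx, h1⟩

theorem isOpen_chronologicalFuture : IsOpen (chronologicalFuture T S) := by
  rw [isOpen_iff_mem_nhds]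
  intro y hy
  obtain ⟨x, hx, h⟩ := (mem_chronologicalFuture_iff T).1 hy
  filter_upwards [h.eventually_right T.isOpen_cone] with z hz
  exact (mem_chronologicalFuture_iff T).2 ⟨x, hx, hz⟩

variable [T2Space M] [SecondCountableTopology M]

/-- Every future directed curve can be continued at its end point so as to become future
inextendible. -/
theorem exists_extend_future (hb : IsGreatest J b)
    (h : ConeCurveOn T.cone γ J) :
    ∃ γ' : ℝ → M, ConeCurveOn T.cone γ' (J ∪ Ici b) ∧ EqOn γ' γ J ∧
      ¬ ∃ q, Tendsto γ' atTop (𝓝 q) := by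
  obtain ⟨c, hc, hc0, hlim⟩ := exists_coneCurveOn_Ici_not_tendsto T.isOpen_cone T.isConic_cone
    (fun x ↦ ⟨T.field x, T.field_ne_zero x, mem_univ _, T.timelike x, T.timelike x⟩) (γ b)
  have hc' := hc.shift (-b)
  refine ⟨_, ConeCurveOn.glue (m := b) (γ₁ := γ) (γ₂ := fun s ↦ c (s + -b)) (Or.inr self_mem_Ici)
    (h.mono_set ?_) (hc'.mono_set ?_) (by simp [hc0]), ?_, ?_⟩
  · rintro s ⟨hs | hs, hs'⟩
    · exact hs
    · obtain rfl : s = b := le_antisymm hs' hs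
      exact hb.1
  · rintro s ⟨-, hs⟩
    have : b ≤ s := hs
    simp [this]
  · intro s hs
    simp [show s ≤ b from hb.2 hs]
  · rintro ⟨q, hq⟩
    refine hlim ⟨q, ?_⟩
    have h1 : Tendsto (fun s : ℝ ↦ s + b) atTop atTop := tendsto_atTop_add_const_right _ _ tendsto_id
    refine (hq.comp h1).congr' ?_
    filter_upwards [eventually_gt_atTop 0] with s hs
    simp [hs]

theorem exists_extend_past (ha : IsLeast J a)
    (h : ConeCurveOn T.cone γ J) :
    ∃ γ' : ℝ → M, ConeCurveOn T.cone γ' (J ∪ Iic a) ∧ EqOn γ' γ J ∧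
      ¬ ∃ q, Tendsto γ' atBot (𝓝 q) := by
  obtain ⟨c, hc, hc0, hlim⟩ := exists_coneCurveOn_Ici_not_tendsto
    (isOpen_oppositeCone T.isOpen_cone) T.isConic_cone.oppositeCone
    (fun x ↦ ⟨(-1 : ℝ) • T.field x, by simpa using T.field_ne_zero x, by
      have := T.timelike x
      simpa [oppositeCone, TimeOrientation.cone, futureCone] using this⟩) (γ a)
  have hc' := hc.reverse.shift (-a)
  rw [oppositeCone_oppositeCone] at hc'
  refine ⟨_, ConeCurveOn.glue (m := a) (γ₁ := fun s ↦ c (-(s + -a))) (γ₂ := γ) (Or.inr self_mem_Iic)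
    (hc'.mono_set ?_) (h.mono_set ?_) (by simp [hc0]), ?_, ?_⟩
  · rintro s ⟨-, hs⟩
    have : s ≤ a := hs
    simp [this]
  · rintro s ⟨hs | hs, hs'⟩
    · exact hs
    · obtain rfl : s = a := le_antisymm hs hs'
      exact ha.1
  · intro s hs
    have has := ha.2 hs
    rcases has.eq_or_lt with rfl | hlt
    · simp [hc0]
    · simp [not_le.2 hlt]
  · rintro ⟨q, hq⟩
    refine hlim ⟨q, ?_⟩
    have h1 : Tendsto (fun s : ℝ ↦ a - s) atTop atBot := by
      simpa [sub_eq_add_neg] using tendsto_atBot_add_const_left atTop a tendsto_neg_atTop_atBot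
    refine (hq.comp h1).congr' ?_
    filter_upwards [eventually_gt_atTop 0] with s hs
    simp [hs.le]

variable {T}

omit [T2Space M] [SecondCountableTopology M] in
theorem existsUnique_of_coneCurveOn (hS : IsCauchyHypersurface g S) (hJ : J.OrdConnected)
    (hJ' : J.Nontrivial) (h : ConeCurveOn T.cone γ J) (hi : IsInextendibleOn γ J) :
    ∃! t, t ∈ J ∧ γ t ∈ S :=
  hS γ J (h.isTimelikeOn hJ hJ' (fun x _ ↦ T.timelike x)) hi

/-- A Cauchy hypersurface is achronal. -/
theorem IsCauchyHypersurface.not_reach (hS : IsCauchyHypersurface g S) (hx : x ∈ S) (hy : y ∈ S) :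
    ¬ Reach T.cone x y := by
  rintro ⟨γ, a, b, hab, hγ, rfl, rfl⟩
  obtain ⟨γ₁, h1, e1, hl1⟩ := exists_extend_past T (isLeast_Icc hab.le) hγ
  have hI : Icc a b ∪ Iic a = Iic b := by
    ext s; simp only [mem_union, mem_Icc, mem_Iic]; grind
  rw [hI] at h1
  obtain ⟨γ₂, h2, e2, hl2⟩ := exists_extend_future T isGreatest_Iic h1
  rw [Iic_union_Ici] at h2
  have hinext : IsInextendibleOn γ₂ univ := by
    constructor
    · rintro ⟨q, hq⟩
      refine hl2 ⟨q, ?_⟩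
      rw [← map_val_atTop_of_Ici_subset (subset_univ (Ici b))]
      exact hq
    · rintro ⟨q, hq⟩
      refine hl1 ⟨q, ?_⟩
      have : Tendsto γ₂ atBot (𝓝 q) := by
        rw [← map_val_atBot_of_Iic_subset (subset_univ (Iic b))]
        exact hq
      refine this.congr' ?_
      filter_upwards [eventually_le_atBot b] with s hs
      exact e2 hs
  have hu := existsUnique_of_coneCurveOn hS ordConnected_univ
    ⟨0, mem_univ _, 1, mem_univ _, by simp⟩ h2 hinext
  have ha : γ₂ a = γ a := (e2 hab.le).trans (e1 ⟨le_rfl, hab.le⟩)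
  have hb : γ₂ b = γ b := (e2 self_mem_Iic).trans (e1 ⟨hab.le, le_rfl⟩)
  exact hab.ne (hu.unique ⟨mem_univ _, ha ▸ hx⟩ ⟨mem_univ _, hb ▸ hy⟩)

/-- A past inextendible curve enters the timelike past of the Cauchy hypersurface. -/
theorem IsCauchyHypersurface.exists_reach_of_past_inextendible (hS : IsCauchyHypersurface g S)
    (hab : a < b) (h : ConeCurveOn T.cone γ (Ioc a b))
    (hlim : ¬ ∃ q, Tendsto γ (𝓝[>] a) (𝓝 q)) :
    ∃ t ∈ Ioc a b, ∃ y ∈ S, Reach T.cone (γ t) y := by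
  obtain ⟨γ₁, h1, e1, hl1⟩ := exists_extend_future T (isGreatest_Ioc hab) h
  have hI : Ioc a b ∪ Ici b = Ioi a := by
    ext s; simp only [mem_union, mem_Ioc, mem_Ioi, mem_Ici]; grind
  rw [hI] at h1
  have hinext : IsInextendibleOn γ₁ (Ioi a) := by
    constructor
    · rintro ⟨q, hq⟩
      refine hl1 ⟨q, ?_⟩
      rw [← map_val_atTop_of_Ici_subset (s := Ioi a) (a := b) (fun s hs ↦ lt_of_lt_of_le hab hs)]
      exact hq
    · rintro ⟨q, hq⟩
      refine hlim ⟨q, ((tendsto_comp_coe_Ioi_atBot (f := γ₁)).1 hq).congr' ?_⟩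
      filter_upwards [Ioc_mem_nhdsGT hab] with s hs
      exact e1 hs
  obtain ⟨t, ⟨hta, htS⟩, -⟩ := existsUnique_of_coneCurveOn hS ordConnected_Ioi
    ⟨a + 1, by simp, a + 2, by simp, by simp⟩ h1 hinext
  have hta' : a < t := hta
  set m := (a + min t b) / 2 with hm
  have hmin : a < min t b := lt_min hta hab
  have hm1 : a < m := by linarith
  have hm2 : m < min t b := by linarith
  have hmb : m ∈ Ioc a b := ⟨hm1, hm2.le.trans (min_le_right _ _)⟩
  refine ⟨m, hmb, _, htS, ?_⟩
  rw [← e1 hmb]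
  exact h1.reach ordConnected_Ioi hm1 hta (hm2.trans_le (min_le_left _ _))

/-- A future inextendible curve enters the timelike future of the Cauchy hypersurface. -/
theorem IsCauchyHypersurface.exists_reach_of_future_inextendible (hS : IsCauchyHypersurface g S)
    (hab : a < b) (h : ConeCurveOn T.cone γ (Ico a b))
    (hlim : ¬ ∃ q, Tendsto γ (𝓝[<] b) (𝓝 q)) :
    ∃ t ∈ Ico a b, ∃ y ∈ S, Reach T.cone y (γ t) := by
  obtain ⟨γ₁, h1, e1, hl1⟩ := exists_extend_past T (isLeast_Ico hab) h
  have hI : Ico a b ∪ Iic a = Iio b := by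
    ext s; simp only [mem_union, mem_Ico, mem_Iio, mem_Iic]; grind
  rw [hI] at h1
  have hinext : IsInextendibleOn γ₁ (Iio b) := by
    constructor
    · rintro ⟨q, hq⟩
      refine hlim ⟨q, ((tendsto_comp_coe_Iio_atTop (f := γ₁)).1 hq).congr' ?_⟩
      filter_upwards [Ico_mem_nhdsLT hab] with s hs
      exact e1 hs
    · rintro ⟨q, hq⟩
      refine hl1 ⟨q, ?_⟩
      rw [← map_val_atBot_of_Iic_subset (s := Iio b) (a := a) (fun s hs ↦ lt_of_le_of_lt hs hab)]
      exact hq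
  obtain ⟨t, ⟨hta, htS⟩, -⟩ := existsUnique_of_coneCurveOn hS ordConnected_Iio
    ⟨b - 1, by simp, b - 2, by simp, by simp⟩ h1 hinext
  have hta' : t < b := hta
  set m := (b + max t a) / 2 with hm
  have hmax : max t a < b := max_lt hta hab
  have hm1 : m < b := by linarith
  have hm2 : max t a < m := by linarith
  have hmb : m ∈ Ico a b := ⟨(le_max_right _ _).trans hm2.le, hm1⟩
  refine ⟨m, hmb, _, htS, ?_⟩
  rw [← e1 hmb]
  exact h1.reach ordConnected_Iio hta hm1 ((le_max_left _ _).trans_lt hm2)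

end Causality

/-! ### Smooth embeddings in equal dimensions -/

section Embedding

variable {d : ℕ} {M : Type*} [TopologicalSpace M] [ChartedSpace (Model d) M]
  {N : Type*} [TopologicalSpace N] [ChartedSpace (Model d) N] {ι : M → N}

/-- A smooth embedding between manifolds of the same dimension has, locally, a smooth inverse
defined on an open set: in suitable charts it is the inclusion `u ↦ (u, 0)` into a product whose
second factor is trivial for dimension reasons. -/
theorem exists_local_inverse (hι : Manifold.IsSmoothEmbedding (𝓡 (d + 1)) (𝓡 (d + 1)) ∞ ι) (x : M) :
    ∃ (W : Set N) (σ : N → M), IsOpen W ∧ ι x ∈ W ∧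
      ContMDiffOn (𝓡 (d + 1)) (𝓡 (d + 1)) ∞ σ W ∧ ∀ y ∈ W, ι (σ y) = y := by
  obtain ⟨F, _, _, hF⟩ := hι.isImmersion
  have h := hF x
  set φ := h.domChart
  set ψ := h.codChart
  set e := h.equiv
  have : FiniteDimensional ℝ (Model d × F) := e.symm.toLinearEquiv.finiteDimensional
  have : FiniteDimensional ℝ F := FiniteDimensional.of_surjective
    (LinearMap.snd ℝ (Model d) F) LinearMap.snd_surjective
  have hfr : Module.finrank ℝ (Model d × F) = Module.finrank ℝ (Model d) :=
    e.toLinearEquiv.finrank_eq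
  rw [Module.finrank_prod] at hfr
  have hF0 : Module.finrank ℝ F = 0 := by omega
  have hsub : Subsingleton F := Module.finrank_zero_iff.1 hF0
  have hloc : ∀ x' ∈ φ.source, ψ (ι x') = e (φ x', 0) := by
    intro x' hx'
    have h0 : φ x' ∈ (h.domChart.extend (𝓡 (d + 1))).target := by
      simpa [φ] using φ.map_source hx'
    have h1 := h.writtenInCharts h0
    simpa [φ, ψ, e, h.domChart.left_inv hx'] using h1
  set L : Model d → Model d := fun z ↦ (e.symm z).1 with hL
  have hLs : ContDiff ℝ ∞ L := (ContinuousLinearMap.fst ℝ (Model d) F).contDiff.comp e.symm.contDiff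
  have hφ := h.domChart_mem_maximalAtlas
  have hψ := h.codChart_mem_maximalAtlas
  have hx : x ∈ φ.source := h.mem_domChart_source
  have hιx : ι x ∈ ψ.source := h.mem_codChart_source
  refine ⟨ψ.source ∩ ψ ⁻¹' (L ⁻¹' φ.target), φ.symm ∘ L ∘ ψ,
    ψ.isOpen_inter_preimage (φ.open_target.preimage hLs.continuous), ⟨hιx, ?_⟩, ?_, ?_⟩
  · simp only [mem_preimage, hL, hloc x hx]
    simpa using φ.map_source hx
  · refine (contMDiffOn_symm_of_mem_maximalAtlas hφ).comp
      (hLs.contMDiff.comp_contMDiffOn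
        ((contMDiffOn_of_mem_maximalAtlas hψ).mono inter_subset_left)) (fun y hy ↦ hy.2)
  · rintro y ⟨hy, hy'⟩
    have hs : φ.symm (L (ψ y)) ∈ φ.source := φ.map_target hy'
    refine ψ.injOn (h.source_subset_preimage_source hs) hy ?_
    rw [hloc _ hs, φ.right_inv hy']
    have : ((L (ψ y), 0) : Model d × F) = e.symm (ψ y) := Prod.ext rfl (Subsingleton.elim _ _)
    rw [this, e.apply_symm_apply]

theorem isOpen_range_of_isSmoothEmbedding
    (hι : Manifold.IsSmoothEmbedding (𝓡 (d + 1)) (𝓡 (d + 1)) ∞ ι) : IsOpen (range ι) := by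
  rw [isOpen_iff_forall_mem_open]
  rintro _ ⟨x, rfl⟩
  obtain ⟨W, σ, hW, hxW, -, hσ⟩ := exists_local_inverse hι x
  exact ⟨W, fun y hy ↦ ⟨σ y, hσ y hy⟩, hW, hxW⟩

theorem isOpenMap_of_isSmoothEmbedding
    (hι : Manifold.IsSmoothEmbedding (𝓡 (d + 1)) (𝓡 (d + 1)) ∞ ι) : IsOpenMap ι :=
  IsOpenEmbedding.isOpenMap ⟨hι.isEmbedding, isOpen_range_of_isSmoothEmbedding hι⟩

theorem exists_smooth_inverse [Nonempty M]
    (hι : Manifold.IsSmoothEmbedding (𝓡 (d + 1)) (𝓡 (d + 1)) ∞ ι) :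
    ∃ σ : N → M, (∀ x, σ (ι x) = x) ∧ ContMDiffOn (𝓡 (d + 1)) (𝓡 (d + 1)) ∞ σ (range ι) := by
  have hinv : ∀ x, Function.invFun ι (ι x) = x := Function.leftInverse_invFun hι.isEmbedding.injective
  refine ⟨Function.invFun ι, hinv, ?_⟩
  rintro _ ⟨x, rfl⟩
  obtain ⟨W, σ, hW, hxW, hsm, hσ⟩ := exists_local_inverse hι x
  refine ((hsm.contMDiffAt (hW.mem_nhds hxW)).congr_of_eventuallyEq ?_).contMDiffWithinAt
  filter_upwards [hW.mem_nhds hxW] with y hy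
  conv_lhs => rw [← hσ y hy]
  exact hinv _

end Embedding

section Transport

variable {d : ℕ} {M : Type*} [TopologicalSpace M] [ChartedSpace (Model d) M]
  [IsManifold (𝓡 (d + 1)) ∞ M]
  {N : Type*} [TopologicalSpace N] [ChartedSpace (Model d) N] [IsManifold (𝓡 (d + 1)) ∞ N]
  {g : LorentzianMetric d ∞ M} {T : TimeOrientation g} {g' : LorentzianMetric d 0 N} {ι : M → N}
  {F : ∀ x : N, TangentSpace (𝓡 (d + 1)) x} {U : Set N} {c : ℝ → N} {γ : ℝ → M} {J : Set ℝ}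

variable (T g' ι F U) in
/-- The points of `M` at which the time orientation of `M` agrees with the one that the timelike
field `F` induces on the region `U` of `N`. -/
def agreeSet : Set M :=
  {x | ι x ∈ U ∧ g'.val (ι x) (F (ι x)) (mfderiv (𝓡 (d + 1)) (𝓡 (d + 1)) ι x (T.field x)) < 0}

theorem continuousOn_val_field (hsm : ContMDiff (𝓡 (d + 1)) (𝓡 (d + 1)) ∞ ι)
    (hF : ContinuousOn (fun x ↦ (⟨x, F x⟩ : TangentBundle (𝓡 (d + 1)) N)) U) :
    ContinuousOn (fun x ↦ g'.val (ι x) (F (ι x))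
      (mfderiv (𝓡 (d + 1)) (𝓡 (d + 1)) ι x (T.field x))) (ι ⁻¹' U) := by
  have : IsManifold (𝓡 (d + 1)) 1 M := .of_le (n := ∞) (by simp)
  have : IsManifold (𝓡 (d + 1)) 1 N := .of_le (n := ∞) (by simp)
  have h1 := hF.comp hsm.continuous.continuousOn (mapsTo_preimage ι U)
  have h2 := ((hsm.continuous_tangentMap (by simp)).comp T.continuous).continuousOn (s := ι ⁻¹' U)
  exact g'.continuousOn_val (b := ι) (v := fun x ↦ F (ι x))
    (w := fun x ↦ mfderiv (𝓡 (d + 1)) (𝓡 (d + 1)) ι x (T.field x)) h1 h2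

theorem isOpen_agreeSet (hsm : ContMDiff (𝓡 (d + 1)) (𝓡 (d + 1)) ∞ ι) (hU : IsOpen U)
    (hF : ContinuousOn (fun x ↦ (⟨x, F x⟩ : TangentBundle (𝓡 (d + 1)) N)) U) :
    IsOpen (agreeSet T g' ι F U) := by
  have h := (continuousOn_val_field (T := T) (g' := g') hsm hF).isOpen_inter_preimage
    (hU.preimage hsm.continuous) (isOpen_Iio (a := (0 : ℝ)))
  convert h using 1
  ext x
  simp [agreeSet]

theorem timelike_mfderiv_field
    (hiso : ∀ (x : M) (v w : TangentSpace (𝓡 (d + 1)) x),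
      g'.val (ι x) (mfderiv (𝓡 (d + 1)) (𝓡 (d + 1)) ι x v)
        (mfderiv (𝓡 (d + 1)) (𝓡 (d + 1)) ι x w) = g.val x v w) (x : M) :
    g'.val (ι x) (mfderiv (𝓡 (d + 1)) (𝓡 (d + 1)) ι x (T.field x))
      (mfderiv (𝓡 (d + 1)) (𝓡 (d + 1)) ι x (T.field x)) < 0 := by
  rw [hiso]
  exact T.timelike x

/-- Agreement of the time orientations propagates along connected sets. -/
theorem subset_agreeSet (hι : IsC0Extension g g' ι) (hU : IsOpen U)
    (hF : ContinuousOn (fun x ↦ (⟨x, F x⟩ : TangentBundle (𝓡 (d + 1)) N)) U)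
    (hFt : ∀ x ∈ U, g'.val x (F x) (F x) < 0) {A : Set M} (hA : IsPreconnected A)
    (hAU : A ⊆ ι ⁻¹' U) (hne : (A ∩ agreeSet T g' ι F U).Nonempty) : A ⊆ agreeSet T g' ι F U := by
  have hsm := hι.isSmoothEmbedding.contMDiff
  have h := (continuousOn_val_field (T := T) (g' := g') hsm hF).isOpen_inter_preimage
    (hU.preimage hsm.continuous) (isOpen_Ioi (a := (0 : ℝ)))
  refine hA.subset_left_of_subset_union (isOpen_agreeSet hsm hU hF) h ?_ ?_ hne
  · rw [disjoint_left]
    rintro x ⟨-, h1⟩ ⟨-, h2⟩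
    exact lt_asymm h1 h2
  · intro x hx
    have hxU : ι x ∈ U := hAU hx
    rcases lt_or_gt_of_ne (g'.ne_zero_of_timelike (hFt _ hxU)
      (timelike_mfderiv_field (T := T) hι.isometric x)) with h1 | h1
    · exact Or.inl ⟨hxU, h1⟩
    · exact Or.inr ⟨hxU, h1⟩

/-- A future directed curve of `N` that runs in the image of `M` is a future directed curve of `M`,
provided the time orientations agree at one of its points. -/
theorem coneCurveOn_of_range (hι : IsC0Extension g g' ι) (hU : IsOpen U)
    (hF : ContinuousOn (fun x ↦ (⟨x, F x⟩ : TangentBundle (𝓡 (d + 1)) N)) U)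
    (hFt : ∀ x ∈ U, g'.val x (F x) (F x) < 0) (hJ : J.OrdConnected) (hJ' : J.Nontrivial)
    (hc : ConeCurveOn (futureCone g' F U) c J) (hγ : ∀ t ∈ J, ι (γ t) = c t)
    (hagree : ∃ t ∈ J, γ t ∈ agreeSet T g' ι F U) :
    (∀ t ∈ J, γ t ∈ agreeSet T g' ι F U) ∧ ConeCurveOn T.cone γ J := by
  have hsm := hι.isSmoothEmbedding.contMDiff
  obtain ⟨t₀, ht₀, htA⟩ := hagree
  have : Nonempty M := ⟨γ t₀⟩
  obtain ⟨σ, hσ, hσs⟩ := exists_smooth_inverse hι.isSmoothEmbedding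
  have hopen := isOpen_range_of_isSmoothEmbedding hι.isSmoothEmbedding
  have hγσ : EqOn (σ ∘ c) γ J := fun t ht ↦ by simp [← hγ t ht, hσ]
  have hcU : ∀ t ∈ J, c t ∈ U := by
    intro t ht
    obtain ⟨u, hu, hut⟩ := hJ'.exists_ne t
    rcases lt_or_gt_of_ne hut with hlt | hlt
    · exact (hc.left t ht ⟨u, hu, hlt⟩).mem.1
    · exact (hc.right t ht ⟨u, hu, hlt⟩).mem.1
  have hcont : ContinuousOn γ J := by
    refine (hσs.continuousOn.comp hc.continuousOn (fun t ht ↦ ?_)).congr hγσ.symm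
    rw [← hγ t ht]
    exact mem_range_self _
  have hall : ∀ t ∈ J, γ t ∈ agreeSet T g' ι F U := by
    have := subset_agreeSet (T := T) hι hU hF hFt (hJ.isPreconnected.image γ hcont)
      (by rintro _ ⟨t, ht, rfl⟩; simpa [hγ t ht] using hcU t ht) ⟨γ t₀, ⟨t₀, ht₀, rfl⟩, htA⟩
    exact fun t ht ↦ this ⟨t, ht, rfl⟩
  -- the differential of the inverse maps the cone of `N` to the cone of `M`
  have key : ∀ t ∈ J, ∀ K : Set ℝ, t ∈ K → UniqueDiffWithinAt ℝ K t →
      SideIn (futureCone g' F U) c K t → SideIn T.cone (σ ∘ c) K t := by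
    intro t ht K hK hKu h
    have htr : c t ∈ range ι := ⟨γ t, hγ t ht⟩
    refine SideIn.comp hopen hσs hK hKu htr ⟨h.smooth, ?_⟩
    set X := tangentMapWithin 𝓘(ℝ, ℝ) (𝓡 (d + 1)) c K ⟨t, (1 : ℝ)⟩ with hX
    have hX1 : X.1 = ι (γ t) := (hγ t ht).symm
    clear_value X
    obtain ⟨z, v⟩ := X
    simp only at hX1
    subst hX1
    have hmem : (⟨ι (γ t), v⟩ : TangentBundle (𝓡 (d + 1)) N) ∈ futureCone g' F U := by
      have := h.mem
      rwa [← hX] at this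
    change (⟨σ (ι (γ t)), mfderiv (𝓡 (d + 1)) (𝓡 (d + 1)) σ (ι (γ t)) v⟩ :
      TangentBundle (𝓡 (d + 1)) M) ∈ T.cone
    set w := mfderiv (𝓡 (d + 1)) (𝓡 (d + 1)) σ (ι (γ t)) v with hw
    have hwv : mfderiv (𝓡 (d + 1)) (𝓡 (d + 1)) ι (σ (ι (γ t))) w = v := by
      have h1 := mfderiv_comp (I := 𝓡 (d + 1)) (I' := 𝓡 (d + 1)) (I'' := 𝓡 (d + 1)) (ι (γ t))
        (g := ι) (f := σ) ((hsm _).mdifferentiableAt (by simp))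
        ((hσs.contMDiffAt (hopen.mem_nhds (mem_range_self _))).mdifferentiableAt (by simp))
      have h2 : (ι ∘ σ) =ᶠ[𝓝 (ι (γ t))] id := by
        filter_upwards [hopen.mem_nhds (mem_range_self (γ t))] with y hy
        obtain ⟨x, rfl⟩ := hy
        simp [hσ]
      have h3 := h2.mfderiv_eq (I := 𝓡 (d + 1)) (I' := 𝓡 (d + 1))
      rw [h1, mfderiv_id] at h3
      exact DFunLike.congr_fun h3 v
    clear_value w
    obtain ⟨h4, h5, h6⟩ := hmem
    have h7 := (hall t ht).2
    simp only at h4 h5 h6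
    generalize hy : σ (ι (γ t)) = y at w hwv
    obtain rfl : y = γ t := by rw [← hy, hσ]
    rw [← hwv] at h5 h6
    refine ⟨mem_univ _, ?_, ?_⟩
    · rwa [hι.isometric] at h5
    · have := g'.neg_of_neg_of_neg (hFt _ h4) (timelike_mfderiv_field (T := T) hι.isometric _)
        h5 h7 h6
      rwa [hι.isometric] at this
  refine ⟨hall, ConeCurveOn.congr (γ₁ := σ ∘ c) ⟨fun t ht hne ↦ ?_, fun t ht hne ↦ ?_⟩ hJ hγσ⟩
  · exact key t ht _ self_mem_Ici (uniqueDiffWithinAt_Ici t) (hc.right t ht hne)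
  · exact key t ht _ self_mem_Iic (uniqueDiffWithinAt_Iic t) (hc.left t ht hne)

end Transport

/-! ### Boxes adapted to the boundary -/

section Coordinates

variable {d : ℕ} {ε₀ ε₁ : ℝ}

/-- The point of `ℝ^{d+1}` with time coordinate `s` and spatial part `y`. -/
def pt (s : ℝ) (y : EuclideanSpace ℝ (Fin d)) : Model d := WithLp.toLp 2 (Fin.cons s fun i ↦ y i)

/-- The coordinate vector `∂₀`. -/
def timeDir (d : ℕ) : Model d := EuclideanSpace.single 0 (1 : ℝ)

@[simp] theorem pt_zero (s : ℝ) (y : EuclideanSpace ℝ (Fin d)) : pt s y 0 = s := rfl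

@[simp] theorem pt_succ (s : ℝ) (y : EuclideanSpace ℝ (Fin d)) (i : Fin d) :
    pt s y i.succ = y i := rfl

@[simp] theorem spatial_apply (x : Model d) (i : Fin d) : spatial x i = x i.succ := rfl

theorem model_ext {x y : Model d} (h0 : x 0 = y 0) (h : ∀ i : Fin d, x i.succ = y i.succ) :
    x = y := by
  ext i
  exact Fin.cases h0 h i

theorem pt_spatial (x : Model d) : pt (x 0) (spatial x) = x := model_ext rfl fun _ ↦ rfl

@[simp] theorem timeDir_zero : timeDir d 0 = 1 := by simp [timeDir]

@[simp] theorem timeDir_succ (i : Fin d) : timeDir d i.succ = 0 := by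
  simp [timeDir, Fin.succ_ne_zero]

theorem pt_add_smul_timeDir (s u : ℝ) (y : EuclideanSpace ℝ (Fin d)) :
    pt s y + u • timeDir d = pt (s + u) y :=
  model_ext (by simp) fun i ↦ by simp

theorem pt_add_smul_pt (s r t : ℝ) (y z : EuclideanSpace ℝ (Fin d)) :
    pt s y + t • pt r z = pt (s + t * r) (y + t • z) :=
  model_ext (by simp) fun i ↦ by simp

theorem norm_pt_one_sub_timeDir (y : EuclideanSpace ℝ (Fin d)) : ‖pt 1 y - timeDir d‖ = ‖y‖ := by
  rw [EuclideanSpace.norm_eq, EuclideanSpace.norm_eq, Fin.sum_univ_succ]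
  simp

theorem continuous_spatial : Continuous (spatial : Model d → EuclideanSpace ℝ (Fin d)) := by
  unfold spatial
  fun_prop

theorem continuous_pt (y : EuclideanSpace ℝ (Fin d)) : Continuous (fun s ↦ pt s y) := by
  have : (fun s ↦ pt s y) = fun s ↦ pt 0 y + s • timeDir d := by
    funext s
    rw [pt_add_smul_timeDir, zero_add]
  rw [this]
  fun_prop

theorem isOpen_cube : IsOpen (cube d ε₁) := by
  have : cube d ε₁ = ⋂ i : Fin d, {y | y i ∈ Ioo (-ε₁) ε₁} := by
    ext y; simp [cube]
  rw [this]
  exact isOpen_iInter_of_finite fun i ↦ isOpen_Ioo.preimage (by fun_prop)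

theorem isOpen_box : IsOpen (box d ε₀ ε₁) :=
  (isOpen_Ioo.preimage (by fun_prop : Continuous fun x : Model d ↦ x 0)).inter
    (isOpen_cube.preimage continuous_spatial)

theorem convex_cube : Convex ℝ (cube d ε₁) := by
  intro y hy z hz a b ha hb hab i
  exact (convex_Ioo (-ε₁) ε₁) (hy i) (hz i) ha hb hab

theorem pt_mem_box {s : ℝ} {y : EuclideanSpace ℝ (Fin d)} :
    pt s y ∈ box d ε₀ ε₁ ↔ s ∈ Ioo (-ε₀) ε₀ ∧ y ∈ cube d ε₁ := Iff.rfl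

theorem add_smul_timeDir_mem_box {x : Model d} {u : ℝ} (hx : x ∈ box d ε₀ ε₁) :
    x + u • timeDir d ∈ box d ε₀ ε₁ ↔ x 0 + u ∈ Ioo (-ε₀) ε₀ := by
  rw [← pt_spatial x, pt_add_smul_timeDir, pt_mem_box]
  simp [hx.2]

end Coordinates

section AdaptedBox

variable {d : ℕ} {M : Type*} [TopologicalSpace M] [ChartedSpace (Model d) M]
  [IsManifold (𝓡 (d + 1)) ∞ M]
  {N : Type*} [TopologicalSpace N] [ChartedSpace (Model d) N] [IsManifold (𝓡 (d + 1)) ∞ N]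

/-- The vector field on the domain of the chart `φ` whose coordinates are constantly `w`. -/
def chartField (φ : OpenPartialHomeomorph N (Model d)) (w : Model d) (x : N) :
    TangentSpace (𝓡 (d + 1)) x := (chartVec φ (φ x) w).2

omit [IsManifold (𝓡 (d + 1)) ∞ N] in
theorem mk_chartField {φ : OpenPartialHomeomorph N (Model d)} (w : Model d) {x : N}
    (hx : x ∈ φ.source) :
    (⟨x, chartField φ w x⟩ : TangentBundle (𝓡 (d + 1)) N) = chartVec φ (φ x) w := by
  have h : (chartVec φ (φ x) w).1 = x := φ.left_inv hx
  ext
  · exact h.symm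
  · rfl

theorem continuousOn_chartField {φ : OpenPartialHomeomorph N (Model d)}
    (hφ : φ ∈ IsManifold.maximalAtlas (𝓡 (d + 1)) ∞ N) (w : Model d) :
    ContinuousOn (fun x ↦ (⟨x, chartField φ w x⟩ : TangentBundle (𝓡 (d + 1)) N)) φ.source := by
  have h1 : ContinuousOn (fun x ↦ (φ x, w)) φ.source := φ.continuousOn.prodMk continuousOn_const
  exact ((continuousOn_chartVec hφ).comp h1 (fun x hx ↦ ⟨φ.map_source hx, mem_univ _⟩)).congr
    (fun x hx ↦ mk_chartField w hx)

/-- The timelike vectors over the domain of the chart `φ` that point to the same side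
as `∂₀`. -/
def chartCone (g' : LorentzianMetric d 0 N) (φ : OpenPartialHomeomorph N (Model d)) :
    Set (TangentBundle (𝓡 (d + 1)) N) :=
  futureCone g' (chartField φ (timeDir d)) φ.source

/-- A chart `φ` of `N` onto a box about a point that is not in the image of `M`, in which
the vectors `ρ`-close to `∂₀` are timelike, such that a neighbourhood of the bottom of the
box lies in the timelike future of `S` in `M`, with `∂₀` being future directed there. The base of
the box is so small that all points of height `ε₀ / 2` are seen from the origin in a direction
`ρ`-close to `∂₀`. -/
structure AdaptedBox {g : LorentzianMetric d ∞ M} (T : TimeOrientation g)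
    (g' : LorentzianMetric d 0 N) (ι : M → N) (S : Set M)
    (φ : OpenPartialHomeomorph N (Model d)) (ε₀ ε₁ ρ η : ℝ) : Prop where
  pos₀ : 0 < ε₀
  pos₁ : 0 < ε₁
  posρ : 0 < ρ
  posη : 0 < η
  smooth : φ ∈ IsManifold.maximalAtlas (𝓡 (d + 1)) ∞ N
  target_eq : φ.target = box d ε₀ ε₁
  cone : ∀ x ∈ box d ε₀ ε₁, ∀ w, ‖w - timeDir d‖ < ρ → (x, w) ∈ coneIn (chartCone g' φ) φ
  narrow : ∀ y ∈ cube d ε₁, 2 * ‖y‖ < ρ * ε₀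
  center : φ.symm 0 ∉ range ι
  bottom : ∀ x ∈ box d ε₀ ε₁, x 0 < -ε₀ + η → ∃ m ∈ chronologicalFuture T S,
    m ∈ agreeSet T g' ι (chartField φ (timeDir d)) φ.source ∧ ι m = φ.symm x

variable (ι : M → N) (φ : OpenPartialHomeomorph N (Model d)) in
/-- The points of the box such that the whole vertical segment from the bottom of the box up to the
point lies in the image of `M`. -/
def subgraph (ε₀ ε₁ : ℝ) : Set (Model d) :=
  {x | x ∈ box d ε₀ ε₁ ∧
    ∀ u : ℝ, 0 ≤ u → x + (-u) • timeDir d ∈ box d ε₀ ε₁ → φ.symm (x + (-u) • timeDir d) ∈ range ι}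

namespace AdaptedBox

variable {g : LorentzianMetric d ∞ M} {T : TimeOrientation g} {g' : LorentzianMetric d 0 N}
  {ι : M → N} {S : Set M} {φ : OpenPartialHomeomorph N (Model d)} {ε₀ ε₁ ρ η : ℝ}
  {x : Model d} {c : ℝ → N} {a b : ℝ}

omit [TopologicalSpace M] [ChartedSpace (Model d) M] [IsManifold (𝓡 (d + 1)) ∞ M]
  [ChartedSpace (Model d) N] [IsManifold (𝓡 (d + 1)) ∞ N] in
theorem mem_range_of_mem_subgraph (hx : x ∈ subgraph ι φ ε₀ ε₁) : φ.symm x ∈ range ι := by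
  have := hx.2 0 le_rfl (by simpa using hx.1)
  simpa using this

omit [TopologicalSpace M] [ChartedSpace (Model d) M] [IsManifold (𝓡 (d + 1)) ∞ M]
  [ChartedSpace (Model d) N] [IsManifold (𝓡 (d + 1)) ∞ N] in
theorem sub_mem_subgraph (hx : x ∈ subgraph ι φ ε₀ ε₁) {u : ℝ} (hu : 0 ≤ u)
    (hb : x + (-u) • timeDir d ∈ box d ε₀ ε₁) : x + (-u) • timeDir d ∈ subgraph ι φ ε₀ ε₁ := by
  refine ⟨hb, fun v hv hvb ↦ ?_⟩
  have e : x + (-u) • timeDir d + (-v) • timeDir d = x + (-(u + v)) • timeDir d := by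
    rw [add_assoc, ← add_smul]; congr 2; ring
  rw [e] at hvb ⊢
  exact hx.2 _ (add_nonneg hu hv) hvb

theorem timelike_field (H : AdaptedBox T g' ι S φ ε₀ ε₁ ρ η) :
    ∀ x ∈ φ.source, g'.val x (chartField φ (timeDir d) x) (chartField φ (timeDir d) x) < 0 := by
  intro x hx
  have h1 := (H.cone (φ x) (H.target_eq ▸ φ.map_source hx) (timeDir d) (by simpa using H.posρ)).2
  rw [← mk_chartField _ hx] at h1
  exact h1.2.1

theorem isOpen_chartCone (H : AdaptedBox T g' ι S φ ε₀ ε₁ ρ η) : IsOpen (chartCone g' φ) :=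
  isOpen_futureCone φ.open_source (continuousOn_chartField H.smooth _)

theorem vertical (H : AdaptedBox T g' ι S φ ε₀ ε₁ ρ η)
    {J : Set ℝ} (h : ∀ s ∈ J, x + s • timeDir d ∈ box d ε₀ ε₁) :
    ConeCurveOn (chartCone g' φ) (fun s ↦ φ.symm (x + s • timeDir d)) J :=
  coneCurveOn_line H.smooth fun s hs ↦ H.cone _ (h s hs) _ (by simpa using H.posρ)

theorem mem_subgraph_of_bottom (H : AdaptedBox T g' ι S φ ε₀ ε₁ ρ η)
    (hx : x ∈ box d ε₀ ε₁) (hx0 : x 0 < -ε₀ + η) :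
    x ∈ subgraph ι φ ε₀ ε₁ := by
  refine ⟨hx, fun u hu hb ↦ ?_⟩
  obtain ⟨m, -, -, hm⟩ := H.bottom _ hb (by simp; linarith)
  exact ⟨m, hm⟩

/-- Only the compact part of the vertical segment outside the bottom region matters. -/
theorem isOpen_subgraph (H : AdaptedBox T g' ι S φ ε₀ ε₁ ρ η)
    (hι : IsC0Extension g g' ι) : IsOpen (subgraph ι φ ε₀ ε₁) := by
  have hopen := isOpen_range_of_isSmoothEmbedding hι.isSmoothEmbedding
  set W : Set (Model d) := (φ.target ∩ φ.symm ⁻¹' range ι) ∪ {x | x 0 < -ε₀ + η} with hW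
  have hWo : IsOpen W := (φ.isOpen_inter_preimage_symm hopen).union
    (isOpen_Iio.preimage (by fun_prop : Continuous fun x : Model d ↦ x 0))
  have hsub : subgraph ι φ ε₀ ε₁ =
      {x | x ∈ box d ε₀ ε₁ ∧ ∀ u ∈ Icc 0 (2 * ε₀), x + (-u) • timeDir d ∈ W} := by
    ext x
    refine and_congr_right fun hx ↦ ⟨fun h u hu ↦ ?_, fun h u hu hb ↦ ?_⟩
    · by_cases hb : x + (-u) • timeDir d ∈ box d ε₀ ε₁
      · exact Or.inl ⟨H.target_eq ▸ hb, h u hu.1 hb⟩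
      · refine Or.inr ?_
        rw [add_smul_timeDir_mem_box hx] at hb
        have h1 : x 0 + -u ≤ -ε₀ := by
          by_contra h2
          exact hb ⟨not_le.1 h2, by linarith [hx.1.2, hu.1]⟩
        simp only [mem_ofPred_eq, PiLp.add_apply, PiLp.smul_apply, timeDir_zero, smul_eq_mul]
        linarith [H.posη]
    · have hb' := (add_smul_timeDir_mem_box hx).1 hb
      rcases h u ⟨hu, by linarith [hb'.1, hx.1.2]⟩ with h1 | h1
      · exact h1.2
      · obtain ⟨m, -, -, hm⟩ := H.bottom _ hb h1
        exact ⟨m, hm⟩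
  rw [hsub, isOpen_iff_mem_nhds]
  rintro x ⟨hx, hxu⟩
  have hK : ∀ᶠ z in 𝓝 x, ∀ u ∈ Icc 0 (2 * ε₀), z + (-u) • timeDir d ∈ W := by
    refine isCompact_Icc.eventually_forall_of_forall_eventually fun u hu ↦ ?_
    have hc : Continuous fun p : Model d × ℝ ↦ p.1 + (-p.2) • timeDir d := by fun_prop
    exact hc.continuousAt.preimage_mem_nhds (hWo.mem_nhds (hxu u hu))
  filter_upwards [hK, isOpen_box.mem_nhds hx] with z h1 h2
  exact ⟨h2, h1⟩

/-- The region below the graph lies in the timelike future of `S`: go up vertically from the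
bottom of the box. -/
theorem exists_of_mem_subgraph (H : AdaptedBox T g' ι S φ ε₀ ε₁ ρ η)
    (hι : IsC0Extension g g' ι) (hx : x ∈ subgraph ι φ ε₀ ε₁) :
    ∃ m ∈ chronologicalFuture T S,
      m ∈ agreeSet T g' ι (chartField φ (timeDir d)) φ.source ∧ ι m = φ.symm x := by
  rcases lt_or_ge (x 0) (-ε₀ + η) with hlt | hge
  · exact H.bottom x hx.1 hlt
  have hη := H.posη
  set u := x 0 + ε₀ - η / 2 with hu
  have hu0 : 0 < u := by linarith
  set z := x + (-u) • timeDir d with hz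
  have hz0 : z 0 = -ε₀ + η / 2 := by simp [hz, hu]; ring
  have hzb : z ∈ box d ε₀ ε₁ := (add_smul_timeDir_mem_box hx.1).2
    ⟨by linarith, by linarith [hx.1.1.2]⟩
  obtain ⟨m, hmS, hmA, hm⟩ := H.bottom z hzb (by linarith)
  have : Nonempty M := ⟨m⟩
  have hzs : ∀ s, z + s • timeDir d = x + (-(u - s)) • timeDir d := by
    intro s
    rw [hz, add_assoc, ← add_smul]; congr 2; ring
  have hbox : ∀ s ∈ Icc 0 u, z + s • timeDir d ∈ box d ε₀ ε₁ := by
    intro s hs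
    rw [add_smul_timeDir_mem_box hzb, hz0]
    exact ⟨by linarith [hs.1], by linarith [hs.2, hx.1.1.2]⟩
  have hrange : ∀ s ∈ Icc 0 u, φ.symm (z + s • timeDir d) ∈ range ι := by
    intro s hs
    have := hbox s hs
    rw [hzs] at this ⊢
    exact hx.2 _ (by linarith [hs.2]) this
  set γ : ℝ → M := fun s ↦ Function.invFun ι (φ.symm (z + s • timeDir d)) with hγ
  have hιγ : ∀ s ∈ Icc 0 u, ι (γ s) = φ.symm (z + s • timeDir d) := fun s hs ↦
    Function.invFun_eq (hrange s hs)
  have hm0 : γ 0 = m := hι.isSmoothEmbedding.isEmbedding.injective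
    (by rw [hιγ 0 ⟨le_rfl, hu0.le⟩, hm]; simp)
  obtain ⟨h1, h2⟩ := coneCurveOn_of_range (T := T) hι φ.open_source
    (continuousOn_chartField H.smooth _) H.timelike_field (J := Icc 0 u) ordConnected_Icc
    ⟨0, ⟨le_rfl, hu0.le⟩, u, ⟨hu0.le, le_rfl⟩, hu0.ne⟩ (H.vertical hbox) hιγ
    ⟨0, ⟨le_rfl, hu0.le⟩, hm0 ▸ hmA⟩
  have huI : u ∈ Icc 0 u := ⟨hu0.le, le_rfl⟩
  refine ⟨γ u, ?_, h1 u huI, ?_⟩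
  · rw [mem_chronologicalFuture_iff] at hmS ⊢
    obtain ⟨y, hy, hr⟩ := hmS
    refine ⟨y, hy, hr.trans ?_⟩
    rw [← hm0]
    exact h2.reach ordConnected_Icc ⟨le_rfl, hu0.le⟩ huI hu0
  · rw [hιγ u huI, hzs]; simp

theorem eventually_exists (H : AdaptedBox T g' ι S φ ε₀ ε₁ ρ η)
    (hι : IsC0Extension g g' ι) (hx : x ∈ box d ε₀ ε₁) {m : M}
    (hm : ι m = φ.symm x) {O : Set M} (hO : O ∈ 𝓝 m) :
    ∀ᶠ z in 𝓝 x, ∃ m' ∈ O, ι m' = φ.symm z := by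
  have h1 : ι '' O ∈ 𝓝 (φ.symm x) := hm ▸
    (isOpenMap_of_isSmoothEmbedding hι.isSmoothEmbedding).image_mem_nhds hO
  exact (φ.symm.continuousAt (x := x) (by simpa [H.target_eq] using hx)) h1

/-- Disagreement of the time orientations would be an open condition. -/
theorem mem_agreeSet_of_mem_closure (H : AdaptedBox T g' ι S φ ε₀ ε₁ ρ η)
    (hι : IsC0Extension g g' ι) (hx : x ∈ box d ε₀ ε₁) {m : M}
    (hm : ι m = φ.symm x) (hcl : x ∈ closure (subgraph ι φ ε₀ ε₁)) :
    m ∈ agreeSet T g' ι (chartField φ (timeDir d)) φ.source := by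
  have hsm := hι.isSmoothEmbedding.contMDiff
  have hmU : ι m ∈ φ.source := by rw [hm]; exact φ.map_target (H.target_eq ▸ hx)
  have hc := continuousOn_val_field (T := T) (g' := g') hsm
    (continuousOn_chartField H.smooth (timeDir d))
  have hopen : IsOpen (ι ⁻¹' φ.source) := φ.open_source.preimage hsm.continuous
  refine ⟨hmU, ?_⟩
  by_contra hneg
  have hpos := lt_of_le_of_ne (not_lt.1 hneg) (g'.ne_zero_of_timelike (H.timelike_field _ hmU)
    (timelike_mfderiv_field (T := T) hι.isometric m)).symm
  have hO := (hc.continuousAt (hopen.mem_nhds hmU)).preimage_mem_nhds (Ioi_mem_nhds hpos)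
  obtain ⟨z, hzG, m', hm', hz⟩ :=
    ((mem_closure_iff_frequently.1 hcl).and_eventually (H.eventually_exists hι hx hm hO)).exists
  obtain ⟨m'', -, hA, hz'⟩ := H.exists_of_mem_subgraph hι hzG
  obtain rfl := hι.isSmoothEmbedding.isEmbedding.injective (hz.trans hz'.symm)
  exact lt_asymm hA.2 hm'

end AdaptedBox

end AdaptedBox

/-! ### The boundary as a graph -/

namespace AdaptedBox

variable {d : ℕ} {M : Type*} [TopologicalSpace M] [T2Space M] [SecondCountableTopology M]
  [ChartedSpace (Model d) M] [IsManifold (𝓡 (d + 1)) ∞ M]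
  {N : Type*} [TopologicalSpace N] [T2Space N] [ChartedSpace (Model d) N]
  [IsManifold (𝓡 (d + 1)) ∞ N]
  {g : LorentzianMetric d ∞ M} {T : TimeOrientation g} {g' : LorentzianMetric d 0 N}
  {ι : M → N} {S : Set M} {φ : OpenPartialHomeomorph N (Model d)} {ε₀ ε₁ ρ η : ℝ}
  {x : Model d} {c : ℝ → N} {a b : ℝ}

/-- The region below the graph is closed in the image of `M`. Otherwise the vertical line down from
a limit point leaves `M` through its past boundary, hence contains a point of the timelike past
of `S`. Shifting the approximating points of the region down by the same amount gives points
close to it, which lie in the timelike future of `S`. -/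
theorem mem_subgraph_of_mem_closure (H : AdaptedBox T g' ι S φ ε₀ ε₁ ρ η)
    (hι : IsC0Extension g g' ι) (hS : IsCauchyHypersurface g S) (hx : x ∈ box d ε₀ ε₁)
    (hxr : φ.symm x ∈ range ι) (hcl : x ∈ closure (subgraph ι φ ε₀ ε₁)) :
    x ∈ subgraph ι φ ε₀ ε₁ := by
  refine ⟨hx, fun u₀ hu₀ hb₀ ↦ ?_⟩
  by_contra hnr
  have hopen := isOpen_range_of_isSmoothEmbedding hι.isSmoothEmbedding
  have hbox : ∀ u ∈ Icc 0 u₀, x + (-u) • timeDir d ∈ box d ε₀ ε₁ := by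
    intro u hu
    have h1 := (add_smul_timeDir_mem_box hx).1 hb₀
    exact (add_smul_timeDir_mem_box hx).2 ⟨by linarith [h1.1, hu.2], by linarith [hx.1.2, hu.1]⟩
  have hcontl : Continuous fun u : ℝ ↦ x + (-u) • timeDir d := by fun_prop
  have hcont : ContinuousOn (fun u : ℝ ↦ φ.symm (x + (-u) • timeDir d)) (Icc 0 u₀) :=
    φ.symm.continuousOn.comp hcontl.continuousOn
      (fun u hu ↦ by simpa [H.target_eq] using hbox u hu)
  -- the first parameter at which the vertical line down from `x` leaves `M`
  have hcomp : IsCompact (Icc 0 u₀ ∩ (fun u : ℝ ↦ φ.symm (x + (-u) • timeDir d)) ⁻¹' (range ι)ᶜ) :=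
    isCompact_Icc.of_isClosed_subset
      (hcont.preimage_isClosed_of_isClosed isClosed_Icc hopen.isClosed_compl) inter_subset_left
  obtain ⟨v, ⟨hvI, hvr⟩, hvmin⟩ := hcomp.exists_isLeast ⟨u₀, ⟨hu₀, le_rfl⟩, hnr⟩
  have hv0 : 0 < v := by
    refine lt_of_le_of_ne hvI.1 (fun h ↦ hvr ?_)
    simpa [← h] using hxr
  have hrange : ∀ s ∈ Ioc (-v) 0, φ.symm (x + s • timeDir d) ∈ range ι := by
    intro s hs
    by_contra h
    have := hvmin ⟨⟨by linarith [hs.2], by linarith [hs.1, hvI.2]⟩,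
      by simpa using h⟩ (a := -s)
    linarith [hs.1]
  have hbox' : ∀ s ∈ Ioc (-v) 0, x + s • timeDir d ∈ box d ε₀ ε₁ := by
    intro s hs
    have := hbox (-s) ⟨by linarith [hs.2], by linarith [hs.1, hvI.2]⟩
    simpa using this
  have : Nonempty M := hxr.nonempty
  set γ : ℝ → M := fun s ↦ Function.invFun ι (φ.symm (x + s • timeDir d)) with hγ
  have hιγ : ∀ s ∈ Ioc (-v) 0, ι (γ s) = φ.symm (x + s • timeDir d) := fun s hs ↦
    Function.invFun_eq (hrange s hs)
  have h0I : (0 : ℝ) ∈ Ioc (-v) 0 := ⟨by linarith, le_rfl⟩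
  have hA : γ 0 ∈ agreeSet T g' ι (chartField φ (timeDir d)) φ.source :=
    H.mem_agreeSet_of_mem_closure hι hx (by simpa using hιγ 0 h0I) hcl
  obtain ⟨-, hγc⟩ := coneCurveOn_of_range (T := T) hι φ.open_source
    (continuousOn_chartField H.smooth _) H.timelike_field (J := Ioc (-v) 0) ordConnected_Ioc
    ⟨0, h0I, -v / 2, ⟨by linarith, by linarith⟩, by linarith⟩ (H.vertical hbox') hιγ ⟨0, h0I, hA⟩
  have hlim : ¬ ∃ q, Tendsto γ (𝓝[>] (-v)) (𝓝 q) := by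
    rintro ⟨q, hq⟩
    have h1 := (hι.isSmoothEmbedding.contMDiff.continuous.tendsto q).comp hq
    have hc' : Continuous fun s : ℝ ↦ x + s • timeDir d := by fun_prop
    have h2 : Tendsto (fun s : ℝ ↦ φ.symm (x + s • timeDir d)) (𝓝[>] (-v))
        (𝓝 (φ.symm (x + (-v) • timeDir d))) :=
      ((ContinuousAt.comp (f := fun s : ℝ ↦ x + s • timeDir d) (x := -v)
        (φ.symm.continuousAt (by simpa [H.target_eq] using hbox v hvI))
        hc'.continuousAt).tendsto).mono_left nhdsWithin_le_nhds
    have h3 : (ι ∘ γ) =ᶠ[𝓝[>] (-v)] fun s : ℝ ↦ φ.symm (x + s • timeDir d) := by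
      filter_upwards [Ioc_mem_nhdsGT (show -v < 0 by linarith)] with s hs
      exact hιγ s hs
    exact hvr ⟨q, tendsto_nhds_unique h1 (h2.congr' h3.symm)⟩
  obtain ⟨t, ht, y, hyS, hty⟩ := hS.exists_reach_of_past_inextendible (by linarith) hγc hlim
  have hev := H.eventually_exists hι (hbox' t ht) (hιγ t ht)
    (hty.eventually_left T.isOpen_cone)
  have hc2 : Continuous fun z : Model d ↦ z + t • timeDir d := by fun_prop
  obtain ⟨z, hzG, ⟨m', hm', hz⟩, hzb⟩ := ((mem_closure_iff_frequently.1 hcl).and_eventually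
    ((hc2.continuousAt.eventually hev).and
      (hc2.continuousAt.preimage_mem_nhds (isOpen_box.mem_nhds (hbox' t ht))))).exists
  have hzG' : z + t • timeDir d ∈ subgraph ι φ ε₀ ε₁ := by
    have hzb' : z + t • timeDir d ∈ box d ε₀ ε₁ := hzb
    have := sub_mem_subgraph hzG (u := -t) (by linarith [ht.2]) (by simpa using hzb')
    simpa using this
  obtain ⟨m'', hm'', -, hz'⟩ := H.exists_of_mem_subgraph hι hzG'
  obtain rfl := hι.isSmoothEmbedding.isEmbedding.injective (hz.trans hz'.symm)
  obtain ⟨y', hy', hr⟩ := (mem_chronologicalFuture_iff T).1 hm''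
  exact hS.not_reach hy' hyS (hr.trans hm')

/-- A past directed curve in the box that starts below the graph stays below the graph: otherwise
it would leave `M`, hence contain a point of the timelike past of `S`. -/
theorem mem_subgraph_of_coneCurveOn (H : AdaptedBox T g' ι S φ ε₀ ε₁ ρ η)
    (hι : IsC0Extension g g' ι) (hS : IsCauchyHypersurface g S) (hab : a < b)
    (hc : ConeCurveOn (chartCone g' φ) c (Icc a b)) (hb : φ (c b) ∈ subgraph ι φ ε₀ ε₁) :
    φ (c a) ∈ subgraph ι φ ε₀ ε₁ := by
  by_contra hna
  have hsrc : ∀ t ∈ Icc a b, c t ∈ φ.source := by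
    intro t ht
    rcases lt_or_ge t b with h | h
    · exact (hc.right t ht ⟨b, ⟨ht.1.trans h.le, le_rfl⟩, h⟩).mem.1
    · exact (hc.left t ht ⟨a, ⟨le_rfl, hab.le⟩, hab.trans_le h⟩).mem.1
  have hcont : ContinuousOn (fun t ↦ φ (c t)) (Icc a b) :=
    φ.continuousOn.comp hc.continuousOn hsrc
  have hcomp : IsCompact (Icc a b ∩ (fun t ↦ φ (c t)) ⁻¹' (subgraph ι φ ε₀ ε₁)ᶜ) :=
    isCompact_Icc.of_isClosed_subset
      (hcont.preimage_isClosed_of_isClosed isClosed_Icc (H.isOpen_subgraph hι).isClosed_compl)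
      inter_subset_left
  obtain ⟨v, ⟨hvI, hvn⟩, hvmax⟩ := hcomp.exists_isGreatest ⟨a, ⟨le_rfl, hab.le⟩, hna⟩
  have hvb : v < b := lt_of_le_of_ne hvI.2 (by rintro rfl; exact hvn hb)
  have hG : ∀ t ∈ Ioc v b, φ (c t) ∈ subgraph ι φ ε₀ ε₁ := by
    intro t ht
    by_contra h
    have := hvmax ⟨⟨hvI.1.trans ht.1.le, ht.2⟩, h⟩
    linarith [ht.1]
  have hsub : Ioc v b ⊆ Icc a b := fun t ht ↦ ⟨hvI.1.trans ht.1.le, ht.2⟩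
  have htend : Tendsto (fun t ↦ φ (c t)) (𝓝[>] v) (𝓝 (φ (c v))) := by
    refine (hcont v hvI).mono_left ?_
    rw [← nhdsWithin_Ioc_eq_nhdsGT hvb]
    exact nhdsWithin_mono _ hsub
  have hvr : c v ∉ range ι := by
    intro hr
    refine hvn (H.mem_subgraph_of_mem_closure hι hS (H.target_eq ▸ φ.map_source (hsrc v hvI)) ?_ ?_)
    · rwa [φ.left_inv (hsrc v hvI)]
    · refine mem_closure_of_tendsto htend ?_
      filter_upwards [Ioc_mem_nhdsGT hvb] with t ht
      exact hG t ht
  have hrange : ∀ t ∈ Ioc v b, ∃ m ∈ chronologicalFuture T S,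
      m ∈ agreeSet T g' ι (chartField φ (timeDir d)) φ.source ∧ ι m = c t := by
    intro t ht
    obtain ⟨m, h1, h2, h3⟩ := H.exists_of_mem_subgraph hι (hG t ht)
    exact ⟨m, h1, h2, by rw [h3, φ.left_inv (hsrc t (hsub ht))]⟩
  have hbI : b ∈ Ioc v b := ⟨hvb, le_rfl⟩
  have : Nonempty M := ⟨(hrange b hbI).choose⟩
  choose! γ hγS hγA hιγ using hrange
  obtain ⟨-, hγc⟩ := coneCurveOn_of_range (T := T) hι φ.open_source
    (continuousOn_chartField H.smooth _) H.timelike_field (J := Ioc v b) ordConnected_Ioc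
    ⟨b, hbI, (v + b) / 2, ⟨by linarith, by linarith⟩, by linarith⟩ (hc.mono_set hsub) hιγ
    ⟨b, hbI, hγA b hbI⟩
  have hlim : ¬ ∃ q, Tendsto γ (𝓝[>] v) (𝓝 q) := by
    rintro ⟨q, hq⟩
    have h1 := (hι.isSmoothEmbedding.contMDiff.continuous.tendsto q).comp hq
    have h2 : Tendsto c (𝓝[>] v) (𝓝 (c v)) := by
      refine (hc.continuousOn v hvI).mono_left ?_
      rw [← nhdsWithin_Ioc_eq_nhdsGT hvb]
      exact nhdsWithin_mono _ hsub
    have h3 : (ι ∘ γ) =ᶠ[𝓝[>] v] c := by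
      filter_upwards [Ioc_mem_nhdsGT hvb] with s hs
      exact hιγ s hs
    exact hvr ⟨q, tendsto_nhds_unique h1 (h2.congr' h3.symm)⟩
  obtain ⟨t, ht, y, hyS, hty⟩ := hS.exists_reach_of_past_inextendible hvb hγc hlim
  obtain ⟨y', hy', hr⟩ := (mem_chronologicalFuture_iff T).1 (hγS t ht)
  exact hS.not_reach hy' hyS (hr.trans hty)

/-- Going down along a straight line with direction close to `∂₀` does not leave the region below
the graph. -/
theorem pt_mem_subgraph_of_line (H : AdaptedBox T g' ι S φ ε₀ ε₁ ρ η)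
    (hι : IsC0Extension g g' ι) (hS : IsCauchyHypersurface g S)
    {s s' : ℝ} {y y' : EuclideanSpace ℝ (Fin d)} (hb : pt s y ∈ box d ε₀ ε₁)
    (hG : pt s' y' ∈ subgraph ι φ ε₀ ε₁) (hss : s < s') (hslope : ‖y' - y‖ < ρ * (s' - s)) :
    pt s y ∈ subgraph ι φ ε₀ ε₁ := by
  set r := s' - s with hr
  have hr0 : 0 < r := sub_pos.2 hss
  set w : Model d := pt 1 (r⁻¹ • (y' - y)) with hw
  have hwρ : ‖w - timeDir d‖ < ρ := by
    rw [hw, norm_pt_one_sub_timeDir, norm_smul, norm_inv, Real.norm_of_nonneg hr0.le,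
      inv_mul_lt_iff₀ hr0, mul_comm]
    exact hslope
  have hline : ∀ t ∈ Icc 0 r, pt s y + t • w ∈ box d ε₀ ε₁ := by
    intro t ht
    rw [hw, pt_add_smul_pt, pt_mem_box]
    refine ⟨⟨by linarith [hb.1.1, ht.1, pt_zero s y], ?_⟩, ?_⟩
    · have := hG.1.1.2
      rw [pt_zero] at this
      linarith [ht.2]
    · rw [smul_smul]
      exact convex_cube.add_smul_sub_mem hb.2 hG.1.2
        ⟨mul_nonneg ht.1 (inv_nonneg.2 hr0.le), by
          rw [← div_eq_mul_inv]; exact (div_le_one hr0).2 ht.2⟩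
  have hcurve : ConeCurveOn (chartCone g' φ) (fun t ↦ φ.symm (pt s y + t • w)) (Icc 0 r) :=
    coneCurveOn_line H.smooth fun t ht ↦ H.cone _ (hline t ht) _ hwρ
  have hend : pt s y + r • w = pt s' y' := by
    rw [hw, pt_add_smul_pt, smul_smul, mul_inv_cancel₀ hr0.ne', hr]
    congr 1
    · ring
    · simp
  have key := H.mem_subgraph_of_coneCurveOn hι hS hr0 hcurve (by
    simp only [hend]
    rw [φ.right_inv (H.target_eq ▸ hG.1)]
    exact hG)
  simp only [zero_smul, add_zero] at key
  rwa [φ.right_inv (H.target_eq ▸ hb)] at key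

variable (ι φ ε₀ ε₁) in
/-- The height at which the upward vertical line over `y` first leaves the image of `M`. It is a
supremum of a nonempty bounded set if `y` lies in the base of the box. -/
def exitHeight (y : EuclideanSpace ℝ (Fin d)) : ℝ := sSup {s | pt s y ∈ subgraph ι φ ε₀ ε₁}

omit [TopologicalSpace M] [T2Space M] [SecondCountableTopology M] [ChartedSpace (Model d) M]
  [IsManifold (𝓡 (d + 1)) ∞ M] [T2Space N] [ChartedSpace (Model d) N]
  [IsManifold (𝓡 (d + 1)) ∞ N] in
theorem pt_mem_subgraph_mono {s s' : ℝ} {y : EuclideanSpace ℝ (Fin d)}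
    (hG : pt s' y ∈ subgraph ι φ ε₀ ε₁) (hss : s ≤ s') (hs : -ε₀ < s) :
    pt s y ∈ subgraph ι φ ε₀ ε₁ := by
  have e : pt s' y + (-(s' - s)) • timeDir d = pt s y := by
    rw [pt_add_smul_timeDir]; congr 1; ring
  have h1 := hG.1.1.2
  rw [pt_zero] at h1
  have := sub_mem_subgraph hG (u := s' - s) (by linarith)
    (by rw [e]; exact pt_mem_box.2 ⟨⟨hs, by linarith⟩, hG.1.2⟩)
  rwa [e] at this

/-- The origin lies in the timelike past of all points of height `ε₀ / 2`, and it is not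
in the image of `M`. -/
theorem le_half_of_mem (H : AdaptedBox T g' ι S φ ε₀ ε₁ ρ η)
    (hι : IsC0Extension g g' ι) (hS : IsCauchyHypersurface g S)
    {s : ℝ} {y : EuclideanSpace ℝ (Fin d)} (hG : pt s y ∈ subgraph ι φ ε₀ ε₁) : s ≤ ε₀ / 2 := by
  by_contra hlt
  have h0 := H.pos₀
  have h1 := pt_mem_subgraph_mono hG (not_le.1 hlt).le (by linarith)
  have hpt0 : pt 0 0 = (0 : Model d) := model_ext rfl fun _ ↦ rfl
  have h2 := H.pt_mem_subgraph_of_line hι hS (s := 0) (y := 0)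
    (pt_mem_box.2 ⟨⟨by linarith, by linarith⟩, fun i ↦ by simp [H.pos₁]⟩) h1 (by linarith)
    (by simpa using (by linarith [H.narrow y hG.1.2] : ‖y‖ < ρ * (ε₀ / 2)))
  rw [hpt0] at h2
  exact H.center (mem_range_of_mem_subgraph h2)

theorem bddAbove_heights (H : AdaptedBox T g' ι S φ ε₀ ε₁ ρ η)
    (hι : IsC0Extension g g' ι) (hS : IsCauchyHypersurface g S) (y : EuclideanSpace ℝ (Fin d)) :
    BddAbove {s | pt s y ∈ subgraph ι φ ε₀ ε₁} :=
  ⟨ε₀ / 2, fun _ hs ↦ H.le_half_of_mem hι hS hs⟩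

omit [T2Space M] [SecondCountableTopology M] [T2Space N] in
theorem exists_height (H : AdaptedBox T g' ι S φ ε₀ ε₁ ρ η)
    {y : EuclideanSpace ℝ (Fin d)} (hy : y ∈ cube d ε₁) :
    ∃ s, -ε₀ < s ∧ pt s y ∈ subgraph ι φ ε₀ ε₁ := by
  have h0 := H.pos₀
  have hη := H.posη
  have hmin : 0 < min η ε₀ := lt_min hη h0
  have h1 := min_le_left η ε₀
  have h2 := min_le_right η ε₀
  exact ⟨-ε₀ + min η ε₀ / 2, by linarith, H.mem_subgraph_of_bottom
    (pt_mem_box.2 ⟨⟨by linarith, by linarith⟩, hy⟩) (by rw [pt_zero]; linarith)⟩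

theorem exitHeight_mem (H : AdaptedBox T g' ι S φ ε₀ ε₁ ρ η)
    (hι : IsC0Extension g g' ι) (hS : IsCauchyHypersurface g S)
    {y : EuclideanSpace ℝ (Fin d)} (hy : y ∈ cube d ε₁) :
    exitHeight ι φ ε₀ ε₁ y ∈ Ioo (-ε₀) ε₀ := by
  obtain ⟨s, hs, hsG⟩ := H.exists_height hy
  refine ⟨hs.trans_le (le_csSup (H.bddAbove_heights hι hS y) hsG), ?_⟩
  have : exitHeight ι φ ε₀ ε₁ y ≤ ε₀ / 2 :=
    csSup_le ⟨s, hsG⟩ fun t ht ↦ H.le_half_of_mem hι hS ht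
  linarith [H.pos₀]

omit [T2Space M] [SecondCountableTopology M] [T2Space N] in
theorem pt_mem_subgraph_of_lt (H : AdaptedBox T g' ι S φ ε₀ ε₁ ρ η)
    {s : ℝ} {y : EuclideanSpace ℝ (Fin d)} (hy : y ∈ cube d ε₁) (hs : -ε₀ < s)
    (hlt : s < exitHeight ι φ ε₀ ε₁ y) : pt s y ∈ subgraph ι φ ε₀ ε₁ := by
  obtain ⟨s₀, -, hs₀⟩ := H.exists_height hy
  obtain ⟨s', hs', hlt'⟩ := exists_lt_of_lt_csSup ⟨s₀, hs₀⟩ hlt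
  exact pt_mem_subgraph_mono hs' hlt'.le hs

theorem pt_exitHeight_mem_box (H : AdaptedBox T g' ι S φ ε₀ ε₁ ρ η)
    (hι : IsC0Extension g g' ι) (hS : IsCauchyHypersurface g S)
    {y : EuclideanSpace ℝ (Fin d)} (hy : y ∈ cube d ε₁) :
    pt (exitHeight ι φ ε₀ ε₁ y) y ∈ box d ε₀ ε₁ :=
  pt_mem_box.2 ⟨H.exitHeight_mem hι hS hy, hy⟩

theorem pt_exitHeight_notMem (H : AdaptedBox T g' ι S φ ε₀ ε₁ ρ η)
    (hι : IsC0Extension g g' ι) (hS : IsCauchyHypersurface g S)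
    {y : EuclideanSpace ℝ (Fin d)} :
    pt (exitHeight ι φ ε₀ ε₁ y) y ∉ subgraph ι φ ε₀ ε₁ := by
  intro h
  have hev := (continuous_pt y).continuousAt.preimage_mem_nhds
    ((H.isOpen_subgraph hι).mem_nhds h)
  obtain ⟨s, hs, hlt⟩ := ((nhdsWithin_le_nhds hev : _ ∈ 𝓝[>] _)
    |> Filter.Eventually.and (self_mem_nhdsWithin : ∀ᶠ s in 𝓝[>] (exitHeight ι φ ε₀ ε₁ y),
      s ∈ Ioi (exitHeight ι φ ε₀ ε₁ y))).exists
  exact absurd (le_csSup (H.bddAbove_heights hι hS y) hlt) (not_le.2 hs)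

theorem pt_exitHeight_mem_closure (H : AdaptedBox T g' ι S φ ε₀ ε₁ ρ η)
    (hι : IsC0Extension g g' ι) (hS : IsCauchyHypersurface g S)
    {y : EuclideanSpace ℝ (Fin d)} (hy : y ∈ cube d ε₁) :
    pt (exitHeight ι φ ε₀ ε₁ y) y ∈ closure (subgraph ι φ ε₀ ε₁) := by
  have ht : Tendsto (fun s ↦ pt s y) (𝓝[<] (exitHeight ι φ ε₀ ε₁ y))
      (𝓝 (pt (exitHeight ι φ ε₀ ε₁ y) y)) :=
    (continuous_pt y).continuousAt.tendsto.mono_left nhdsWithin_le_nhds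
  refine mem_closure_of_tendsto ht ?_
  filter_upwards [Ioo_mem_nhdsLT (H.exitHeight_mem hι hS hy).1] with s hs
  exact H.pt_mem_subgraph_of_lt hy hs.1 hs.2

theorem pt_exitHeight_notMem_range (H : AdaptedBox T g' ι S φ ε₀ ε₁ ρ η)
    (hι : IsC0Extension g g' ι) (hS : IsCauchyHypersurface g S)
    {y : EuclideanSpace ℝ (Fin d)} (hy : y ∈ cube d ε₁) :
    φ.symm (pt (exitHeight ι φ ε₀ ε₁ y) y) ∉ range ι := fun h ↦
  H.pt_exitHeight_notMem hι hS (H.mem_subgraph_of_mem_closure hι hS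
    (H.pt_exitHeight_mem_box hι hS hy) h (H.pt_exitHeight_mem_closure hι hS hy))

theorem lipschitzOnWith_exitHeight (H : AdaptedBox T g' ι S φ ε₀ ε₁ ρ η)
    (hι : IsC0Extension g g' ι) (hS : IsCauchyHypersurface g S) :
    LipschitzOnWith (Real.toNNReal ρ⁻¹) (exitHeight ι φ ε₀ ε₁) (cube d ε₁) := by
  refine LipschitzOnWith.of_le_add_mul _ fun y hy z hz ↦ ?_
  rw [Real.coe_toNNReal _ (inv_nonneg.2 H.posρ.le), dist_eq_norm]
  obtain ⟨s₀, -, hs₀⟩ := H.exists_height hy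
  refine csSup_le ⟨s₀, hs₀⟩ fun s hs ↦ ?_
  by_contra hlt
  have hlt' := not_le.1 hlt
  have hnn : 0 ≤ ρ⁻¹ * ‖y - z‖ := mul_nonneg (inv_nonneg.2 H.posρ.le) (norm_nonneg _)
  refine H.pt_exitHeight_notMem hι hS (H.pt_mem_subgraph_of_line hι hS
    (H.pt_exitHeight_mem_box hι hS hz) hs (by linarith) ?_)
  rw [← inv_mul_lt_iff₀ H.posρ]
  linarith

/-- The vertical line below a point of the graph is a timelike curve as required in the definition
of the future boundary. -/
theorem pt_exitHeight_mem_futureBoundary (H : AdaptedBox T g' ι S φ ε₀ ε₁ ρ η)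
    (hι : IsC0Extension g g' ι) (hS : IsCauchyHypersurface g S)
    {y : EuclideanSpace ℝ (Fin d)} (hy : y ∈ cube d ε₁) :
    φ.symm (pt (exitHeight ι φ ε₀ ε₁ y) y) ∈ futureBoundary T g' ι := by
  set z := pt (exitHeight ι φ ε₀ ε₁ y) y with hz
  have hzb : z ∈ box d ε₀ ε₁ := H.pt_exitHeight_mem_box hι hS hy
  have hzt : z ∈ φ.target := H.target_eq ▸ hzb
  have hopen := isOpen_range_of_isSmoothEmbedding hι.isSmoothEmbedding
  refine ⟨⟨?_, ?_⟩, ?_⟩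
  · have h1 := (φ.symm.continuousAt hzt).continuousWithinAt (s := subgraph ι φ ε₀ ε₁)
      |>.mem_closure_image (H.pt_exitHeight_mem_closure hι hS hy)
    refine closure_mono ?_ h1
    rintro _ ⟨x, hx, rfl⟩
    exact mem_range_of_mem_subgraph hx
  · rw [hopen.interior_eq]
    exact H.pt_exitHeight_notMem_range hι hS hy
  -- the vertical line, parametrized so that it starts half way down to the bottom of the box
  set r := (exitHeight ι φ ε₀ ε₁ y + ε₀) / 2 with hr
  have hf := H.exitHeight_mem hι hS hy
  have hr0 : 0 < r := by have := hf.1; rw [hr]; linarith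
  have hzs : ∀ s, z + s • timeDir d = pt (exitHeight ι φ ε₀ ε₁ y + s) y := fun s ↦
    pt_add_smul_timeDir _ _ _
  have hbox : ∀ s ∈ Icc (-r) 0, z + s • timeDir d ∈ box d ε₀ ε₁ := by
    intro s hs
    rw [hzs]
    refine pt_mem_box.2 ⟨⟨?_, ?_⟩, hy⟩
    · have := hs.1; have := hf.1; rw [hr] at *; linarith
    · linarith [hs.2, hf.2]
  have hG : ∀ s ∈ Ico (-r) 0, z + s • timeDir d ∈ subgraph ι φ ε₀ ε₁ := by
    intro s hs
    have := (hbox s ⟨hs.1, hs.2.le⟩).1.1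
    rw [hzs] at this ⊢
    exact H.pt_mem_subgraph_of_lt hy this (by linarith [hs.2])
  have hline := ((H.vertical hbox).mono (fun X hX ↦ isConic_futureCone X hX r hr0)).comp_affine
    (𝒞 := chartCone g' φ) (b := 0) hr0.ne'
  have hline' : ConeCurveOn (chartCone g' φ)
      (fun s : ℝ ↦ φ.symm (z + (r * s + 0) • timeDir d)) (Icc (-1) 0) := by
    refine hline.mono_set fun s hs ↦ ⟨?_, ?_⟩
    · nlinarith [hs.1]
    · nlinarith [hs.2]
  have hmaps : ∀ s ∈ Ico (-1 : ℝ) 0, r * s + 0 ∈ Ico (-r) 0 := fun s hs ↦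
    ⟨by nlinarith [hs.1], by nlinarith [hs.2]⟩
  have hrange : ∀ s ∈ Ico (-1 : ℝ) 0, ∃ m,
      m ∈ agreeSet T g' ι (chartField φ (timeDir d)) φ.source ∧
        ι m = φ.symm (z + (r * s + 0) • timeDir d) := by
    intro s hs
    obtain ⟨m, -, h2, h3⟩ := H.exists_of_mem_subgraph hι (hG _ (hmaps s hs))
    exact ⟨m, h2, h3⟩
  obtain ⟨m₀, -⟩ := hrange (-1) (by simp)
  have : Nonempty M := ⟨m₀⟩
  choose! γ hγA hιγ using hrange
  refine ⟨_, hline'.isTimelikeOn ordConnected_Icc ⟨-1, by simp, 0, by simp, by simp⟩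
    H.timelike_field, by simp, γ, hιγ, ?_⟩
  have hnt : (Ico (-1 : ℝ) 0).Nontrivial :=
    ⟨-1, by simp, -1 / 2, by constructor <;> norm_num, by norm_num⟩
  obtain ⟨-, h2⟩ := coneCurveOn_of_range (T := T) hι φ.open_source
    (continuousOn_chartField H.smooth _) H.timelike_field ordConnected_Ico hnt
    (hline'.mono_set Ico_subset_Icc_self) hιγ ⟨-1, by simp, hγA (-1) (by simp)⟩
  exact isFutureDirectedOn_iff.2 ⟨ordConnected_Ico, hnt, h2⟩

/-- A future directed curve between two points of the graph could be deformed so as to end in the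
open region below the graph, and then its starting point would lie in this region as well. -/
theorem not_reach_graph (H : AdaptedBox T g' ι S φ ε₀ ε₁ ρ η)
    (hι : IsC0Extension g g' ι) (hS : IsCauchyHypersurface g S)
    {y z : EuclideanSpace ℝ (Fin d)} (hy : y ∈ cube d ε₁) (hz : z ∈ cube d ε₁) :
    ¬ Reach (chartCone g' φ) (φ.symm (pt (exitHeight ι φ ε₀ ε₁ y) y))
      (φ.symm (pt (exitHeight ι φ ε₀ ε₁ z) z)) := by
  intro h
  have hyt : pt (exitHeight ι φ ε₀ ε₁ y) y ∈ φ.target :=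
    H.target_eq ▸ H.pt_exitHeight_mem_box hι hS hy
  have hzt : pt (exitHeight ι φ ε₀ ε₁ z) z ∈ φ.target :=
    H.target_eq ▸ H.pt_exitHeight_mem_box hι hS hz
  -- the end point of the curve can be moved into the region below the graph
  have hev := (φ.symm.continuousAt hzt).eventually (h.eventually_right H.isOpen_chartCone)
  obtain ⟨x, hxG, c, a, b, hab, hc, hca, hcb⟩ := ((mem_closure_iff_frequently.1
    (H.pt_exitHeight_mem_closure hι hS hz)).and_eventually hev).exists
  have := H.mem_subgraph_of_coneCurveOn hι hS hab hc
    (by rwa [hcb, φ.right_inv (H.target_eq ▸ hxG.1)])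
  rw [hca, φ.right_inv hyt] at this
  exact H.pt_exitHeight_notMem hι hS this

theorem isAchronalIn_graph (H : AdaptedBox T g' ι S φ ε₀ ε₁ ρ η)
    (hι : IsC0Extension g g' ι) (hS : IsCauchyHypersurface g S) :
    IsAchronalIn g' φ.source (φ.symm '' graphIn ε₀ ε₁ (exitHeight ι φ ε₀ ε₁)) := by
  rintro c hc hsrc ⟨x, ⟨hxb, hx⟩, hx0⟩ ⟨z, ⟨hzb, hz⟩, hz0⟩
  rw [← pt_spatial x, hx] at hx0
  rw [← pt_spatial z, hz] at hz0
  have h01 : (0 : ℝ) ∈ Icc (0 : ℝ) 1 := by simp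
  have h11 : (1 : ℝ) ∈ Icc (0 : ℝ) 1 := by simp
  rcases hc.coneCurveOn_or φ.open_source (continuousOn_chartField H.smooth (timeDir d))
    H.timelike_field hsrc with h | h
  · have hr := h.reach ordConnected_Icc h01 h11 one_pos
    rw [← hx0, ← hz0] at hr
    exact H.not_reach_graph hι hS hxb.2 hzb.2 hr
  · have hr := (h.reach ordConnected_Icc h01 h11 one_pos).reverse
    rw [oppositeCone_oppositeCone, ← hx0, ← hz0] at hr
    exact H.not_reach_graph hι hS hzb.2 hxb.2 hr

theorem isBoundaryChart (H : AdaptedBox T g' ι S φ ε₀ ε₁ ρ η)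
    (hι : IsC0Extension g g' ι) (hS : IsCauchyHypersurface g S) {p : N} (hp : p ∈ φ.source)
    (hp0 : φ p = 0) {δ : ℝ}
    (hclose : ∀ x ∈ box d ε₀ ε₁, ∀ μ ν, |metricComponent g' φ x μ ν - minkowski d μ ν| < δ) :
    IsBoundaryChart T g' ι p δ ε₀ ε₁ φ (exitHeight ι φ ε₀ ε₁) ∧
      belowGraph ε₀ ε₁ (exitHeight ι φ ε₀ ε₁) ⊆
        φ '' (ι '' chronologicalFuture T S ∩ φ.source) := by
  have hbelow : ∀ x ∈ belowGraph ε₀ ε₁ (exitHeight ι φ ε₀ ε₁), x ∈ subgraph ι φ ε₀ ε₁ := by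
    rintro x ⟨hxb, hx⟩
    have := H.pt_mem_subgraph_of_lt hxb.2 hxb.1.1 hx
    rwa [pt_spatial] at this
  refine ⟨⟨H.pos₀, H.pos₁, H.smooth, H.target_eq, hp, hp0, hclose,
    fun y hy ↦ H.exitHeight_mem hι hS hy, ⟨_, H.lipschitzOnWith_exitHeight hι hS⟩, ?_, ?_,
    H.isAchronalIn_graph hι hS⟩, ?_⟩
  · intro x hx
    have hxt : x ∈ φ.target := H.target_eq ▸ hx.1
    exact ⟨φ.symm x, ⟨mem_range_of_mem_subgraph (hbelow x hx), φ.map_target hxt⟩, φ.right_inv hxt⟩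
  · rintro x ⟨hxb, hx⟩
    have hxt : x ∈ φ.target := H.target_eq ▸ hxb
    refine ⟨φ.symm x, ⟨?_, φ.map_target hxt⟩, φ.right_inv hxt⟩
    have := H.pt_exitHeight_mem_futureBoundary hι hS hxb.2
    rwa [← hx, pt_spatial] at this
  · intro x hx
    have hxt : x ∈ φ.target := H.target_eq ▸ hx.1
    obtain ⟨m, hm, -, hmx⟩ := H.exists_of_mem_subgraph hι (hbelow x hx)
    exact ⟨φ.symm x, ⟨⟨m, hm, hmx⟩, φ.map_target hxt⟩, φ.right_inv hxt⟩

end AdaptedBox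

/-! ### Orthonormal frames and affine charts -/

section Frames

/-- Two unit timelike vectors are related by a linear isometry: if `s e` is the one of `e`, `-e`
in the same half cone as `u`, the reflection along `u - s e` exchanges `s e` and `u`. -/
theorem exists_isometry_apply_eq {V : Type*} [AddCommGroup V] [Module ℝ V]
    (B : V →ₗ[ℝ] V →ₗ[ℝ] ℝ) (hB : ∀ v w, B v w = B w v) {e u : V} (he : B e e = -1)
    (hu : B u u = -1) (hue : B u e ≠ 0) :
    ∃ R : V ≃ₗ[ℝ] V, (∀ v w, B (R v) (R w) = B v w) ∧ R e = u := by
  obtain ⟨s, hs, hpos⟩ : ∃ s : ℝ, s * s = 1 ∧ 0 < s * B u e := by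
    rcases lt_or_gt_of_ne hue with h | h
    · exact ⟨-1, by norm_num, by linarith⟩
    · exact ⟨1, by norm_num, by linarith⟩
  have hs0 : s ≠ 0 := by
    rintro rfl
    norm_num at hs
  set n := u - s • e with hn
  have hnn : B n n = -2 - 2 * (s * B u e) := by
    simp only [hn, map_sub, LinearMap.sub_apply, map_smul, LinearMap.smul_apply, smul_eq_mul, he,
      hu, hB e u]
    linear_combination (-1 : ℝ) * hs
  have hnn0 : B n n ≠ 0 := by linarith
  have hne : B n e = B u e + s := by
    simp only [hn, map_sub, LinearMap.sub_apply, map_smul, LinearMap.smul_apply, smul_eq_mul, he]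
    ring
  have hf : ((2 / B n n) • B n) n = 2 := by
    simp only [LinearMap.smul_apply, smul_eq_mul]
    field_simp
  refine ⟨(Module.reflection hf).trans (LinearEquiv.smulOfNeZero ℝ V s hs0), fun v w ↦ ?_, ?_⟩
  · simp only [LinearEquiv.trans_apply, Module.reflection_apply, LinearEquiv.smulOfNeZero_apply,
      map_sub, LinearMap.sub_apply, map_smul, LinearMap.smul_apply, smul_eq_mul, hB v n]
    field_simp
    linear_combination (B v w * B n n) * hs
  · simp only [LinearEquiv.trans_apply, Module.reflection_apply, LinearEquiv.smulOfNeZero_apply,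
      LinearMap.smul_apply, smul_eq_mul, hne]
    have h1 : s * (2 / B n n * (B u e + s)) = -1 := by
      rw [show s * (2 / B n n * (B u e + s)) = 2 * (s * B u e + s * s) / B n n by ring,
        div_eq_iff hnn0, hnn]
      linear_combination (2 : ℝ) * hs
    rw [smul_sub, smul_smul, h1, hn]
    module

variable {d : ℕ} {N : Type*} [TopologicalSpace N] [ChartedSpace (Model d) N]
  [IsManifold (𝓡 (d + 1)) ∞ N] (g' : LorentzianMetric d 0 N)
  {ψ : OpenPartialHomeomorph N (Model d)} {z w : Model d}

/-- The metric in the coordinates of the chart `ψ`, at the point with coordinates `z`. -/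
def chartForm (ψ : OpenPartialHomeomorph N (Model d)) (z w w' : Model d) : ℝ :=
  g'.val (ψ.symm z) (chartVec ψ z w).2 (chartVec ψ z w').2

theorem metricComponent_eq_chartForm (z : Model d) (μ ν : Fin (d + 1)) :
    metricComponent g' ψ z μ ν =
      chartForm g' ψ z (EuclideanSpace.single μ (1 : ℝ)) (EuclideanSpace.single ν (1 : ℝ)) := rfl

variable {g'}

theorem continuousOn_chartForm (hψ : ψ ∈ IsManifold.maximalAtlas (𝓡 (d + 1)) ∞ N) :
    ContinuousOn (fun q : Model d × Model d × Model d ↦ chartForm g' ψ q.1 q.2.1 q.2.2)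
      (ψ.target ×ˢ univ) := by
  have h1 : ContinuousOn (fun q : Model d × Model d × Model d ↦ chartVec ψ q.1 q.2.1)
      (ψ.target ×ˢ univ) :=
    (continuousOn_chartVec hψ).comp (f := fun q : Model d × Model d × Model d ↦ (q.1, q.2.1))
      (by fun_prop) (fun q hq ↦ ⟨hq.1, mem_univ _⟩)
  have h2 : ContinuousOn (fun q : Model d × Model d × Model d ↦ chartVec ψ q.1 q.2.2)
      (ψ.target ×ˢ univ) :=
    (continuousOn_chartVec hψ).comp (f := fun q : Model d × Model d × Model d ↦ (q.1, q.2.2))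
      (by fun_prop) (fun q hq ↦ ⟨hq.1, mem_univ _⟩)
  exact g'.continuousOn_val (b := fun q : Model d × Model d × Model d ↦ ψ.symm q.1) h1 h2

theorem mem_coneIn_futureCone {w₀ : Model d} :
    (z, w) ∈ coneIn (futureCone g' (chartField ψ w₀) ψ.source) ψ ↔
      z ∈ ψ.target ∧ chartForm g' ψ z w w < 0 ∧ chartForm g' ψ z w₀ w < 0 := by
  refine and_congr_right fun hz ↦ ?_
  have h1 := mk_chartField (d := d) (φ := ψ) w₀ (ψ.map_target hz)
  have h2 : (chartField ψ w₀ (ψ.symm z) : Model d) = (chartVec ψ z w₀).2 := by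
    simp only [chartField]
    rw [ψ.right_inv hz]
  have h3 : chartField ψ w₀ (chartVec ψ z w).1 = (chartVec ψ z w₀).2 := h2
  simp only [futureCone, mem_ofPred_eq, h3]
  exact and_iff_right (ψ.map_target hz)

theorem chartForm_smul_left (a : ℝ) (w' : Model d) :
    chartForm g' ψ z (a • w) w' = a * chartForm g' ψ z w w' := by
  have h : (chartVec ψ z (a • w)).2 = a • (chartVec ψ z w).2 :=
    map_smul (mfderiv (𝓡 (d + 1)) (𝓡 (d + 1)) ψ.symm z) a w
  simp only [chartForm]
  rw [h]
  exact DFunLike.congr_fun (map_smul (g'.val (ψ.symm z)) a (chartVec ψ z w).2) _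

/-- A timelike direction, suitably rescaled, is the first vector of a Lorentz orthonormal frame. -/
theorem exists_frame (hψ : ψ ∈ IsManifold.maximalAtlas (𝓡 (d + 1)) ∞ N) (hz : z ∈ ψ.target)
    (hw : chartForm g' ψ z w w < 0) :
    ∃ a : ℝ, 0 < a ∧ ∃ L : Model d ≃L[ℝ] Model d, (∀ μ ν, chartForm g' ψ z
      (L (EuclideanSpace.single μ (1 : ℝ))) (L (EuclideanSpace.single ν (1 : ℝ))) =
        minkowski d μ ν) ∧ L (timeDir d) = a⁻¹ • w := by
  let D : Model d →L[ℝ] Model d := mfderiv (𝓡 (d + 1)) (𝓡 (d + 1)) ψ.symm z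
  have hsurj : Function.Surjective (D : Model d →ₗ[ℝ] Model d) := by
    intro v
    have h1 : ∀ X : TangentBundle (𝓡 (d + 1)) N, X.1 ∈ ψ.source →
        ∃ w' : Model d, chartVec ψ (ψ X.1) w' = X :=
      fun X hX ↦ ⟨_, chartVec_tangentMap hψ hX⟩
    obtain ⟨w', hw'⟩ := h1 ⟨ψ.symm z, v⟩ (ψ.map_target hz)
    simp only [ψ.right_inv hz] at hw'
    exact ⟨w', (Bundle.TotalSpace.mk_inj (b := ψ.symm z)).1 hw'⟩
  let e : Model d ≃ₗ[ℝ] Model d := LinearEquiv.ofBijective (D : Model d →ₗ[ℝ] Model d)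
    ⟨LinearMap.injective_iff_surjective.2 hsurj, hsurj⟩
  obtain ⟨b, hb⟩ := g'.signature (ψ.symm z)
  let G : Model d →L[ℝ] Model d →L[ℝ] ℝ := g'.val (ψ.symm z)
  let B : Model d →ₗ[ℝ] Model d →ₗ[ℝ] ℝ :=
    LinearMap.mk₂ ℝ (fun v w ↦ G v w) (by simp) (by simp) (by simp) (by simp)
  have hBG : ∀ v w', B (e v) (e w') = chartForm g' ψ z v w' := fun v w' ↦ rfl
  let b' : Module.Basis (Fin (d + 1)) ℝ (Model d) := b
  have hb' : ∀ μ ν, B (b' μ) (b' ν) = minkowski d μ ν := hb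
  have hneg : B (e w) (e w) < 0 := hw
  set a := √(-B (e w) (e w)) with ha
  have ha0 : 0 < a := Real.sqrt_pos.2 (by linarith)
  have haa : a * a = -B (e w) (e w) := Real.mul_self_sqrt (by linarith)
  have hu : B (a⁻¹ • e w) (a⁻¹ • e w) = -1 := by
    simp only [map_smul, LinearMap.smul_apply, smul_eq_mul]
    field_simp
    linarith
  have hb0 : B (b' 0) (b' 0) = -1 := by simp [hb', minkowski]
  have hne : B (a⁻¹ • e w) (b' 0) ≠ 0 :=
    g'.ne_zero_of_timelike (x := ψ.symm z) (hu.trans_lt (by norm_num))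
      (hb0.trans_lt (by norm_num))
  obtain ⟨R, hR, hR0⟩ := exists_isometry_apply_eq B (fun v w' ↦ g'.symm _ v w') hb0 hu hne
  let c : Module.Basis (Fin (d + 1)) ℝ (Model d) := b'.map (R.trans e.symm)
  let L := (EuclideanSpace.basisFun (Fin (d + 1)) ℝ).toBasis.equiv c (Equiv.refl _)
  have hL : ∀ μ, L (EuclideanSpace.single μ (1 : ℝ)) = e.symm (R (b' μ)) := by
    intro μ
    have h1 := (EuclideanSpace.basisFun (Fin (d + 1)) ℝ).toBasis.equiv_apply μ c (Equiv.refl _)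
    simpa [c] using h1
  refine ⟨a, ha0, L.toContinuousLinearEquiv, fun μ ν ↦ ?_, ?_⟩
  · simp only [LinearEquiv.coe_toContinuousLinearEquiv', hL]
    rw [← hBG]
    simp [hR, hb']
  · simp only [LinearEquiv.coe_toContinuousLinearEquiv', timeDir, hL, hR0]
    simp

end Frames

section AffineCharts

variable {d : ℕ} {N : Type*} [TopologicalSpace N] [ChartedSpace (Model d) N]
  [IsManifold (𝓡 (d + 1)) ∞ N] {ψ : OpenPartialHomeomorph N (Model d)}

/-- Affine changes of coordinates, restricted to an open set `D` of new coordinates. -/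
theorem exists_affine_chart (hψ : ψ ∈ IsManifold.maximalAtlas (𝓡 (d + 1)) ∞ N) (z₀ : Model d)
    (A : Model d ≃L[ℝ] Model d) {D : Set (Model d)} (hD : IsOpen D)
    (hDψ : ∀ x ∈ D, z₀ + A x ∈ ψ.target) :
    ∃ φ ∈ IsManifold.maximalAtlas (𝓡 (d + 1)) ∞ N, φ.target = D ∧
      (∀ x, φ.symm x = ψ.symm (z₀ + A x)) ∧
      ∀ x ∈ D, ∀ w, chartVec φ x w = chartVec ψ (z₀ + A x) (A w) := by
  let e : Model d ≃ₜ Model d := A.toHomeomorph.trans (Homeomorph.addLeft z₀)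
  have he : ∀ x, e x = z₀ + A x := fun x ↦ rfl
  have hes : ∀ x, e.symm x = A.symm (-z₀ + x) := fun x ↦ rfl
  let φ : OpenPartialHomeomorph N (Model d) :=
    ((e.toOpenPartialHomeomorph.trans ψ.symm).restrOpen D hD).symm
  have htarget : φ.target = D := by
    ext x
    simp only [φ, OpenPartialHomeomorph.symm_target, OpenPartialHomeomorph.restrOpen_source,
      OpenPartialHomeomorph.trans_source, mem_inter_iff]
    constructor
    · exact fun h ↦ h.2
    · exact fun h ↦ ⟨⟨mem_univ _, hDψ x h⟩, h⟩
  have hsymm : ∀ x, φ.symm x = ψ.symm (z₀ + A x) := fun x ↦ rfl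
  have happ : ∀ y, φ y = A.symm (-z₀ + ψ y) := fun y ↦ rfl
  have hsrc : φ.source ⊆ ψ.source := by
    intro y hy
    rw [← φ.left_inv hy, hsymm]
    exact ψ.map_target (hDψ _ (htarget ▸ φ.map_source hy))
  have hsm : ContDiff ℝ ∞ (fun x ↦ z₀ + A x) := by fun_prop
  have hsm' : ContDiff ℝ ∞ (fun x ↦ A.symm (-z₀ + x)) := by fun_prop
  refine ⟨φ, OpenPartialHomeomorph.mem_maximalAtlas_of_contMDiffOn φ ?_ ?_, htarget, hsymm, ?_⟩
  · exact hsm'.contMDiff.comp_contMDiffOn ((contMDiffOn_of_mem_maximalAtlas hψ).mono hsrc)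
  · refine (contMDiffOn_symm_of_mem_maximalAtlas hψ).comp hsm.contMDiff.contMDiffOn fun x hx ↦ ?_
    exact hDψ x (htarget ▸ hx)
  · intro x hx w
    have h1 : MDifferentiableAt (𝓡 (d + 1)) (𝓡 (d + 1)) ψ.symm (z₀ + A x) :=
      (contMDiffAt_symm_of_mem_maximalAtlas hψ (hDψ x hx)).mdifferentiableAt (by simp)
    have h2 : MDifferentiableAt (𝓡 (d + 1)) (𝓡 (d + 1)) (fun x ↦ z₀ + A x) x :=
      (hsm.contMDiff x).mdifferentiableAt (by simp)
    have h3 := tangentMap_comp_at (I := 𝓡 (d + 1)) (I' := 𝓡 (d + 1)) (I'' := 𝓡 (d + 1))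
      (f := fun x ↦ z₀ + A x) (g := ψ.symm) ⟨x, w⟩ h1 h2
    have h4 : mfderiv (𝓡 (d + 1)) (𝓡 (d + 1)) (fun x ↦ z₀ + A x) x w = A w := by
      have h5 : HasFDerivAt (fun x ↦ z₀ + A x) (A : Model d →L[ℝ] Model d) x :=
        (A : Model d →L[ℝ] Model d).hasFDerivAt.const_add z₀
      rw [mfderiv_eq_fderiv, h5.fderiv]
      rfl
    refine h3.trans ?_
    simp only [tangentMap, chartVec]
    rw [h4]
    rfl

end AffineCharts

/-! ### Construction of the adapted box -/

section Linear

variable {d : ℕ}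

theorem exists_cube_subset_ball (d : ℕ) {κ : ℝ} (hκ : 0 < κ) :
    ∃ ε : ℝ, 0 < ε ∧ ∀ y ∈ cube d ε, ‖y‖ < κ := by
  have hd : (0 : ℝ) < d + 1 := by positivity
  refine ⟨κ / (d + 1), by positivity, fun y hy ↦ ?_⟩
  have h1 : ‖y‖ ≤ ∑ i : Fin d, ‖y i‖ := by
    have h2 := norm_sum_le Finset.univ fun i ↦ y i • EuclideanSpace.single i (1 : ℝ)
    have h3 := (EuclideanSpace.basisFun (Fin d) ℝ).sum_repr y
    simp only [EuclideanSpace.basisFun_repr, EuclideanSpace.basisFun_apply] at h3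
    rw [h3] at h2
    simpa [norm_smul] using h2
  have h4 : ∑ i : Fin d, ‖y i‖ ≤ ∑ _i : Fin d, κ / (d + 1) :=
    Finset.sum_le_sum fun i _ ↦ (abs_lt.2 (hy i)).le
  have h5 : ∑ _i : Fin d, κ / ((d : ℝ) + 1) < κ := by
    rw [Finset.sum_const, Finset.card_univ, Fintype.card_fin, nsmul_eq_mul, ← mul_div_assoc,
      div_lt_iff₀ hd]
    nlinarith
  linarith

theorem norm_pt_le (s : ℝ) (y : EuclideanSpace ℝ (Fin d)) : ‖pt s y‖ ≤ |s| + ‖y‖ := by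
  have h1 : pt s y = s • timeDir d + (pt 1 y - timeDir d) :=
    model_ext (by simp) fun i ↦ by simp
  rw [h1, ← norm_pt_one_sub_timeDir y]
  refine (norm_add_le _ _).trans (add_le_add_left ?_ _)
  simp [norm_smul, timeDir]

/-- An invertible linear map can be changed slightly so as to map `∂₀` to a prescribed vector. -/
theorem eventually_exists_equiv (L : Model d ≃L[ℝ] Model d) {r : ℝ} (hr : 0 < r) :
    ∀ᶠ c in 𝓝 (L (timeDir d)), ∃ A : Model d ≃L[ℝ] Model d, A (timeDir d) = c ∧
      ‖(A : Model d →L[ℝ] Model d) - L‖ < r := by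
  let F : Model d → (Model d →L[ℝ] Model d) := fun c ↦
    (L : Model d →L[ℝ] Model d) +
      (EuclideanSpace.proj (0 : Fin (d + 1)) : Model d →L[ℝ] ℝ).smulRight (c - L (timeDir d))
  have hF : Continuous F := by
    have h1 : Continuous fun c : Model d ↦
        (EuclideanSpace.proj (0 : Fin (d + 1)) : Model d →L[ℝ] ℝ).smulRight (c - L (timeDir d)) :=
      ((ContinuousLinearMap.smulRightL ℝ (Model d) (Model d)
        (EuclideanSpace.proj (0 : Fin (d + 1)))).continuous).comp (continuous_sub_right _)
    exact continuous_const.add h1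
  have hF0 : F (L (timeDir d)) = L := by simp [F]
  have hFc : ∀ c, F c (timeDir d) = c := fun c ↦ by simp [F]
  have h1 := hF.continuousAt.preimage_mem_nhds (x := L (timeDir d)) (t := Metric.ball (L : Model d →L[ℝ] Model d) r)
    (by rw [hF0]; exact Metric.ball_mem_nhds _ hr)
  have h2 := hF.continuousAt.preimage_mem_nhds (x := L (timeDir d))
    (by rw [hF0]; exact ContinuousLinearEquiv.nhds L)
  filter_upwards [h1, h2] with c hc1 hc2
  obtain ⟨A, hA⟩ := hc2
  refine ⟨A, ?_, ?_⟩
  · rw [← hFc c, ← hA]; rfl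
  · rw [← dist_eq_norm, hA]; exact hc1

variable {N : Type*} [TopologicalSpace N] [ChartedSpace (Model d) N]
  [IsManifold (𝓡 (d + 1)) ∞ N] {g' : LorentzianMetric d 0 N}
  {ψ : OpenPartialHomeomorph N (Model d)} {z₀ : Model d}

/-- Near the origin of a Lorentz orthonormal frame `L`, and for frames `A` close to `L`, the metric
components are close to the Minkowski ones, and directions close to `∂₀` are timelike and lie in the
same half cone as `∂₀`. -/
theorem exists_radius (hψ : ψ ∈ IsManifold.maximalAtlas (𝓡 (d + 1)) ∞ N) (hz₀ : z₀ ∈ ψ.target)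
    (L : Model d ≃L[ℝ] Model d)
    (hL : ∀ μ ν, chartForm g' ψ z₀ (L (EuclideanSpace.single μ (1 : ℝ)))
      (L (EuclideanSpace.single ν (1 : ℝ))) = minkowski d μ ν) {δ : ℝ} (hδ : 0 < δ) :
    ∃ r > 0, ∀ (z : Model d) (A : Model d →L[ℝ] Model d), ‖z - z₀‖ < r →
      ‖A - L‖ < r → z ∈ ψ.target ∧
      (∀ μ ν, |chartForm g' ψ z (A (EuclideanSpace.single μ (1 : ℝ)))
        (A (EuclideanSpace.single ν (1 : ℝ))) - minkowski d μ ν| < δ) ∧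
      ∀ w, ‖w - timeDir d‖ < r → chartForm g' ψ z (A w) (A w) < 0 ∧
        chartForm g' ψ z (A (timeDir d)) (A w) < 0 ∧
        chartForm g' ψ z (L (timeDir d)) (A w) < 0 := by
  have hcf := (continuousOn_chartForm (g' := g') hψ)
  have key : ∀ u v : Model d × (Model d →L[ℝ] Model d) × Model d → Model d, Continuous u →
      Continuous v → ContinuousAt (fun q ↦ chartForm g' ψ q.1 (u q) (v q))
        (z₀, (L : Model d →L[ℝ] Model d), timeDir d) := by
    intro u v hu hv
    exact ContinuousAt.comp
      (f := fun q : Model d × (Model d →L[ℝ] Model d) × Model d ↦ (q.1, u q, v q))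
      (hcf.continuousAt ((ψ.open_target.prod isOpen_univ).mem_nhds ⟨hz₀, mem_univ _⟩))
      (by fun_prop)
  have h00 : chartForm g' ψ z₀ (L (timeDir d)) (L (timeDir d)) = -1 := by
    rw [timeDir, hL]; simp [minkowski]
  have e1 : ∀ᶠ q : Model d × (Model d →L[ℝ] Model d) × Model d in
      𝓝 (z₀, (L : Model d →L[ℝ] Model d), timeDir d), q.1 ∈ ψ.target :=
    continuousAt_fst.preimage_mem_nhds (ψ.open_target.mem_nhds hz₀)
  have e2 : ∀ᶠ q : Model d × (Model d →L[ℝ] Model d) × Model d in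
      𝓝 (z₀, (L : Model d →L[ℝ] Model d), timeDir d), ∀ μ ν,
        |chartForm g' ψ q.1 (q.2.1 (EuclideanSpace.single μ (1 : ℝ)))
          (q.2.1 (EuclideanSpace.single ν (1 : ℝ))) - minkowski d μ ν| < δ := by
    refine eventually_all.2 fun μ ↦ eventually_all.2 fun ν ↦ ?_
    have h1 := key (fun q ↦ q.2.1 (EuclideanSpace.single μ (1 : ℝ)))
      (fun q ↦ q.2.1 (EuclideanSpace.single ν (1 : ℝ))) (by fun_prop) (by fun_prop)
    refine ((h1.sub continuousAt_const).abs).eventually_lt continuousAt_const ?_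
    simpa [hL] using hδ
  have e3 := (key (fun q ↦ q.2.1 q.2.2) (fun q ↦ q.2.1 q.2.2) (by fun_prop)
    (by fun_prop)).eventually_lt continuousAt_const (by simp [h00] : _ < (0 : ℝ))
  have e4 := (key (fun q ↦ q.2.1 (timeDir d)) (fun q ↦ q.2.1 q.2.2) (by fun_prop)
    (by fun_prop)).eventually_lt continuousAt_const (by simp [h00] : _ < (0 : ℝ))
  have e5 := (key (fun q ↦ L (timeDir d)) (fun q ↦ q.2.1 q.2.2) (by fun_prop)
    (by fun_prop)).eventually_lt continuousAt_const (by simp [h00] : _ < (0 : ℝ))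
  obtain ⟨r, hr, hball⟩ := Metric.eventually_nhds_iff.1 (e1.and (e2.and (e3.and (e4.and e5))))
  refine ⟨r, hr, fun z A hz hA ↦ ?_⟩
  have hmem : ∀ w, ‖w - timeDir d‖ < r →
      dist (z, A, w) (z₀, (L : Model d →L[ℝ] Model d), timeDir d) < r := by
    intro w hw
    rw [Prod.dist_eq, Prod.dist_eq, dist_eq_norm, dist_eq_norm, dist_eq_norm]
    exact max_lt hz (max_lt hA hw)
  have h0 := hball (hmem (timeDir d) (by simpa using hr))
  exact ⟨h0.1, h0.2.1, fun w hw ↦ (hball (hmem w hw)).2.2⟩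

end Linear

section Agreement

variable {d : ℕ} {M : Type*} [TopologicalSpace M] [ChartedSpace (Model d) M]
  [IsManifold (𝓡 (d + 1)) ∞ M]
  {N : Type*} [TopologicalSpace N] [ChartedSpace (Model d) N] [IsManifold (𝓡 (d + 1)) ∞ N]
  {g : LorentzianMetric d ∞ M} {T : TimeOrientation g} {g' : LorentzianMetric d 0 N} {ι : M → N}
  {F F' : ∀ x : N, TangentSpace (𝓡 (d + 1)) x} {U : Set N} {c : ℝ → N} {γ : ℝ → M} {a b : ℝ}
  {S : Set M}

theorem mem_agreeSet_of_tangentMap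
    (hiso : ∀ (x : M) (v w : TangentSpace (𝓡 (d + 1)) x),
      g'.val (ι x) (mfderiv (𝓡 (d + 1)) (𝓡 (d + 1)) ι x v)
        (mfderiv (𝓡 (d + 1)) (𝓡 (d + 1)) ι x w) = g.val x v w)
    (hF : ∀ x ∈ U, g'.val x (F x) (F x) < 0) {Y : TangentBundle (𝓡 (d + 1)) M} (hY : Y ∈ T.cone)
    (h : tangentMap (𝓡 (d + 1)) (𝓡 (d + 1)) ι Y ∈ futureCone g' F U) :
    Y.1 ∈ agreeSet T g' ι F U := by
  obtain ⟨h1, h2, h3⟩ := h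
  refine ⟨h1, ?_⟩
  have hT := hY.2.2
  rw [← hiso, g'.symm] at hT
  rw [g'.symm] at h3
  exact g'.neg_of_neg_of_neg h2 (hF _ h1) (timelike_mfderiv_field (T := T) hiso _) h3 hT

theorem agreeSet_of_neg
    (hiso : ∀ (x : M) (v w : TangentSpace (𝓡 (d + 1)) x),
      g'.val (ι x) (mfderiv (𝓡 (d + 1)) (𝓡 (d + 1)) ι x v)
        (mfderiv (𝓡 (d + 1)) (𝓡 (d + 1)) ι x w) = g.val x v w) {x : M}
    (hx : x ∈ agreeSet T g' ι F U) (hF : g'.val (ι x) (F (ι x)) (F (ι x)) < 0)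
    (hF' : g'.val (ι x) (F' (ι x)) (F' (ι x)) < 0) (h : g'.val (ι x) (F (ι x)) (F' (ι x)) < 0) :
    x ∈ agreeSet T g' ι F' U :=
  ⟨hx.1, g'.neg_of_neg_of_neg hF hF' (timelike_mfderiv_field (T := T) hiso _) h hx.2⟩

/-- If a future directed curve of `M` continues in `N` to an end point with end velocity in the
cone of `F`, then `F` is future directed at the late points of the curve. -/
theorem eventually_mem_agreeSet (hι : IsC0Extension g g' ι) (hU : IsOpen U)
    (hF : ContinuousOn (fun x ↦ (⟨x, F x⟩ : TangentBundle (𝓡 (d + 1)) N)) U)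
    (hc : SideIn (futureCone g' F U) c (Iic b) b) (hFt : ∀ x ∈ U, g'.val x (F x) (F x) < 0)
    (hab : a < b) (hγ : ConeCurveOn T.cone γ (Ico a b)) (hιγ : ∀ t ∈ Ico a b, ι (γ t) = c t) :
    ∀ᶠ t in 𝓝[<] b, γ t ∈ agreeSet T g' ι F U := by
  filter_upwards [hc.eventually_left (isOpen_futureCone hU hF), Ioo_mem_nhdsLT hab]
    with t ht' hta
  have ht := ht'.2
  have hγt : SideIn T.cone γ (Iic t) t := hγ.left t ⟨hta.1.le, hta.2⟩
    ⟨a, ⟨le_rfl, hab⟩, hta.1⟩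
  have h1 : SideIn (tangentMap (𝓡 (d + 1)) (𝓡 (d + 1)) ι '' T.cone) (ι ∘ γ) (Iic t) t :=
    SideIn.comp isOpen_univ hι.isSmoothEmbedding.contMDiff.contMDiffOn self_mem_Iic
      (uniqueDiffWithinAt_Iic t) (mem_univ _) (hγt.mono (subset_preimage_image _ _))
  have h2 : (ι ∘ γ) =ᶠ[𝓝[Iic t] t] c := by
    filter_upwards [mem_nhdsWithin_of_mem_nhds (Ioo_mem_nhds hta.1 hta.2)] with s hs
    exact hιγ s ⟨hs.1.le, hs.2⟩
  obtain ⟨Y, hY, hYc⟩ := (h1.congr self_mem_Iic h2).mem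
  have h3 := ht.mem
  rw [← hYc] at h3
  have h4 : ι Y.1 = ι (γ t) := (congrArg Bundle.TotalSpace.proj hYc).trans
    (hιγ t ⟨hta.1.le, hta.2⟩).symm
  rw [← hι.isSmoothEmbedding.isEmbedding.injective h4]
  exact mem_agreeSet_of_tangentMap hι.isometric hFt hY h3

/-- A future inextendible curve lies in the timelike future of a Cauchy hypersurface from some
parameter on. -/
theorem eventually_mem_chronologicalFuture [T2Space M] [SecondCountableTopology M]
    (hS : IsCauchyHypersurface g S) (hab : a < b) (hγ : ConeCurveOn T.cone γ (Ico a b))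
    (hlim : ¬ ∃ q, Tendsto γ (𝓝[<] b) (𝓝 q)) :
    ∀ᶠ t in 𝓝[<] b, γ t ∈ chronologicalFuture T S := by
  obtain ⟨t, ht, y, hy, hr⟩ := hS.exists_reach_of_future_inextendible hab hγ hlim
  filter_upwards [Ioo_mem_nhdsLT ht.2] with s hs
  exact (mem_chronologicalFuture_iff T).2 ⟨y, hy, hr.trans
    (hγ.reach ordConnected_Ico ht ⟨ht.1.trans hs.1.le, hs.2⟩ hs.1)⟩

end Agreement

section Construction

variable {d : ℕ} {M : Type*} [TopologicalSpace M] [T2Space M] [SecondCountableTopology M]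
  [ChartedSpace (Model d) M] [IsManifold (𝓡 (d + 1)) ∞ M]
  {N : Type*} [TopologicalSpace N] [T2Space N] [ChartedSpace (Model d) N]
  [IsManifold (𝓡 (d + 1)) ∞ N]
  {g : LorentzianMetric d ∞ M} {T : TimeOrientation g} {g' : LorentzianMetric d 0 N} {ι : M → N}
  {S : Set M} {p : N}

/-- The adapted box about a future boundary point `p`: the frame at the centre is Lorentz
orthonormal up to a small error, and its time direction is the secant of a timelike curve ending
at `p`, so that the centre of the bottom of the box lies on this curve. -/
theorem exists_adaptedBox (hι : IsC0Extension g g' ι) (hS : IsCauchyHypersurface g S)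
    (hp : p ∈ futureBoundary T g' ι) {δ : ℝ} (hδ : 0 < δ) :
    ∃ (ε₀ ε₁ ρ η : ℝ) (φ : OpenPartialHomeomorph N (Model d)),
      AdaptedBox T g' ι S φ ε₀ ε₁ ρ η ∧ p ∈ φ.source ∧ φ p = 0 ∧
      ∀ x ∈ box d ε₀ ε₁, ∀ μ ν, |metricComponent g' φ x μ ν - minkowski d μ ν| < δ := by
  obtain ⟨hfr, c, hc, hc0, γ, hγc, hγ⟩ := hp
  have hsm := hι.isSmoothEmbedding.contMDiff
  have hpr : p ∉ range ι := fun h ↦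
    hfr.2 ((isOpen_range_of_isSmoothEmbedding hι.isSmoothEmbedding).interior_eq.symm ▸ h)
  have hγ' : ConeCurveOn T.cone γ (Ico (-1) 0) := (isFutureDirectedOn_iff.1 hγ).2.2
  have hI0 : (0 : ℝ) ∈ Icc (-1 : ℝ) 0 := by simp
  have hne0 : (Icc (-1 : ℝ) 0 ∩ Iio 0).Nonempty := ⟨-1, by simp, by simp⟩
  -- the end velocity of the curve in a chart
  set ψ := chartAt (Model d) p with hψdef
  have hψ : ψ ∈ IsManifold.maximalAtlas (𝓡 (d + 1)) ∞ N := IsManifold.chart_mem_maximalAtlas p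
  have hpψ : p ∈ ψ.source := mem_chart_source _ _
  have hside : SideIn {X | g'.val X.1 X.2 X.2 < 0} c (Iic 0) 0 :=
    ⟨hc.piecewiseSmooth.left hc.ordConnected hI0 hne0, hc.left_timelike 0 hI0 hne0⟩
  obtain ⟨w₀, hw₀, ⟨hz₀, hw₀neg⟩, hw₀vec⟩ :=
    hside.hasDerivWithinAt hψ self_mem_Iic (hc0.symm ▸ hpψ)
  rw [hc0] at hz₀ hw₀neg hw₀vec
  set z₀ := ψ p with hz₀def
  obtain ⟨a, ha, L, hL, hL0⟩ := exists_frame (g' := g') hψ hz₀ hw₀neg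
  obtain ⟨r, hr, hrad⟩ := exists_radius hψ hz₀ L hL hδ
  -- the secants of the curve converge to its end velocity
  have hsec : Tendsto (fun t ↦ (t * a)⁻¹ • (ψ (c t) - z₀)) (𝓝[<] 0) (𝓝 (L (timeDir d))) := by
    have h1 := (hasDerivWithinAt_iff_tendsto_slope' (by simp)).1 (hw₀.mono Iio_subset_Iic_self)
    have h2 := h1.const_smul a⁻¹
    rw [hL0]
    refine h2.congr fun t ↦ ?_
    simp [slope, hc0, smul_smul, mul_comm, hz₀def]
  have hcont : Tendsto (fun t ↦ ψ (c t)) (𝓝[<] 0) (𝓝 z₀) := by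
    have := (hw₀.continuousWithinAt.mono Iio_subset_Iic_self).tendsto
    simp only [Function.comp_apply, hc0] at this
    exact this
  have hcc : Tendsto c (𝓝[<] 0) (𝓝 p) := by
    have := ((hside.continuousWithinAt self_mem_Iic).mono Iio_subset_Iic_self).tendsto
    rwa [hc0] at this
  -- a region in which the time direction of the frame is timelike
  set U := ψ.source ∩ ψ ⁻¹' Metric.ball z₀ r with hU
  have hUo : IsOpen U := ψ.isOpen_inter_preimage Metric.isOpen_ball
  set F := chartField ψ (L (timeDir d)) with hFdef
  have hFc : ContinuousOn (fun x ↦ (⟨x, F x⟩ : TangentBundle (𝓡 (d + 1)) N)) U :=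
    (continuousOn_chartField hψ _).mono inter_subset_left
  have hform : ∀ x ∈ ψ.source, ∀ v w, chartForm g' ψ (ψ x) v w =
      g'.val x (chartField ψ v x) (chartField ψ w x) := by
    intro x hx v w
    simp only [chartForm, chartField]
    rw [ψ.left_inv hx]
  have hFt : ∀ x ∈ U, g'.val x (F x) (F x) < 0 := by
    intro x hx
    rw [← hform x hx.1]
    have h1 := hrad (ψ x) L (by simpa [dist_eq_norm] using hx.2) (by simpa using hr)
    exact (h1.2.2 (timeDir d) (by simpa using hr)).1
  have hpU : p ∈ U := ⟨hpψ, by simpa [hz₀def] using hr⟩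
  have hsideU : SideIn (futureCone g' F U) c (Iic 0) 0 := by
    have h1 : (z₀, w₀) ∈ coneIn (futureCone g' F ψ.source) ψ := by
      refine mem_coneIn_futureCone.2 ⟨hz₀, hw₀neg, ?_⟩
      rw [hL0, chartForm_smul_left]
      exact mul_neg_of_pos_of_neg (inv_pos.2 ha) hw₀neg
    have h2 := h1.2
    rw [hw₀vec] at h2
    refine ⟨hside.smooth, ?_, h2.2⟩
    change c 0 ∈ U
    rwa [hc0]
  have hnolim : ¬ ∃ q, Tendsto γ (𝓝[<] 0) (𝓝 q) := by
    rintro ⟨q, hq⟩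
    have h1 : (ι ∘ γ) =ᶠ[𝓝[<] 0] c := by
      filter_upwards [Ico_mem_nhdsLT (show (-1 : ℝ) < 0 by norm_num)] with s hs
      exact hγc s hs
    exact hpr ⟨q, tendsto_nhds_unique ((hsm.continuous.tendsto q).comp hq) (hcc.congr' h1.symm)⟩
  -- a late parameter of the curve
  have e1 : ∀ᶠ t in 𝓝[<] (0 : ℝ), t ∈ Ioo (-1 : ℝ) 0 := Ioo_mem_nhdsLT (by norm_num)
  have e2 := eventually_mem_chronologicalFuture hS (by norm_num) hγ' hnolim
  have e3 := eventually_mem_agreeSet hι hUo hFc hsideU hFt (by norm_num) hγ' hγc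
  have e4 := hsec.eventually (eventually_exists_equiv L hr)
  have e5 : ∀ᶠ t in 𝓝[<] (0 : ℝ), (‖(L : Model d →L[ℝ] Model d)‖ + r) * (2 * -(t * a)) < r := by
    have h1 : ContinuousAt
        (fun t ↦ (‖(L : Model d →L[ℝ] Model d)‖ + r) * (2 * -(t * a))) 0 := by fun_prop
    exact (h1.eventually_lt continuousAt_const (by simpa using hr)).filter_mono nhdsWithin_le_nhds
  obtain ⟨t, ⟨ht1, ht0⟩, htS, htA, ⟨A, hAt, hAL⟩, htr⟩ :=
    (e1.and (e2.and (e3.and (e4.and e5)))).exists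
  have hιγ : ι (γ t) = c t := hγc t ⟨ht1.le, ht0⟩
  set h := -(t * a) with hh
  have hh0 : 0 < h := by rw [hh]; nlinarith
  have hta : t * a ≠ 0 := by nlinarith
  have hctU : c t ∈ U := hιγ ▸ htA.1
  set F' := chartField ψ (A (timeDir d)) with hF'def
  have hF'A : γ t ∈ agreeSet T g' ι F' U := by
    have h1 := (hrad (ψ (c t)) A (by simpa [dist_eq_norm] using hctU.2) hAL).2.2 (timeDir d)
      (by simpa using hr)
    rw [hform _ hctU.1, hform _ hctU.1] at h1
    refine agreeSet_of_neg hι.isometric htA ?_ ?_ ?_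
    all_goals rw [hιγ]
    · exact hFt _ hctU
    · exact h1.1
    · exact h1.2.2
  -- the centre of the bottom of the box
  set x₁ : Model d := pt (-h) 0 with hx₁
  have hAx₁ : z₀ + A x₁ = ψ (c t) := by
    have h1 : x₁ = (t * a) • timeDir d := model_ext (by simp [hx₁, hh]) fun i ↦ by simp [hx₁]
    rw [h1, map_smul, hAt, smul_inv_smul₀ hta]
    abel
  have hO : IsOpen (ι '' (chronologicalFuture T S ∩ agreeSet T g' ι F' U)) :=
    isOpenMap_of_isSmoothEmbedding hι.isSmoothEmbedding _ ((isOpen_chronologicalFuture T).inter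
      (isOpen_agreeSet hsm hUo ((continuousOn_chartField hψ _).mono inter_subset_left)))
  have hx₁O : ψ.symm (z₀ + A x₁) ∈ ι '' (chronologicalFuture T S ∩ agreeSet T g' ι F' U) := by
    rw [hAx₁, ψ.left_inv hctU.1]
    exact ⟨γ t, ⟨htS, hF'A⟩, hιγ⟩
  have hcontx : ContinuousAt (fun x ↦ ψ.symm (z₀ + A x)) x₁ := by
    refine ContinuousAt.comp (f := fun x ↦ z₀ + A x) (ψ.symm.continuousAt ?_) (by fun_prop)
    rw [hAx₁]
    exact ψ.map_source hctU.1
  obtain ⟨κ, hκ, hball⟩ := Metric.eventually_nhds_iff.1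
    (hcontx.eventually (hO.mem_nhds hx₁O))
  obtain ⟨ε₁, hε₁, hcube⟩ := exists_cube_subset_ball d
    (show 0 < min (min h (κ / 2)) (r * h / 2) by positivity)
  have hbox : ∀ x ∈ box d h ε₁, ‖z₀ + A x - z₀‖ < r := by
    intro x hx
    have h1 : ‖x‖ ≤ 2 * h := by
      have h2 := norm_pt_le (x 0) (spatial x)
      rw [pt_spatial] at h2
      have h3 := (hcube _ hx.2).trans_le ((min_le_left _ _).trans (min_le_left _ _))
      have h4 := abs_lt.2 hx.1
      linarith
    have h2 : ‖(A : Model d →L[ℝ] Model d)‖ ≤ ‖(L : Model d →L[ℝ] Model d)‖ + r := by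
      have := norm_le_norm_add_norm_sub' (A : Model d →L[ℝ] Model d) L
      linarith
    have h3 := (A : Model d →L[ℝ] Model d).le_opNorm x
    rw [add_sub_cancel_left]
    calc ‖A x‖ ≤ ‖(A : Model d →L[ℝ] Model d)‖ * ‖x‖ := h3
      _ ≤ (‖(L : Model d →L[ℝ] Model d)‖ + r) * (2 * h) := by gcongr
      _ < r := htr
  obtain ⟨φ, hφ, htarget, hsymm, hvec⟩ := exists_affine_chart hψ z₀ A (isOpen_box (d := d))
    fun x hx ↦ (hrad _ A (hbox x hx) hAL).1
  have hφform : ∀ x ∈ box d h ε₁, ∀ v w, chartForm g' φ x v w =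
      chartForm g' ψ (z₀ + A x) (A v) (A w) := by
    intro x hx v w
    simp only [chartForm]
    rw [hvec x hx v, hvec x hx w, hsymm]
  have h0box : (0 : Model d) ∈ box d h ε₁ :=
    ⟨by simpa using hh0, fun i ↦ by simpa using hε₁⟩
  have hφ0 : φ.symm 0 = p := by
    rw [hsymm, map_zero, add_zero]
    exact ψ.left_inv hpψ
  refine ⟨h, ε₁, r, κ / 2, φ, ⟨hh0, hε₁, hr, by positivity, hφ, htarget, ?_, ?_, ?_, ?_⟩,
    ?_, ?_, ?_⟩
  · intro x hx w hw
    have h1 := (hrad _ A (hbox x hx) hAL).2.2 w hw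
    refine mem_coneIn_futureCone.2 ⟨htarget ▸ hx, ?_⟩
    rw [hφform x hx, hφform x hx]
    exact ⟨h1.1, h1.2.1⟩
  · intro y hy
    have := (hcube y hy).trans_le (min_le_right _ _)
    linarith
  · rwa [hφ0]
  · intro x hx hx0
    have hxt : x ∈ φ.target := htarget ▸ hx
    obtain ⟨m, ⟨hmS, hmA⟩, hm⟩ := hball (y := x) (by
      have h1 : x - x₁ = pt (x 0 + h) (spatial x) :=
        model_ext (by simp [hx₁]) fun i ↦ by simp [hx₁]
      have h2 := (hcube _ hx.2).trans_le ((min_le_left _ _).trans (min_le_right _ _))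
      have h3 : |x 0 + h| < κ / 2 := abs_lt.2 ⟨by linarith [hx.1.1], by linarith⟩
      rw [dist_eq_norm, h1]
      linarith [norm_pt_le (x 0 + h) (spatial x)])
    have hmx : ι m = φ.symm x := by rw [hm, hsymm]
    have hsrc : ι m ∈ φ.source := hmx ▸ φ.map_target hxt
    refine ⟨m, hmS, ⟨hsrc, ?_⟩, hmx⟩
    have h1 : chartField φ (timeDir d) (ι m) = F' (ι m) := by
      have e1 : φ (ι m) = x := by rw [hmx, φ.right_inv hxt]
      have e2 : ψ (ι m) = z₀ + A x := by
        rw [hm, ψ.right_inv (hrad _ A (hbox x hx) hAL).1]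
      simp only [hF'def, chartField]
      rw [e1, e2, hvec x hx]
    rw [h1]
    exact hmA.2
  · rw [← hφ0]
    exact φ.map_target (htarget ▸ h0box)
  · rw [← hφ0]
    exact φ.right_inv (htarget ▸ h0box)
  · intro x hx μ ν
    rw [metricComponent_eq_chartForm, hφform x hx]
    exact (hrad _ A (hbox x hx) hAL).2.1 μ ν

end Construction

end C0Ext

end

theorem proposition2p2 (d : ℕ)
    {M : Type*} [TopologicalSpace M] [T2Space M] [SecondCountableTopology M] [ConnectedSpace M]
    [ChartedSpace (C0Ext.Model d) M] [IsManifold (𝓡 (d + 1)) ∞ M]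
    {N : Type*} [TopologicalSpace N] [T2Space N] [SecondCountableTopology N] [ConnectedSpace N]
    [ChartedSpace (C0Ext.Model d) N] [IsManifold (𝓡 (d + 1)) ∞ N]
    (g : C0Ext.LorentzianMetric d ∞ M) (T : C0Ext.TimeOrientation g)
    (hg : C0Ext.IsGloballyHyperbolic g)
    (g' : C0Ext.LorentzianMetric d 0 N) (ι : M → N) (hι : C0Ext.IsC0Extension g g' ι)
    (p : N) (hp : p ∈ C0Ext.futureBoundary T g' ι) (δ : ℝ) (hδ : 0 < δ) :
    (∃ (ε₀ ε₁ : ℝ) (φ : OpenPartialHomeomorph N (C0Ext.Model d))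
        (f : EuclideanSpace ℝ (Fin d) → ℝ),
        C0Ext.IsBoundaryChart T g' ι p δ ε₀ ε₁ φ f) ∧
      ∀ S : Set M, C0Ext.IsCauchyHypersurface g S →
        ∃ (ε₀ ε₁ : ℝ) (φ : OpenPartialHomeomorph N (C0Ext.Model d))
          (f : EuclideanSpace ℝ (Fin d) → ℝ),
          C0Ext.IsBoundaryChart T g' ι p δ ε₀ ε₁ φ f ∧
            C0Ext.belowGraph ε₀ ε₁ f ⊆
              φ '' (ι '' C0Ext.chronologicalFuture T S ∩ φ.source) := by
  have key : ∀ S : Set M, C0Ext.IsCauchyHypersurface g S →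
      ∃ (ε₀ ε₁ : ℝ) (φ : OpenPartialHomeomorph N (C0Ext.Model d))
        (f : EuclideanSpace ℝ (Fin d) → ℝ),
        C0Ext.IsBoundaryChart T g' ι p δ ε₀ ε₁ φ f ∧
          C0Ext.belowGraph ε₀ ε₁ f ⊆
            φ '' (ι '' C0Ext.chronologicalFuture T S ∩ φ.source) := by
    intro S hS
    obtain ⟨ε₀, ε₁, ρ, η, φ, H, hpφ, hφp, hclose⟩ := C0Ext.exists_adaptedBox hι hS hp hδ
    exact ⟨ε₀, ε₁, φ, _, H.isBoundaryChart hι hS hpφ hφp hclose⟩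
  refine ⟨?_, key⟩
  obtain ⟨S, hS⟩ := hg
  obtain ⟨ε₀, ε₁, φ, f, hf, -⟩ := key S hS
  exact ⟨ε₀, ε₁, φ, f, hf⟩
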